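/- **Conventions.** Let $(\mathcal C,\otimes,\underline 1)$ be a monoidal category with coequalizers. We write the tensor product as juxtaposition, write $X$ also for the identity of $X$, and suppress associativity and unit constraints. Every object $Z$ of $\mathcal C$ is assumed to be flat, meaning (left) coflat: the functor $-\otimes Z$ preserves coequalizers. Let $(A,m,\eta)$ be an algebra in $\mathcal C$. For a right $A$-module $M$ with action $\rho$ and a left $A$-module $N$ with action $\lambda$, $M\otimes_A N$ is the coequalizer of $\rho N,\ M\lambda: MAN\to MN$. The left $A$-module $N$ is *robust* if, for every object $Z$ and every right $A$-module $M$, the functor $Z\otimes -$ preserves this coequalizer, i.e. the canonical morphism $(ZM)\otimes_A N\to Z(M\otimes_A N)$ is an isomorphism. We assume that every left $A$-module in $\mathcal C$ is robust. Then the category ${}_A\mathcal C_A$ of $A$-bimodules is monoidal with tensor product $\otimes_A$ and unit $A$. **The categories $\mathcal T_A^\#$ and ${}_A^\#\mathcal T$.** Objects of $\mathcal T_A^\#$ are pairs $(X,\psi)$ with $\psi:XA\to AX$ satisfying $\psi\circ Xm=mX\circ A\psi\circ\psi A$ and $\psi\circ X\eta=\eta X$. A morphism $(X,\psi)\to(X',\psi')$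 is a morphism $f:X\to AX'$ in $\mathcal C$ with $mX'\circ Af\circ\psi=mX'\circ A\psi'\circ fA$; the composite of $f$ and $g:X'\to AX''$ is $mX''\circ Ag\circ f$, and identities are $\eta X$. This category is monoidal, with constraints inherited from $\mathcal C$: the unit is $\underline 1$ with the canonical isomorphism $\underline 1A\cong A\underline 1$, the tensor product of $(X,\psi)$ and $(Y,\psi')$ is $(XY,\ \psi Y\circ X\psi')$, and the tensor product of $f:X\to AX'$ and $g:Y\to AY'$ is $mX'Y'\circ A\psi_{X'}Y'\circ fg:XY\to AX'Y'$. The monoidal category ${}_A^\#\mathcal T$ is its mirror image: objects are pairs $(Y,\varphi)$ with $\varphi:AY\to YA$ satisfying $\varphi\circ mY=Ym\circ\varphi A\circ A\varphi$ and $\varphi\circ\eta Y=Y\eta$, and morphisms $(Y,\varphi)\to (Y',\varphi')$ are morphisms $f:Y\to Y'A$ with $Y'm\circ fA\circ\varphi=Y'm\circ\varphi'A\circ Af$. **Cowreaths, the dual wreath, the smash product.** A *cowreath* $(A,X,\psi)$ consists of an object $(X,\psi)$ of $\mathcal T_A^\#$ with a coalgebra structure in $\mathcal T_A^\#$, i.e.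 with a comultiplication and a counit given by morphisms $\delta:X\to AXX$ and $\epsilon:X\to A$ in $\mathcal C$. Let such a cowreath be given, and assume that $X\dashv Y$ in $\mathcal C$: there are $b:\underline 1\to YX$ and $d:XY\to\underline 1$ with $Yd\circ bY=Y$ and $dX\circ Xb=X$. Then $(Y,\varphi)$ is an algebra in ${}_A^\#\mathcal T$ with $$\varphi=YAd\circ Y\psi Y\circ bAY:\ AY\to YA,$$ $$m_Y=YA\bigl(d\circ XdY\bigr)\circ Y\delta YY\circ bYY:\ YY\to YA,\qquad \eta_Y=Y\epsilon\circ b:\ \underline 1\to YA .$$ The *smash product* $YA$ is the algebra in $\mathcal C$ with underlying object $YA$, multiplication $Ym\circ m_Ym\circ Y\varphi A$ and unit $\eta_Y$. The morphism $i=Ym\circ\eta_YA:A\to YA$ is an algebra morphism, so that $YA$ is an algebra extension of $A$ and, equivalently, an $A$-ring, i.e. an algebra in ${}_A\mathcal C_A$. **Separability notions.** * A coalgebra $K$ in a monoidal category $\mathcal D$ is *coseparable* if it is relative injective as a $K$-bicomodule: if $j:M\to N$ is a $K$-bicolinear morphism for which there is a $p:N\to M$ in $\mathcal D$ with $p\circ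 j=M$, then for every $K$-bicolinear $f:M\to K$ there is a $K$-bicolinear $g:N\to K$ with $g\circ j=f$. * An algebra $S$ in a monoidal category is *separable* if its multiplication $S\otimes S\to S$ has a section that is a morphism of $S$-bimodules. * An algebra extension $A\to S$ in $\mathcal C$ is *separable* if the $S$-bimodule morphism $S\otimes_AS\to S$ induced by the multiplication of $S$ has a section that is a morphism of $S$-bimodules. * A functor $F:\mathcal D\to\mathcal E$ is *separable* if the natural transformation $\mathcal D(-,-)\to\mathcal E(F-,F-)$ induced by $F$ has a natural left inverse. * An object $P$ of $\mathcal C$ is a *left $\otimes$-generator* if, for all $f,g:UZ\to W$ in $\mathcal C$, the equalities $f\circ hZ=g\circ hZ$ for all $h:P\to U$ imply $f=g$. **Proposition.** Under the assumptions above ($\mathcal C$ has coequalizers, every object of $\mathcal C$ is flat, every left $A$-module is robust, $(A,X,\psi)$ is a cowreath in $\mathcal C$ and $X\dashv Y$ in $\mathcal C$), the following assertions are equivalent: 1. $(X,\psi)$ is a coseparable coalgebra in $\mathcal T_A^\#$; 2. $(Y,\varphi)$ is a separable algebra in ${}_A^\#\mathcal T$; 3. the smash product $YA$ is a separable algebra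 extension of $A$ in $\mathcal C$; 4. $YA$ is a separable $A$-ring, that is, a separable algebra in ${}_A\mathcal C_A$. If $\underline 1$ is a left $\otimes$-generator of $\mathcal C$, then these assertions are also equivalent to 5. the restriction of scalars functor $\mathcal C_{YA}\to\mathcal C_A$ along $i:A\to YA$, between the categories of right modules, is separable. -/

import Mathlib

open CategoryTheory MonoidalCategory MonObj Limits

universe v u

/-- A (right) transfer morphism `(X, ψ)` through the algebra `A`, i.e. an object of `𝒯_A`; the
objects of `𝒯_A^#` are the same. -/
structure RightTransfer {C : Type u} [Category.{v} C] [MonoidalCategory C] (A : C) [MonObj A] where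
  X : C
  ψ : X ⊗ A ⟶ A ⊗ X
  mul_ψ : X ◁ μ[A] ≫ ψ =
    (α_ X A A).inv ≫ ψ ▷ A ≫ (α_ A X A).hom ≫ A ◁ ψ ≫ (α_ A A X).inv ≫ μ[A] ▷ X
  one_ψ : X ◁ η[A] ≫ ψ = (ρ_ X).hom ≫ (λ_ X).inv ≫ η[A] ▷ X

namespace RightTransfer

section

variable {C : Type u} [Category.{v} C] [MonoidalCategory C] {A : C} [MonObj A]

/-- A morphism `X ⟶ Y` in the Eilenberg-Moore category `𝒯_A^#`: a morphism `f : X ⟶ A ⊗ Y` in `C`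
that is compatible with the transfer morphisms. -/
@[ext]
structure Hom (X Y : RightTransfer A) where
  f : X.X ⟶ A ⊗ Y.X
  comm : X.ψ ≫ A ◁ f ≫ (α_ A A Y.X).inv ≫ μ[A] ▷ Y.X =
    f ▷ A ≫ (α_ A Y.X A).hom ≫ A ◁ Y.ψ ≫ (α_ A A Y.X).inv ≫ μ[A] ▷ Y.X

/-- The functor `𝒯_A → 𝒯_A^#` on morphisms, `g ↦ η ⊗ g`. -/
def ofHom {X Y : RightTransfer A} (g : X.X ⟶ Y.X) (h : X.ψ ≫ A ◁ g = g ▷ A ≫ Y.ψ) : Hom X Y where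
  f := g ≫ (λ_ Y.X).inv ≫ η[A] ▷ Y.X
  comm := by
    calc _ = (X.ψ ≫ A ◁ g) ⊗≫ (A ◁ η[A] ≫ μ[A]) ▷ Y.X := by monoidal
      _ = g ▷ A ⊗≫ Y.ψ ⊗≫ (η[A] ▷ A ≫ μ[A]) ▷ Y.X := by
          rw [h, MonObj.mul_one, MonObj.one_mul]; monoidal
      _ = g ▷ A ⊗≫ (𝟙_ C ◁ Y.ψ ≫ η[A] ▷ (A ⊗ Y.X)) ⊗≫ μ[A] ▷ Y.X := by monoidal
      _ = _ := by rw [whisker_exchange]; monoidal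

/-- The composition `g • f = (m ⊗ Z) ∘ (A ⊗ g) ∘ f`. -/
def compHom {X Y Z : RightTransfer A} (f : Hom X Y) (g : Hom Y Z) : Hom X Z where
  f := f.f ≫ A ◁ g.f ≫ (α_ A A Z.X).inv ≫ μ[A] ▷ Z.X
  comm := by
    calc _ = X.ψ ⊗≫ A ◁ f.f ⊗≫ A ◁ A ◁ g.f ⊗≫ (A ◁ μ[A] ≫ μ[A]) ▷ Z.X := by monoidal
      _ = X.ψ ⊗≫ A ◁ f.f ⊗≫ ((A ⊗ A) ◁ g.f ≫ μ[A] ▷ (A ⊗ Z.X)) ⊗≫ μ[A] ▷ Z.X := by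
          rw [MonObj.mul_assoc_flip]; monoidal
      _ = (X.ψ ≫ A ◁ f.f ≫ (α_ A A Y.X).inv ≫ μ[A] ▷ Y.X) ≫ A ◁ g.f ⊗≫ μ[A] ▷ Z.X := by
          rw [whisker_exchange]; monoidal
      _ = f.f ▷ A ⊗≫ A ◁ Y.ψ ⊗≫ (μ[A] ▷ Y.X ≫ A ◁ g.f) ⊗≫ μ[A] ▷ Z.X := by
          rw [f.comm]; monoidal
      _ = f.f ▷ A ⊗≫ A ◁ (Y.ψ ≫ A ◁ g.f ≫ (α_ A A Z.X).inv ≫ μ[A] ▷ Z.X) ⊗≫ μ[A] ▷ Z.X := by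
          rw [← whisker_exchange]
          calc _ = f.f ▷ A ⊗≫ A ◁ Y.ψ ⊗≫ A ◁ A ◁ g.f ⊗≫ (μ[A] ▷ A ≫ μ[A]) ▷ Z.X := by monoidal
            _ = _ := by rw [MonObj.mul_assoc]; monoidal
      _ = f.f ▷ A ⊗≫ A ◁ g.f ▷ A ⊗≫ A ◁ A ◁ Z.ψ ⊗≫ (A ◁ μ[A] ≫ μ[A]) ▷ Z.X := by
          rw [g.comm]; monoidal
      _ = f.f ▷ A ⊗≫ A ◁ g.f ▷ A ⊗≫ ((A ⊗ A) ◁ Z.ψ ≫ μ[A] ▷ (A ⊗ Z.X)) ⊗≫ μ[A] ▷ Z.X := by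
          rw [MonObj.mul_assoc_flip]; monoidal
      _ = _ := by rw [whisker_exchange]; monoidal

/-- The category `𝒯_A^#`. -/
instance : Category (RightTransfer A) where
  Hom X Y := Hom X Y
  id X := ofHom (𝟙 X.X) (by simp)
  comp f g := compHom f g
  id_comp {X Y} f := by
    apply Hom.ext
    calc _ = 𝟙 _ ⊗≫ (η[A] ▷ X.X ≫ A ◁ f.f) ⊗≫ μ[A] ▷ Y.X := by
          dsimp [compHom, ofHom]; monoidal
      _ = f.f ⊗≫ (η[A] ▷ A ≫ μ[A]) ▷ Y.X := by rw [← whisker_exchange]; monoidal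
      _ = _ := by rw [MonObj.one_mul]; monoidal
  comp_id {X Y} f := by
    apply Hom.ext
    calc _ = f.f ⊗≫ (A ◁ η[A] ≫ μ[A]) ▷ Y.X := by dsimp [compHom, ofHom]; monoidal
      _ = _ := by rw [MonObj.mul_one]; monoidal
  assoc {X Y Z W} f g h := by
    apply Hom.ext
    calc _ = f.f ⊗≫ A ◁ g.f ⊗≫ (μ[A] ▷ Z.X ≫ A ◁ h.f) ⊗≫ μ[A] ▷ W.X := by
          dsimp [compHom]; monoidal
      _ = f.f ⊗≫ A ◁ g.f ⊗≫ A ◁ A ◁ h.f ⊗≫ (μ[A] ▷ A ≫ μ[A]) ▷ W.X := by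
          rw [← whisker_exchange]; monoidal
      _ = _ := by rw [MonObj.mul_assoc]; dsimp [compHom]; monoidal

@[ext]
theorem hom_ext {X Y : RightTransfer A} {f g : X ⟶ Y} (h : f.f = g.f) : f = g := Hom.ext h

/-- The image of a morphism of `𝒯_A` in `𝒯_A^#`. -/
def of {X Y : RightTransfer A} (g : X.X ⟶ Y.X) (h : X.ψ ≫ A ◁ g = g ▷ A ≫ Y.ψ) : X ⟶ Y :=
  ofHom g h

theorem of_f {X Y : RightTransfer A} (g : X.X ⟶ Y.X) (h : X.ψ ≫ A ◁ g = g ▷ A ≫ Y.ψ) :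
    (of g h).f = g ≫ (λ_ Y.X).inv ≫ η[A] ▷ Y.X := rfl

theorem id_f (X : RightTransfer A) : Hom.f (𝟙 X) = (λ_ X.X).inv ≫ η[A] ▷ X.X :=
  Category.id_comp _

theorem comp_f {X Y Z : RightTransfer A} (f : X ⟶ Y) (g : Y ⟶ Z) :
    Hom.f (f ≫ g) = f.f ≫ A ◁ g.f ≫ (α_ A A Z.X).inv ≫ μ[A] ▷ Z.X := rfl

theorem of_comp_f {X Y Z : RightTransfer A} (g : X.X ⟶ Y.X) (h : X.ψ ≫ A ◁ g = g ▷ A ≫ Y.ψ)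
    (f : Y ⟶ Z) : Hom.f (of g h ≫ f) = g ≫ f.f := by
  rw [comp_f, of_f]
  calc _ = g ⊗≫ (η[A] ▷ Y.X ≫ A ◁ f.f) ⊗≫ μ[A] ▷ Z.X := by monoidal
    _ = g ⊗≫ f.f ⊗≫ (η[A] ▷ A ≫ μ[A]) ▷ Z.X := by rw [← whisker_exchange]; monoidal
    _ = _ := by rw [MonObj.one_mul]; monoidal

theorem comp_of_f {X Y Z : RightTransfer A} (f : X ⟶ Y) (g : Y.X ⟶ Z.X)
    (h : Y.ψ ≫ A ◁ g = g ▷ A ≫ Z.ψ) : Hom.f (f ≫ of g h) = f.f ≫ A ◁ g := by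
  rw [comp_f, of_f]
  calc _ = f.f ⊗≫ A ◁ g ⊗≫ (A ◁ η[A] ≫ μ[A]) ▷ Z.X := by monoidal
    _ = _ := by rw [MonObj.mul_one]; monoidal

theorem of_comp_of {X Y Z : RightTransfer A} (g : X.X ⟶ Y.X) (h : X.ψ ≫ A ◁ g = g ▷ A ≫ Y.ψ)
    (g' : Y.X ⟶ Z.X) (h' : Y.ψ ≫ A ◁ g' = g' ▷ A ≫ Z.ψ) :
    of g h ≫ of g' h' = of (g ≫ g') (by
      rw [whiskerLeft_comp, comp_whiskerRight, reassoc_of% h, h', Category.assoc]) := by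
  ext
  rw [of_comp_f, of_f, of_f, Category.assoc]

theorem of_congr {X Y : RightTransfer A} {g g' : X.X ⟶ Y.X} {h : X.ψ ≫ A ◁ g = g ▷ A ≫ Y.ψ}
    {h' : X.ψ ≫ A ◁ g' = g' ▷ A ≫ Y.ψ} (e : g = g') : of g h = of g' h' := by
  subst e; rfl

theorem of_id (X : RightTransfer A) : of (𝟙 X.X) (by simp) = 𝟙 X := rfl

/-- An isomorphism of `𝒯_A`, seen in `𝒯_A^#`. -/
@[simps]
def ofIso {X Y : RightTransfer A} (g : X.X ≅ Y.X) (h : X.ψ ≫ A ◁ g.hom = g.hom ▷ A ≫ Y.ψ) :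
    X ≅ Y where
  hom := of g.hom h
  inv := of g.inv (by
    rw [← cancel_epi (g.hom ▷ A), ← cancel_mono (A ◁ g.hom)]
    simp [← h])
  hom_inv_id := by rw [of_comp_of, ← of_id]; exact of_congr g.hom_inv_id
  inv_hom_id := by rw [of_comp_of, ← of_id]; exact of_congr g.inv_hom_id

/-- The tensor product `(X ⊗ Y, (ψ_X ⊗ Y) ∘ (X ⊗ ψ_Y))`. -/
abbrev tensor (X Y : RightTransfer A) : RightTransfer A where
  X := X.X ⊗ Y.X
  ψ := (α_ X.X Y.X A).hom ≫ X.X ◁ Y.ψ ≫ (α_ X.X A Y.X).inv ≫ X.ψ ▷ Y.X ≫ (α_ A X.X Y.X).hom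
  mul_ψ := by
    calc _ = 𝟙 _ ⊗≫ X.X ◁ (Y.X ◁ μ[A] ≫ Y.ψ) ⊗≫ X.ψ ▷ Y.X ⊗≫ 𝟙 _ := by monoidal
      _ = 𝟙 _ ⊗≫ X.X ◁ Y.ψ ▷ A ⊗≫ X.X ◁ A ◁ Y.ψ ⊗≫ (X.X ◁ μ[A] ≫ X.ψ) ▷ Y.X ⊗≫ 𝟙 _ := by
          rw [Y.mul_ψ]; monoidal
      _ = 𝟙 _ ⊗≫ X.X ◁ Y.ψ ▷ A ⊗≫ ((X.X ⊗ A) ◁ Y.ψ ≫ X.ψ ▷ (A ⊗ Y.X)) ⊗≫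
            A ◁ X.ψ ▷ Y.X ⊗≫ μ[A] ▷ X.X ▷ Y.X ⊗≫ 𝟙 _ := by
          rw [X.mul_ψ]; monoidal
      _ = _ := by rw [whisker_exchange]; monoidal
  one_ψ := by
    calc _ = 𝟙 _ ⊗≫ X.X ◁ (Y.X ◁ η[A] ≫ Y.ψ) ⊗≫ X.ψ ▷ Y.X ⊗≫ 𝟙 _ := by monoidal
      _ = 𝟙 _ ⊗≫ (X.X ◁ η[A] ≫ X.ψ) ▷ Y.X ⊗≫ 𝟙 _ := by rw [Y.one_ψ]; monoidal
      _ = _ := by rw [X.one_ψ]; monoidal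

/-- The unit object `(𝟙, id_A)`. -/
abbrev unit : RightTransfer A where
  X := 𝟙_ C
  ψ := (λ_ A).hom ≫ (ρ_ A).inv
  mul_ψ := by monoidal
  one_ψ := by
    calc _ = 𝟙 _ ⊗≫ η[A] ⊗≫ 𝟙 _ := by monoidal
      _ = _ := by monoidal

/-- `f ⊗ Z`. -/
def whiskerRight {X Y : RightTransfer A} (f : X ⟶ Y) (Z : RightTransfer A) :
    Hom (tensor X Z) (tensor Y Z) where
  f := f.f ▷ Z.X ≫ (α_ A Y.X Z.X).hom
  comm := by
    dsimp
    calc _ = 𝟙 _ ⊗≫ X.X ◁ Z.ψ ⊗≫ (X.ψ ≫ A ◁ f.f ≫ (α_ A A Y.X).inv ≫ μ[A] ▷ Y.X) ▷ Z.X ⊗≫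
            𝟙 _ := by monoidal
      _ = 𝟙 _ ⊗≫ (X.X ◁ Z.ψ ≫ f.f ▷ (A ⊗ Z.X)) ⊗≫ A ◁ Y.ψ ▷ Z.X ⊗≫ μ[A] ▷ Y.X ▷ Z.X ⊗≫ 𝟙 _ := by
          rw [f.comm]; monoidal
      _ = _ := by rw [whisker_exchange]; monoidal

/-- `Z ⊗ g`. -/
def whiskerLeft (Z : RightTransfer A) {X Y : RightTransfer A} (f : X ⟶ Y) :
    Hom (tensor Z X) (tensor Z Y) where
  f := Z.X ◁ f.f ≫ (α_ Z.X A Y.X).inv ≫ Z.ψ ▷ Y.X ≫ (α_ A Z.X Y.X).hom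
  comm := by
    dsimp
    calc _ = 𝟙 _ ⊗≫ Z.X ◁ X.ψ ⊗≫ (Z.ψ ▷ X.X ≫ (A ⊗ Z.X) ◁ f.f) ⊗≫ A ◁ Z.ψ ▷ Y.X ⊗≫
            μ[A] ▷ Z.X ▷ Y.X ⊗≫ 𝟙 _ := by monoidal
      _ = 𝟙 _ ⊗≫ Z.X ◁ X.ψ ⊗≫ Z.X ◁ A ◁ f.f ⊗≫
            ((α_ Z.X A A).inv ≫ Z.ψ ▷ A ≫ (α_ A Z.X A).hom ≫ A ◁ Z.ψ ≫ (α_ A A Z.X).inv ≫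
              μ[A] ▷ Z.X) ▷ Y.X ⊗≫ 𝟙 _ := by
          rw [← whisker_exchange]; monoidal
      _ = 𝟙 _ ⊗≫ Z.X ◁ (X.ψ ≫ A ◁ f.f ≫ (α_ A A Y.X).inv ≫ μ[A] ▷ Y.X) ⊗≫ Z.ψ ▷ Y.X ⊗≫ 𝟙 _ := by
          rw [← Z.mul_ψ]; monoidal
      _ = 𝟙 _ ⊗≫ Z.X ◁ f.f ▷ A ⊗≫ Z.X ◁ A ◁ Y.ψ ⊗≫ (Z.X ◁ μ[A] ≫ Z.ψ) ▷ Y.X ⊗≫ 𝟙 _ := by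
          rw [f.comm]; monoidal
      _ = 𝟙 _ ⊗≫ Z.X ◁ f.f ▷ A ⊗≫ ((Z.X ⊗ A) ◁ Y.ψ ≫ Z.ψ ▷ (A ⊗ Y.X)) ⊗≫ A ◁ Z.ψ ▷ Y.X ⊗≫
            μ[A] ▷ Z.X ▷ Y.X ⊗≫ 𝟙 _ := by
          rw [Z.mul_ψ]; monoidal
      _ = _ := by rw [whisker_exchange]; monoidal

instance : MonoidalCategoryStruct (RightTransfer A) where
  tensorObj := tensor
  tensorUnit := unit
  whiskerLeft Z _ _ f := whiskerLeft Z f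
  whiskerRight f Z := whiskerRight f Z
  tensorHom {_ Y₁ X₂ _} f g := compHom (whiskerRight f X₂) (whiskerLeft Y₁ g)
  associator X Y Z := ofIso (α_ X.X Y.X Z.X) (by dsimp; monoidal)
  leftUnitor X := ofIso (λ_ X.X) (by dsimp; monoidal)
  rightUnitor X := ofIso (ρ_ X.X) (by dsimp; monoidal)

theorem tensorObj_X (X Y : RightTransfer A) : (X ⊗ Y).X = X.X ⊗ Y.X := rfl

theorem tensorObj_ψ (X Y : RightTransfer A) : (X ⊗ Y).ψ = (α_ X.X Y.X A).hom ≫ X.X ◁ Y.ψ ≫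
    (α_ X.X A Y.X).inv ≫ X.ψ ▷ Y.X ≫ (α_ A X.X Y.X).hom := rfl

theorem tensorUnit_X : (𝟙_ (RightTransfer A)).X = 𝟙_ C := rfl

theorem tensorUnit_ψ : (𝟙_ (RightTransfer A)).ψ = (λ_ A).hom ≫ (ρ_ A).inv := rfl

theorem whiskerRight_f {X Y : RightTransfer A} (f : X ⟶ Y) (Z : RightTransfer A) :
    Hom.f (f ▷ Z) = f.f ▷ Z.X ≫ (α_ A Y.X Z.X).hom := rfl

theorem whiskerLeft_f (Z : RightTransfer A) {X Y : RightTransfer A} (f : X ⟶ Y) :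
    Hom.f (Z ◁ f) = Z.X ◁ f.f ≫ (α_ Z.X A Y.X).inv ≫ Z.ψ ▷ Y.X ≫ (α_ A Z.X Y.X).hom := rfl

theorem tensorHom_eq {X₁ Y₁ X₂ Y₂ : RightTransfer A} (f : X₁ ⟶ Y₁) (g : X₂ ⟶ Y₂) :
    f ⊗ₘ g = f ▷ X₂ ≫ Y₁ ◁ g := rfl

theorem associator_hom_eq (X Y Z : RightTransfer A) :
    (α_ X Y Z).hom = of (α_ X.X Y.X Z.X).hom (by
      simp only [tensorObj_ψ, tensorObj_X]; monoidal) := rfl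

theorem associator_hom_f (X Y Z : RightTransfer A) : Hom.f (α_ X Y Z).hom =
    (α_ X.X Y.X Z.X).hom ≫ (λ_ _).inv ≫ η[A] ▷ _ := rfl

theorem whiskerRight_of {X Y : RightTransfer A} (g : X.X ⟶ Y.X) (h : X.ψ ≫ A ◁ g = g ▷ A ≫ Y.ψ)
    (Z : RightTransfer A) : of g h ▷ Z = of (Y := Y ⊗ Z) (X := X ⊗ Z) (g ▷ Z.X) (by
      simp only [tensorObj_ψ, tensorObj_X]
      calc _ = 𝟙 _ ⊗≫ X.X ◁ Z.ψ ⊗≫ (X.ψ ≫ A ◁ g) ▷ Z.X ⊗≫ 𝟙 _ := by monoidal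
        _ = 𝟙 _ ⊗≫ (X.X ◁ Z.ψ ≫ g ▷ (A ⊗ Z.X)) ⊗≫ Y.ψ ▷ Z.X ⊗≫ 𝟙 _ := by rw [h]; monoidal
        _ = _ := by rw [whisker_exchange]; monoidal) := by
  ext
  rw [whiskerRight_f, of_f, of_f]
  monoidal

theorem whiskerLeft_of (Z : RightTransfer A) {X Y : RightTransfer A} (g : X.X ⟶ Y.X)
    (h : X.ψ ≫ A ◁ g = g ▷ A ≫ Y.ψ) : Z ◁ of g h = of (Y := Z ⊗ Y) (X := Z ⊗ X) (Z.X ◁ g) (by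
      simp only [tensorObj_ψ, tensorObj_X]
      calc _ = 𝟙 _ ⊗≫ Z.X ◁ X.ψ ⊗≫ (Z.ψ ▷ X.X ≫ (A ⊗ Z.X) ◁ g) ⊗≫ 𝟙 _ := by monoidal
        _ = 𝟙 _ ⊗≫ Z.X ◁ (X.ψ ≫ A ◁ g) ⊗≫ Z.ψ ▷ Y.X ⊗≫ 𝟙 _ := by
            rw [← whisker_exchange]; monoidal
        _ = _ := by rw [h]; monoidal) := by
  ext
  rw [whiskerLeft_f, of_f, of_f]
  calc _ = 𝟙 _ ⊗≫ Z.X ◁ g ⊗≫ (Z.X ◁ η[A] ≫ Z.ψ) ▷ Y.X ⊗≫ 𝟙 _ := by monoidal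
    _ = _ := by rw [Z.one_ψ]; monoidal

theorem id_whiskerRight' (X Z : RightTransfer A) : 𝟙 X ▷ Z = 𝟙 (X ⊗ Z) := by
  rw [← of_id, whiskerRight_of, ← of_id]
  exact of_congr (id_whiskerRight _ _)

theorem whiskerLeft_id' (Z X : RightTransfer A) : Z ◁ 𝟙 X = 𝟙 (Z ⊗ X) := by
  rw [← of_id, whiskerLeft_of, ← of_id]
  exact of_congr (whiskerLeft_id _ _)

theorem comp_whiskerRight' {X Y W : RightTransfer A} (f : X ⟶ Y) (g : Y ⟶ W)
    (Z : RightTransfer A) : (f ≫ g) ▷ Z = f ▷ Z ≫ g ▷ Z := by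
  ext
  simp only [whiskerRight_f, comp_f, tensorObj_X]
  monoidal

theorem whiskerLeft_comp' (Z : RightTransfer A) {X Y W : RightTransfer A} (f : X ⟶ Y)
    (g : Y ⟶ W) : Z ◁ (f ≫ g) = Z ◁ f ≫ Z ◁ g := by
  ext
  simp only [whiskerLeft_f, comp_f, tensorObj_X]
  calc _ = 𝟙 _ ⊗≫ Z.X ◁ f.f ⊗≫ Z.X ◁ A ◁ g.f ⊗≫ (Z.X ◁ μ[A] ≫ Z.ψ) ▷ W.X ⊗≫ 𝟙 _ := by monoidal
    _ = 𝟙 _ ⊗≫ Z.X ◁ f.f ⊗≫ ((Z.X ⊗ A) ◁ g.f ≫ Z.ψ ▷ (A ⊗ W.X)) ⊗≫ A ◁ Z.ψ ▷ W.X ⊗≫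
          μ[A] ▷ Z.X ▷ W.X ⊗≫ 𝟙 _ := by
        rw [Z.mul_ψ]; monoidal
    _ = _ := by rw [whisker_exchange]; monoidal

theorem whisker_exchange' {W X Y Z : RightTransfer A} (f : W ⟶ X) (g : Y ⟶ Z) :
    W ◁ g ≫ f ▷ Z = f ▷ Y ≫ X ◁ g := by
  ext
  simp only [whiskerLeft_f, whiskerRight_f, comp_f, tensorObj_X]
  calc _ = 𝟙 _ ⊗≫ W.X ◁ g.f ⊗≫ (W.ψ ≫ A ◁ f.f ≫ (α_ A A X.X).inv ≫ μ[A] ▷ X.X) ▷ Z.X ⊗≫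
          𝟙 _ := by monoidal
    _ = 𝟙 _ ⊗≫ (W.X ◁ g.f ≫ f.f ▷ (A ⊗ Z.X)) ⊗≫ A ◁ X.ψ ▷ Z.X ⊗≫ μ[A] ▷ X.X ▷ Z.X ⊗≫ 𝟙 _ := by
        rw [f.comm]; monoidal
    _ = _ := by rw [whisker_exchange]; monoidal

/-- The tensor product of `f` and `g` in `𝒯_A^#` is `(m ⊗ X' ⊗ Y') ∘ (A ⊗ ψ ⊗ Y') ∘ (f ⊗ g)`. -/
theorem tensorHom_f {X X' Y Y' : RightTransfer A} (f : X ⟶ X') (g : Y ⟶ Y') :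
    Hom.f (f ⊗ₘ g) = (f.f ⊗ₘ g.f) ≫ (α_ A X'.X (A ⊗ Y'.X)).hom ≫ A ◁ (α_ X'.X A Y'.X).inv ≫
      A ◁ X'.ψ ▷ Y'.X ≫ A ◁ (α_ A X'.X Y'.X).hom ≫ (α_ A A (X'.X ⊗ Y'.X)).inv ≫
        μ[A] ▷ (X'.X ⊗ Y'.X) := by
  rw [tensorHom_eq, MonoidalCategory.tensorHom_def]
  simp only [whiskerLeft_f, whiskerRight_f, comp_f, tensorObj_X]
  monoidal

theorem leftUnitor_hom_eq (X : RightTransfer A) : (λ_ X).hom =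
    of (λ_ X.X).hom (by
      simp only [tensorObj_ψ, tensorObj_X, tensorUnit_ψ, tensorUnit_X]; monoidal) := rfl

theorem rightUnitor_hom_eq (X : RightTransfer A) : (ρ_ X).hom =
    of (ρ_ X.X).hom (by
      simp only [tensorObj_ψ, tensorObj_X, tensorUnit_ψ, tensorUnit_X]; monoidal) := rfl

theorem whiskerRight_tensor' {X X' : RightTransfer A} (f : X ⟶ X') (Y Z : RightTransfer A) :
    f ▷ Y ▷ Z ≫ (α_ X' Y Z).hom = (α_ X Y Z).hom ≫ f ▷ (Y ⊗ Z) := by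
  ext
  rw [associator_hom_eq, associator_hom_eq, comp_of_f, of_comp_f]
  simp only [whiskerRight_f, tensorObj_X]
  monoidal

theorem whisker_assoc' (X : RightTransfer A) {Y Y' : RightTransfer A} (g : Y ⟶ Y')
    (Z : RightTransfer A) :
    (X ◁ g) ▷ Z ≫ (α_ X Y' Z).hom = (α_ X Y Z).hom ≫ X ◁ g ▷ Z := by
  ext
  rw [associator_hom_eq, associator_hom_eq, comp_of_f, of_comp_f]
  simp only [whiskerRight_f, whiskerLeft_f, tensorObj_X]
  monoidal

theorem tensor_whiskerLeft' (X Y : RightTransfer A) {Z Z' : RightTransfer A} (h : Z ⟶ Z') :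
    (X ⊗ Y) ◁ h ≫ (α_ X Y Z').hom = (α_ X Y Z).hom ≫ X ◁ Y ◁ h := by
  ext
  rw [associator_hom_eq, associator_hom_eq, comp_of_f, of_comp_f]
  simp only [whiskerLeft_f, tensorObj_X, tensorObj_ψ]
  monoidal

/-- The monoidal category `𝒯_A^#`. -/
instance : MonoidalCategory (RightTransfer A) where
  id_tensorHom_id X Y := by
    rw [tensorHom_eq, id_whiskerRight', whiskerLeft_id', Category.comp_id]
  tensorHom_comp_tensorHom f g f' g' := by
    simp only [tensorHom_eq, comp_whiskerRight', whiskerLeft_comp', Category.assoc]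
    rw [← reassoc_of% (whisker_exchange' f' g)]
  whiskerLeft_id := whiskerLeft_id'
  id_whiskerRight := id_whiskerRight'
  associator_naturality f g h := by
    simp only [tensorHom_eq, comp_whiskerRight', whiskerLeft_comp', Category.assoc]
    rw [tensor_whiskerLeft', reassoc_of% whisker_assoc', reassoc_of% whiskerRight_tensor']
  leftUnitor_naturality f := by
    ext
    rw [leftUnitor_hom_eq, leftUnitor_hom_eq, comp_of_f, of_comp_f, whiskerLeft_f]
    simp only [tensorUnit_X, tensorUnit_ψ]
    monoidal
  rightUnitor_naturality f := by
    ext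
    rw [rightUnitor_hom_eq, rightUnitor_hom_eq, comp_of_f, of_comp_f, whiskerRight_f]
    simp only [tensorUnit_X]
    monoidal
  pentagon W X Y Z := by
    simp only [associator_hom_eq, whiskerLeft_of, whiskerRight_of, of_comp_of]
    exact of_congr (pentagon _ _ _ _)
  triangle X Y := by
    simp only [associator_hom_eq, leftUnitor_hom_eq, rightUnitor_hom_eq, whiskerLeft_of,
      whiskerRight_of, of_comp_of]
    exact of_congr (triangle _ _)

end

end RightTransfer
/-- A left transfer morphism `(X, φ)` through the algebra `A`, i.e. an object of `_A𝒯`; the objects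
of `_A^#𝒯` are the same. -/
structure LeftTransfer {C : Type u} [Category.{v} C] [MonoidalCategory C] (A : C) [MonObj A] where
  X : C
  φ : A ⊗ X ⟶ X ⊗ A
  mul_φ : μ[A] ▷ X ≫ φ =
    (α_ A A X).hom ≫ A ◁ φ ≫ (α_ A X A).inv ≫ φ ▷ A ≫ (α_ X A A).hom ≫ X ◁ μ[A]
  one_φ : η[A] ▷ X ≫ φ = (λ_ X).hom ≫ (ρ_ X).inv ≫ X ◁ η[A]

namespace LeftTransfer

section

variable {C : Type u} [Category.{v} C] [MonoidalCategory C] {A : C} [MonObj A]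

/-- A morphism `X ⟶ Y` in the Eilenberg-Moore category `_A^#𝒯`: a morphism `f : X ⟶ Y ⊗ A` in `C`
that is compatible with the transfer morphisms. -/
@[ext]
structure Hom (X Y : LeftTransfer A) where
  f : X.X ⟶ Y.X ⊗ A
  comm : X.φ ≫ f ▷ A ≫ (α_ Y.X A A).hom ≫ Y.X ◁ μ[A] =
    A ◁ f ≫ (α_ A Y.X A).inv ≫ Y.φ ▷ A ≫ (α_ Y.X A A).hom ≫ Y.X ◁ μ[A]

/-- The functor `_A𝒯 → _A^#𝒯` on morphisms, `g ↦ g ⊗ η`. -/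
def ofHom {X Y : LeftTransfer A} (g : X.X ⟶ Y.X) (h : X.φ ≫ g ▷ A = A ◁ g ≫ Y.φ) : Hom X Y where
  f := g ≫ (ρ_ Y.X).inv ≫ Y.X ◁ η[A]
  comm := by
    calc _ = (X.φ ≫ g ▷ A) ⊗≫ Y.X ◁ (η[A] ▷ A ≫ μ[A]) := by monoidal
      _ = A ◁ g ⊗≫ Y.φ ⊗≫ Y.X ◁ (A ◁ η[A] ≫ μ[A]) := by
          rw [h, MonObj.one_mul, MonObj.mul_one]; monoidal
      _ = A ◁ g ⊗≫ (Y.φ ▷ 𝟙_ C ≫ (Y.X ⊗ A) ◁ η[A]) ⊗≫ Y.X ◁ μ[A] := by monoidal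
      _ = _ := by rw [← whisker_exchange]; monoidal

/-- The composition `g • f = (Z ⊗ m) ∘ (g ⊗ A) ∘ f`. -/
def compHom {X Y Z : LeftTransfer A} (f : Hom X Y) (g : Hom Y Z) : Hom X Z where
  f := f.f ≫ g.f ▷ A ≫ (α_ Z.X A A).hom ≫ Z.X ◁ μ[A]
  comm := by
    calc _ = X.φ ⊗≫ f.f ▷ A ⊗≫ g.f ▷ A ▷ A ⊗≫ Z.X ◁ (μ[A] ▷ A ≫ μ[A]) := by monoidal
      _ = X.φ ⊗≫ f.f ▷ A ⊗≫ (g.f ▷ (A ⊗ A) ≫ (Z.X ⊗ A) ◁ μ[A]) ⊗≫ Z.X ◁ μ[A] := by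
          rw [MonObj.mul_assoc]; monoidal
      _ = (X.φ ≫ f.f ▷ A ≫ (α_ Y.X A A).hom ≫ Y.X ◁ μ[A]) ≫ g.f ▷ A ⊗≫ Z.X ◁ μ[A] := by
          rw [← whisker_exchange]; monoidal
      _ = A ◁ f.f ⊗≫ Y.φ ▷ A ⊗≫ (Y.X ◁ μ[A] ≫ g.f ▷ A) ⊗≫ Z.X ◁ μ[A] := by
          rw [f.comm]; monoidal
      _ = A ◁ f.f ⊗≫ (Y.φ ≫ g.f ▷ A ≫ (α_ Z.X A A).hom ≫ Z.X ◁ μ[A]) ▷ A ⊗≫ Z.X ◁ μ[A] := by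
          rw [whisker_exchange]
          calc _ = A ◁ f.f ⊗≫ Y.φ ▷ A ⊗≫ g.f ▷ A ▷ A ⊗≫ Z.X ◁ (A ◁ μ[A] ≫ μ[A]) := by monoidal
            _ = _ := by rw [MonObj.mul_assoc_flip]; monoidal
      _ = A ◁ f.f ⊗≫ A ◁ g.f ▷ A ⊗≫ Z.φ ▷ A ▷ A ⊗≫ Z.X ◁ (μ[A] ▷ A ≫ μ[A]) := by
          rw [g.comm]; monoidal
      _ = A ◁ f.f ⊗≫ A ◁ g.f ▷ A ⊗≫ (Z.φ ▷ (A ⊗ A) ≫ (Z.X ⊗ A) ◁ μ[A]) ⊗≫ Z.X ◁ μ[A] := by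
          rw [MonObj.mul_assoc]; monoidal
      _ = _ := by rw [← whisker_exchange]; monoidal

/-- The category `_A^#𝒯`. -/
instance : Category (LeftTransfer A) where
  Hom X Y := Hom X Y
  id X := ofHom (𝟙 X.X) (by simp)
  comp f g := compHom f g
  id_comp {X Y} f := by
    apply Hom.ext
    calc _ = 𝟙 _ ⊗≫ (X.X ◁ η[A] ≫ f.f ▷ A) ⊗≫ Y.X ◁ μ[A] := by
          dsimp [compHom, ofHom]; monoidal
      _ = f.f ⊗≫ Y.X ◁ (A ◁ η[A] ≫ μ[A]) := by rw [whisker_exchange]; monoidal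
      _ = _ := by rw [MonObj.mul_one]; monoidal
  comp_id {X Y} f := by
    apply Hom.ext
    calc _ = f.f ⊗≫ Y.X ◁ (η[A] ▷ A ≫ μ[A]) := by dsimp [compHom, ofHom]; monoidal
      _ = _ := by rw [MonObj.one_mul]; monoidal
  assoc {X Y Z W} f g h := by
    apply Hom.ext
    calc _ = f.f ⊗≫ g.f ▷ A ⊗≫ (Z.X ◁ μ[A] ≫ h.f ▷ A) ⊗≫ W.X ◁ μ[A] := by
          dsimp [compHom]; monoidal
      _ = f.f ⊗≫ g.f ▷ A ⊗≫ h.f ▷ A ▷ A ⊗≫ W.X ◁ (A ◁ μ[A] ≫ μ[A]) := by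
          rw [whisker_exchange]; monoidal
      _ = _ := by rw [MonObj.mul_assoc_flip]; dsimp [compHom]; monoidal

@[ext]
theorem hom_ext {X Y : LeftTransfer A} {f g : X ⟶ Y} (h : f.f = g.f) : f = g := Hom.ext h

/-- The image of a morphism of `_A𝒯` in `_A^#𝒯`. -/
def of {X Y : LeftTransfer A} (g : X.X ⟶ Y.X) (h : X.φ ≫ g ▷ A = A ◁ g ≫ Y.φ) : X ⟶ Y :=
  ofHom g h

theorem of_f {X Y : LeftTransfer A} (g : X.X ⟶ Y.X) (h : X.φ ≫ g ▷ A = A ◁ g ≫ Y.φ) :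
    (of g h).f = g ≫ (ρ_ Y.X).inv ≫ Y.X ◁ η[A] := rfl

theorem id_f (X : LeftTransfer A) : Hom.f (𝟙 X) = (ρ_ X.X).inv ≫ X.X ◁ η[A] :=
  Category.id_comp _

theorem comp_f {X Y Z : LeftTransfer A} (f : X ⟶ Y) (g : Y ⟶ Z) :
    Hom.f (f ≫ g) = f.f ≫ g.f ▷ A ≫ (α_ Z.X A A).hom ≫ Z.X ◁ μ[A] := rfl

theorem of_comp_f {X Y Z : LeftTransfer A} (g : X.X ⟶ Y.X) (h : X.φ ≫ g ▷ A = A ◁ g ≫ Y.φ)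
    (f : Y ⟶ Z) : Hom.f (of g h ≫ f) = g ≫ f.f := by
  rw [comp_f, of_f]
  calc _ = g ⊗≫ (Y.X ◁ η[A] ≫ f.f ▷ A) ⊗≫ Z.X ◁ μ[A] := by monoidal
    _ = g ⊗≫ f.f ⊗≫ Z.X ◁ (A ◁ η[A] ≫ μ[A]) := by rw [whisker_exchange]; monoidal
    _ = _ := by rw [MonObj.mul_one]; monoidal

theorem comp_of_f {X Y Z : LeftTransfer A} (f : X ⟶ Y) (g : Y.X ⟶ Z.X)
    (h : Y.φ ≫ g ▷ A = A ◁ g ≫ Z.φ) : Hom.f (f ≫ of g h) = f.f ≫ g ▷ A := by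
  rw [comp_f, of_f]
  calc _ = f.f ⊗≫ g ▷ A ⊗≫ Z.X ◁ (η[A] ▷ A ≫ μ[A]) := by monoidal
    _ = _ := by rw [MonObj.one_mul]; monoidal

theorem of_comp_of {X Y Z : LeftTransfer A} (g : X.X ⟶ Y.X) (h : X.φ ≫ g ▷ A = A ◁ g ≫ Y.φ)
    (g' : Y.X ⟶ Z.X) (h' : Y.φ ≫ g' ▷ A = A ◁ g' ≫ Z.φ) :
    of g h ≫ of g' h' = of (g ≫ g') (by
      rw [comp_whiskerRight, whiskerLeft_comp, reassoc_of% h, h', Category.assoc]) := by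
  ext
  rw [of_comp_f, of_f, of_f, Category.assoc]

theorem of_congr {X Y : LeftTransfer A} {g g' : X.X ⟶ Y.X} {h : X.φ ≫ g ▷ A = A ◁ g ≫ Y.φ}
    {h' : X.φ ≫ g' ▷ A = A ◁ g' ≫ Y.φ} (e : g = g') : of g h = of g' h' := by
  subst e; rfl

theorem of_id (X : LeftTransfer A) : of (𝟙 X.X) (by simp) = 𝟙 X := rfl

/-- An isomorphism of `_A𝒯`, seen in `_A^#𝒯`. -/
@[simps]
def ofIso {X Y : LeftTransfer A} (g : X.X ≅ Y.X) (h : X.φ ≫ g.hom ▷ A = A ◁ g.hom ≫ Y.φ) :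
    X ≅ Y where
  hom := of g.hom h
  inv := of g.inv (by
    rw [← cancel_epi (A ◁ g.hom), ← cancel_mono (g.hom ▷ A)]
    simp [← h])
  hom_inv_id := by rw [of_comp_of, ← of_id]; exact of_congr g.hom_inv_id
  inv_hom_id := by rw [of_comp_of, ← of_id]; exact of_congr g.inv_hom_id

/-- The tensor product `(X ⊗ Y, (X ⊗ φ_Y) ∘ (φ_X ⊗ Y))`. -/
abbrev tensor (X Y : LeftTransfer A) : LeftTransfer A where
  X := X.X ⊗ Y.X
  φ := (α_ A X.X Y.X).inv ≫ X.φ ▷ Y.X ≫ (α_ X.X A Y.X).hom ≫ X.X ◁ Y.φ ≫ (α_ X.X Y.X A).inv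
  mul_φ := by
    calc _ = 𝟙 _ ⊗≫ (μ[A] ▷ X.X ≫ X.φ) ▷ Y.X ⊗≫ X.X ◁ Y.φ ⊗≫ 𝟙 _ := by monoidal
      _ = 𝟙 _ ⊗≫ A ◁ X.φ ▷ Y.X ⊗≫ X.φ ▷ A ▷ Y.X ⊗≫ X.X ◁ (μ[A] ▷ Y.X ≫ Y.φ) ⊗≫ 𝟙 _ := by
          rw [X.mul_φ]; monoidal
      _ = 𝟙 _ ⊗≫ A ◁ X.φ ▷ Y.X ⊗≫ (X.φ ▷ (A ⊗ Y.X) ≫ (X.X ⊗ A) ◁ Y.φ) ⊗≫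
            X.X ◁ Y.φ ▷ A ⊗≫ X.X ◁ Y.X ◁ μ[A] ⊗≫ 𝟙 _ := by
          rw [Y.mul_φ]; monoidal
      _ = _ := by rw [← whisker_exchange]; monoidal
  one_φ := by
    calc _ = 𝟙 _ ⊗≫ (η[A] ▷ X.X ≫ X.φ) ▷ Y.X ⊗≫ X.X ◁ Y.φ ⊗≫ 𝟙 _ := by monoidal
      _ = 𝟙 _ ⊗≫ X.X ◁ (η[A] ▷ Y.X ≫ Y.φ) ⊗≫ 𝟙 _ := by rw [X.one_φ]; monoidal
      _ = _ := by rw [Y.one_φ]; monoidal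

/-- The unit object `(𝟙, id_A)`. -/
abbrev unit : LeftTransfer A where
  X := 𝟙_ C
  φ := (ρ_ A).hom ≫ (λ_ A).inv
  mul_φ := by monoidal
  one_φ := by
    calc _ = 𝟙 _ ⊗≫ η[A] ⊗≫ 𝟙 _ := by monoidal
      _ = _ := by monoidal

/-- `f ⊗ Z`. -/
def whiskerRight {X Y : LeftTransfer A} (f : X ⟶ Y) (Z : LeftTransfer A) :
    Hom (tensor X Z) (tensor Y Z) where
  f := f.f ▷ Z.X ≫ (α_ Y.X A Z.X).hom ≫ Y.X ◁ Z.φ ≫ (α_ Y.X Z.X A).inv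
  comm := by
    calc _ = 𝟙 _ ⊗≫ X.φ ▷ Z.X ⊗≫ (X.X ◁ Z.φ ≫ f.f ▷ (Z.X ⊗ A)) ⊗≫ Y.X ◁ Z.φ ▷ A ⊗≫
            Y.X ◁ Z.X ◁ μ[A] ⊗≫ 𝟙 _ := by monoidal
      _ = 𝟙 _ ⊗≫ X.φ ▷ Z.X ⊗≫ f.f ▷ A ▷ Z.X ⊗≫
            Y.X ◁ ((α_ A A Z.X).hom ≫ A ◁ Z.φ ≫ (α_ A Z.X A).inv ≫ Z.φ ▷ A ≫ (α_ Z.X A A).hom ≫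
              Z.X ◁ μ[A]) ⊗≫ 𝟙 _ := by
          rw [whisker_exchange]; monoidal
      _ = 𝟙 _ ⊗≫ (X.φ ≫ f.f ▷ A ≫ (α_ Y.X A A).hom ≫ Y.X ◁ μ[A]) ▷ Z.X ⊗≫ Y.X ◁ Z.φ ⊗≫ 𝟙 _ := by
          rw [← Z.mul_φ]; monoidal
      _ = 𝟙 _ ⊗≫ A ◁ f.f ▷ Z.X ⊗≫ Y.φ ▷ A ▷ Z.X ⊗≫ Y.X ◁ (μ[A] ▷ Z.X ≫ Z.φ) ⊗≫ 𝟙 _ := by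
          rw [f.comm]; monoidal
      _ = 𝟙 _ ⊗≫ A ◁ f.f ▷ Z.X ⊗≫ (Y.φ ▷ (A ⊗ Z.X) ≫ (Y.X ⊗ A) ◁ Z.φ) ⊗≫ Y.X ◁ Z.φ ▷ A ⊗≫
            Y.X ◁ Z.X ◁ μ[A] ⊗≫ 𝟙 _ := by
          rw [Z.mul_φ]; monoidal
      _ = _ := by rw [← whisker_exchange]; monoidal

/-- `Z ⊗ f`. -/
def whiskerLeft (Z : LeftTransfer A) {X Y : LeftTransfer A} (f : X ⟶ Y) :
    Hom (tensor Z X) (tensor Z Y) where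
  f := Z.X ◁ f.f ≫ (α_ Z.X Y.X A).inv
  comm := by
    calc _ = 𝟙 _ ⊗≫ Z.φ ▷ X.X ⊗≫ Z.X ◁ (X.φ ≫ f.f ▷ A ≫ (α_ Y.X A A).hom ≫ Y.X ◁ μ[A]) ⊗≫
            𝟙 _ := by monoidal
      _ = 𝟙 _ ⊗≫ (Z.φ ▷ X.X ≫ (Z.X ⊗ A) ◁ f.f) ⊗≫ Z.X ◁ Y.φ ▷ A ⊗≫ Z.X ◁ Y.X ◁ μ[A] ⊗≫ 𝟙 _ := by
          rw [f.comm]; monoidal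
      _ = _ := by rw [← whisker_exchange]; monoidal

instance : MonoidalCategoryStruct (LeftTransfer A) where
  tensorObj := tensor
  tensorUnit := unit
  whiskerLeft Z _ _ f := whiskerLeft Z f
  whiskerRight f Z := whiskerRight f Z
  tensorHom {_ Y₁ X₂ _} f g := compHom (whiskerRight f X₂) (whiskerLeft Y₁ g)
  associator X Y Z := ofIso (α_ X.X Y.X Z.X) (by dsimp; monoidal)
  leftUnitor X := ofIso (λ_ X.X) (by dsimp; monoidal)
  rightUnitor X := ofIso (ρ_ X.X) (by dsimp; monoidal)

theorem tensorObj_X (X Y : LeftTransfer A) : (X ⊗ Y).X = X.X ⊗ Y.X := rfl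

theorem tensorObj_φ (X Y : LeftTransfer A) : (X ⊗ Y).φ = (α_ A X.X Y.X).inv ≫ X.φ ▷ Y.X ≫
    (α_ X.X A Y.X).hom ≫ X.X ◁ Y.φ ≫ (α_ X.X Y.X A).inv := rfl

theorem tensorUnit_X : (𝟙_ (LeftTransfer A)).X = 𝟙_ C := rfl

theorem tensorUnit_φ : (𝟙_ (LeftTransfer A)).φ = (ρ_ A).hom ≫ (λ_ A).inv := rfl

theorem whiskerLeft_f (Z : LeftTransfer A) {X Y : LeftTransfer A} (f : X ⟶ Y) :
    Hom.f (Z ◁ f) = Z.X ◁ f.f ≫ (α_ Z.X Y.X A).inv := rfl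

theorem whiskerRight_f {X Y : LeftTransfer A} (f : X ⟶ Y) (Z : LeftTransfer A) :
    Hom.f (f ▷ Z) = f.f ▷ Z.X ≫ (α_ Y.X A Z.X).hom ≫ Y.X ◁ Z.φ ≫ (α_ Y.X Z.X A).inv := rfl

theorem tensorHom_eq {X₁ Y₁ X₂ Y₂ : LeftTransfer A} (f : X₁ ⟶ Y₁) (g : X₂ ⟶ Y₂) :
    f ⊗ₘ g = f ▷ X₂ ≫ Y₁ ◁ g := rfl

theorem associator_hom_eq (X Y Z : LeftTransfer A) :
    (α_ X Y Z).hom = of (α_ X.X Y.X Z.X).hom (by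
      simp only [tensorObj_φ, tensorObj_X]; monoidal) := rfl

theorem whiskerLeft_of (Z : LeftTransfer A) {X Y : LeftTransfer A} (g : X.X ⟶ Y.X)
    (h : X.φ ≫ g ▷ A = A ◁ g ≫ Y.φ) : Z ◁ of g h = of (Y := Z ⊗ Y) (X := Z ⊗ X) (Z.X ◁ g) (by
      simp only [tensorObj_φ, tensorObj_X]
      calc _ = 𝟙 _ ⊗≫ Z.φ ▷ X.X ⊗≫ Z.X ◁ (X.φ ≫ g ▷ A) ⊗≫ 𝟙 _ := by monoidal
        _ = 𝟙 _ ⊗≫ (Z.φ ▷ X.X ≫ (Z.X ⊗ A) ◁ g) ⊗≫ Z.X ◁ Y.φ ⊗≫ 𝟙 _ := by rw [h]; monoidal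
        _ = _ := by rw [← whisker_exchange]; monoidal) := by
  ext
  rw [whiskerLeft_f, of_f, of_f]
  monoidal

theorem whiskerRight_of {X Y : LeftTransfer A} (g : X.X ⟶ Y.X)
    (h : X.φ ≫ g ▷ A = A ◁ g ≫ Y.φ) (Z : LeftTransfer A) : of g h ▷ Z = of (Y := Y ⊗ Z) (X := X ⊗ Z) (g ▷ Z.X) (by
      simp only [tensorObj_φ, tensorObj_X]
      calc _ = 𝟙 _ ⊗≫ X.φ ▷ Z.X ⊗≫ (X.X ◁ Z.φ ≫ g ▷ (Z.X ⊗ A)) ⊗≫ 𝟙 _ := by monoidal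
        _ = 𝟙 _ ⊗≫ (X.φ ≫ g ▷ A) ▷ Z.X ⊗≫ Y.X ◁ Z.φ ⊗≫ 𝟙 _ := by
            rw [whisker_exchange]; monoidal
        _ = _ := by rw [h]; monoidal) := by
  ext
  rw [whiskerRight_f, of_f, of_f]
  calc _ = 𝟙 _ ⊗≫ g ▷ Z.X ⊗≫ Y.X ◁ (η[A] ▷ Z.X ≫ Z.φ) ⊗≫ 𝟙 _ := by monoidal
    _ = _ := by rw [Z.one_φ]; monoidal

theorem id_whiskerRight' (X Z : LeftTransfer A) : 𝟙 X ▷ Z = 𝟙 (X ⊗ Z) := by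
  rw [← of_id, whiskerRight_of, ← of_id]
  exact of_congr (id_whiskerRight _ _)

theorem whiskerLeft_id' (Z X : LeftTransfer A) : Z ◁ 𝟙 X = 𝟙 (Z ⊗ X) := by
  rw [← of_id, whiskerLeft_of, ← of_id]
  exact of_congr (whiskerLeft_id _ _)

theorem whiskerLeft_comp' (Z : LeftTransfer A) {X Y W : LeftTransfer A} (f : X ⟶ Y)
    (g : Y ⟶ W) : Z ◁ (f ≫ g) = Z ◁ f ≫ Z ◁ g := by
  ext
  simp only [whiskerLeft_f, comp_f, tensorObj_X]
  monoidal

theorem comp_whiskerRight' {X Y W : LeftTransfer A} (f : X ⟶ Y)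
    (g : Y ⟶ W) (Z : LeftTransfer A) : (f ≫ g) ▷ Z = f ▷ Z ≫ g ▷ Z := by
  ext
  simp only [whiskerRight_f, comp_f, tensorObj_X]
  calc _ = 𝟙 _ ⊗≫ f.f ▷ Z.X ⊗≫ g.f ▷ A ▷ Z.X ⊗≫ W.X ◁ (μ[A] ▷ Z.X ≫ Z.φ) ⊗≫ 𝟙 _ := by monoidal
    _ = 𝟙 _ ⊗≫ f.f ▷ Z.X ⊗≫ (g.f ▷ (A ⊗ Z.X) ≫ (W.X ⊗ A) ◁ Z.φ) ⊗≫ W.X ◁ Z.φ ▷ A ⊗≫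
          W.X ◁ Z.X ◁ μ[A] ⊗≫ 𝟙 _ := by
        rw [Z.mul_φ]; monoidal
    _ = _ := by rw [← whisker_exchange]; monoidal

theorem whisker_exchange' {W X Y Z : LeftTransfer A} (f : W ⟶ X) (g : Y ⟶ Z) :
    W ◁ g ≫ f ▷ Z = f ▷ Y ≫ X ◁ g := by
  symm
  ext
  simp only [whiskerRight_f, whiskerLeft_f, comp_f, tensorObj_X]
  calc _ = 𝟙 _ ⊗≫ f.f ▷ Y.X ⊗≫ X.X ◁ (Y.φ ≫ g.f ▷ A ≫ (α_ Z.X A A).hom ≫ Z.X ◁ μ[A]) ⊗≫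
          𝟙 _ := by monoidal
    _ = 𝟙 _ ⊗≫ (f.f ▷ Y.X ≫ (X.X ⊗ A) ◁ g.f) ⊗≫ X.X ◁ Z.φ ▷ A ⊗≫ X.X ◁ Z.X ◁ μ[A] ⊗≫ 𝟙 _ := by
        rw [g.comm]; monoidal
    _ = _ := by rw [← whisker_exchange]; monoidal

/-- The tensor product of `f` and `g` in `_A^#𝒯` is `(X' ⊗ Y' ⊗ m) ∘ (X' ⊗ φ ⊗ A) ∘ (f ⊗ g)`. -/
theorem tensorHom_f {X X' Y Y' : LeftTransfer A} (f : X ⟶ X') (g : Y ⟶ Y') :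
    Hom.f (f ⊗ₘ g) = (f.f ⊗ₘ g.f) ≫ (α_ (X'.X ⊗ A) Y'.X A).inv ≫ (α_ X'.X A Y'.X).hom ▷ A ≫
      (X'.X ◁ Y'.φ) ▷ A ≫ (α_ X'.X Y'.X A).inv ▷ A ≫ (α_ (X'.X ⊗ Y'.X) A A).hom ≫
        (X'.X ⊗ Y'.X) ◁ μ[A] := by
  rw [tensorHom_eq, ← whisker_exchange', MonoidalCategory.tensorHom_def']
  simp only [whiskerRight_f, whiskerLeft_f, comp_f, tensorObj_X]
  monoidal

theorem leftUnitor_hom_eq (X : LeftTransfer A) : (λ_ X).hom =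
    of (λ_ X.X).hom (by
      simp only [tensorObj_φ, tensorObj_X, tensorUnit_φ, tensorUnit_X]; monoidal) := rfl

theorem rightUnitor_hom_eq (X : LeftTransfer A) : (ρ_ X).hom =
    of (ρ_ X.X).hom (by
      simp only [tensorObj_φ, tensorObj_X, tensorUnit_φ, tensorUnit_X]; monoidal) := rfl

theorem whiskerRight_tensor' {X X' : LeftTransfer A} (f : X ⟶ X') (Y Z : LeftTransfer A) :
    f ▷ Y ▷ Z ≫ (α_ X' Y Z).hom = (α_ X Y Z).hom ≫ f ▷ (Y ⊗ Z) := by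
  ext
  rw [associator_hom_eq, associator_hom_eq, comp_of_f, of_comp_f]
  simp only [whiskerRight_f, tensorObj_X, tensorObj_φ]
  monoidal

theorem whisker_assoc' (X : LeftTransfer A) {Y Y' : LeftTransfer A} (g : Y ⟶ Y')
    (Z : LeftTransfer A) :
    (X ◁ g) ▷ Z ≫ (α_ X Y' Z).hom = (α_ X Y Z).hom ≫ X ◁ g ▷ Z := by
  ext
  rw [associator_hom_eq, associator_hom_eq, comp_of_f, of_comp_f]
  simp only [whiskerRight_f, whiskerLeft_f, tensorObj_X]
  monoidal

theorem tensor_whiskerLeft' (X Y : LeftTransfer A) {Z Z' : LeftTransfer A} (h : Z ⟶ Z') :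
    (X ⊗ Y) ◁ h ≫ (α_ X Y Z').hom = (α_ X Y Z).hom ≫ X ◁ Y ◁ h := by
  ext
  rw [associator_hom_eq, associator_hom_eq, comp_of_f, of_comp_f]
  simp only [whiskerLeft_f, tensorObj_X]
  monoidal

/-- The monoidal category `_A^#𝒯`. -/
instance : MonoidalCategory (LeftTransfer A) where
  id_tensorHom_id X Y := by
    rw [tensorHom_eq, id_whiskerRight', whiskerLeft_id', Category.comp_id]
  tensorHom_comp_tensorHom f g f' g' := by
    simp only [tensorHom_eq, comp_whiskerRight', whiskerLeft_comp', Category.assoc]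
    rw [← reassoc_of% (whisker_exchange' f' g)]
  whiskerLeft_id := whiskerLeft_id'
  id_whiskerRight := id_whiskerRight'
  associator_naturality f g h := by
    simp only [tensorHom_eq, comp_whiskerRight', whiskerLeft_comp', Category.assoc]
    rw [tensor_whiskerLeft', reassoc_of% whisker_assoc', reassoc_of% whiskerRight_tensor']
  leftUnitor_naturality f := by
    ext
    rw [leftUnitor_hom_eq, leftUnitor_hom_eq, comp_of_f, of_comp_f, whiskerLeft_f]
    simp only [tensorUnit_X]
    monoidal
  rightUnitor_naturality f := by
    ext
    rw [rightUnitor_hom_eq, rightUnitor_hom_eq, comp_of_f, of_comp_f, whiskerRight_f]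
    simp only [tensorUnit_X, tensorUnit_φ]
    monoidal
  pentagon W X Y Z := by
    simp only [associator_hom_eq, whiskerLeft_of, whiskerRight_of, of_comp_of]
    exact of_congr (pentagon _ _ _ _)
  triangle X Y := by
    simp only [associator_hom_eq, leftUnitor_hom_eq, rightUnitor_hom_eq, whiskerLeft_of,
      whiskerRight_of, of_comp_of]
    exact of_congr (triangle _ _)

end

end LeftTransfer

namespace RightTransfer

section

variable {C : Type u} [Category.{v} C] [MonoidalCategory C] {A : C} [MonObj A]

/-- The comultiplication `δ : X ⟶ A ⊗ (X ⊗ X)` of a coalgebra in `𝒯_A^#`, as a morphism of `C`. -/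
def δ (X : RightTransfer A) [ComonObj X] : X.X ⟶ A ⊗ (X.X ⊗ X.X) :=
  Hom.f (ComonObj.comul (X := X))

/-- The counit `ε : X ⟶ A` of a coalgebra in `𝒯_A^#`, as a morphism of `C`. -/
def e (X : RightTransfer A) [ComonObj X] : X.X ⟶ A :=
  Hom.f (ComonObj.counit (X := X)) ≫ (ρ_ A).hom

theorem counit_f (X : RightTransfer A) [ComonObj X] :
    Hom.f (ComonObj.counit (X := X)) = X.e ≫ (ρ_ A).inv := by
  simp [e]

theorem ψ_δ (X : RightTransfer A) [ComonObj X] :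
    X.ψ ⊗≫ A ◁ X.δ ⊗≫ μ[A] ▷ (X.X ⊗ X.X) =
      X.δ ▷ A ⊗≫ A ◁ X.X ◁ X.ψ ⊗≫ A ◁ X.ψ ▷ X.X ⊗≫ μ[A] ▷ (X.X ⊗ X.X) := by
  have h := Hom.comm (ComonObj.comul (X := X))
  simp only [tensorObj_ψ, tensorObj_X] at h
  calc _ = _ := by rw [δ]; monoidal
    _ = _ := h
    _ = _ := by rw [δ]; monoidal

theorem ψ_e (X : RightTransfer A) [ComonObj X] :
    X.ψ ≫ A ◁ X.e ≫ μ[A] = X.e ▷ A ≫ μ[A] := by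
  have h := Hom.comm (ComonObj.counit (X := X))
  rw [counit_f] at h
  simp only [tensorUnit_ψ, tensorUnit_X] at h
  rw [← cancel_mono (ρ_ A).inv]
  calc _ = _ := by monoidal
    _ = _ := h
    _ = _ := by monoidal

theorem δ_e_left (X : RightTransfer A) [ComonObj X] :
    X.δ ⊗≫ A ◁ X.e ▷ X.X ⊗≫ μ[A] ▷ X.X = 𝟙 _ ⊗≫ η[A] ▷ X.X := by
  have h := congrArg Hom.f (ComonObj.counit_comul X)
  have h2 : Hom.f (λ_ X).inv = (λ_ X.X).inv ≫ (λ_ _).inv ≫ η[A] ▷ _ := rfl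
  rw [h2, comp_f, whiskerRight_f, counit_f] at h
  simp only [tensorUnit_X, tensorObj_X] at h
  rw [← cancel_mono (A ◁ (λ_ X.X).inv)]
  calc _ = _ := by rw [δ]; monoidal
    _ = _ := h
    _ = _ := by monoidal

theorem δ_e_right (X : RightTransfer A) [ComonObj X] :
    X.δ ⊗≫ A ◁ X.X ◁ X.e ⊗≫ A ◁ X.ψ ⊗≫ μ[A] ▷ X.X = 𝟙 _ ⊗≫ η[A] ▷ X.X := by
  have h := congrArg Hom.f (ComonObj.comul_counit X)
  have h2 : Hom.f (ρ_ X).inv = (ρ_ X.X).inv ≫ (λ_ _).inv ≫ η[A] ▷ _ := rfl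
  rw [h2, comp_f, whiskerLeft_f, counit_f] at h
  simp only [tensorUnit_X, tensorObj_X] at h
  rw [← cancel_mono (A ◁ (ρ_ X.X).inv)]
  calc _ = _ := by rw [δ]; monoidal
    _ = _ := h
    _ = _ := by monoidal

theorem δ_δ (X : RightTransfer A) [ComonObj X] :
    X.δ ⊗≫ A ◁ X.X ◁ X.δ ⊗≫ A ◁ X.ψ ▷ (X.X ⊗ X.X) ⊗≫ μ[A] ▷ (X.X ⊗ X.X ⊗ X.X) =
      X.δ ⊗≫ A ◁ X.δ ▷ X.X ⊗≫ μ[A] ▷ (X.X ⊗ X.X ⊗ X.X) := by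
  have h := congrArg Hom.f (ComonObj.comul_assoc X)
  rw [← Category.assoc, associator_hom_eq, comp_of_f, comp_f, comp_f, whiskerLeft_f,
    whiskerRight_f] at h
  simp only [tensorObj_X] at h
  calc _ = _ := by rw [δ]; monoidal
    _ = _ := h
    _ = _ := by rw [δ]; monoidal

variable (X : RightTransfer A) (Y : C) [ExactPairing Y X.X]

/-- Transposition `C(Z, Y ⊗ W) → C(X ⊗ Z, W)` along the adjunction `X ⊣ Y`. -/
abbrev tr {Z W : C} (f : Z ⟶ Y ⊗ W) : X.X ⊗ Z ⟶ W :=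
  X.X ◁ f ≫ (α_ _ _ _).inv ≫ ε_ Y X.X ▷ _ ≫ (λ_ _).hom

variable {Y} in
theorem tr_inj {Z W : C} {f g : Z ⟶ Y ⊗ W} (h : X.tr Y f = X.tr Y g) : f = g :=
  (tensorLeftHomEquiv _ Y X.X _).symm.injective h

/-- `φ = (Y ⊗ A ⊗ d) ∘ (Y ⊗ ψ ⊗ Y) ∘ (b ⊗ A ⊗ Y)`. -/
def dualφ : A ⊗ Y ⟶ Y ⊗ A :=
  (λ_ (A ⊗ Y)).inv ≫ η_ Y X.X ▷ (A ⊗ Y) ≫ (α_ Y X.X (A ⊗ Y)).hom ≫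
    Y ◁ ((α_ X.X A Y).inv ≫ X.ψ ▷ Y ≫ (α_ A X.X Y).hom ≫ A ◁ ε_ Y X.X ≫ (ρ_ A).hom)

/-- `d² = d ∘ (X ⊗ d ⊗ Y)`, the evaluation of `X ⊗ X ⊣ Y ⊗ Y`. -/
def d2 : (X.X ⊗ X.X) ⊗ (Y ⊗ Y) ⟶ 𝟙_ C :=
  (α_ X.X X.X (Y ⊗ Y)).hom ≫ X.X ◁ (α_ X.X Y Y).inv ≫ X.X ◁ ε_ Y X.X ▷ Y ≫ X.X ◁ (λ_ Y).hom ≫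
    ε_ Y X.X

/-- `m_Y = (Y ⊗ A ⊗ d²) ∘ (Y ⊗ δ ⊗ Y ⊗ Y) ∘ (b ⊗ Y ⊗ Y)`. -/
def dualMul [ComonObj X] : Y ⊗ Y ⟶ Y ⊗ A :=
  (λ_ (Y ⊗ Y)).inv ≫ η_ Y X.X ▷ (Y ⊗ Y) ≫ (α_ Y X.X (Y ⊗ Y)).hom ≫
    Y ◁ (X.δ ▷ (Y ⊗ Y) ≫ (α_ A (X.X ⊗ X.X) (Y ⊗ Y)).hom ≫ A ◁ X.d2 Y ≫ (ρ_ A).hom)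

/-- `η_Y = (Y ⊗ ε) ∘ b`. -/
def dualOne [ComonObj X] : 𝟙_ C ⟶ Y ⊗ A :=
  η_ Y X.X ≫ Y ◁ X.e

theorem tr_dualφ : X.tr Y (X.dualφ Y) = 𝟙 _ ⊗≫ X.ψ ▷ Y ⊗≫ A ◁ ε_ Y X.X ⊗≫ 𝟙 _ := by
  have := (tensorLeftHomEquiv _ Y X.X _).left_inv
    ((α_ X.X A Y).inv ≫ X.ψ ▷ Y ≫ (α_ A X.X Y).hom ≫ A ◁ ε_ Y X.X ≫ (ρ_ A).hom)
  refine this.trans ?_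
  monoidal

theorem tr_dualMul [ComonObj X] : X.tr Y (X.dualMul Y) =
    X.δ ▷ (Y ⊗ Y) ⊗≫ A ◁ X.d2 Y ⊗≫ 𝟙 _ := by
  refine ((tensorLeftHomEquiv _ Y X.X _).left_inv _).trans ?_
  monoidal

theorem tr_dualOne [ComonObj X] : X.tr Y (X.dualOne Y) = (ρ_ _).hom ≫ X.e := by
  have h := (tensorLeftHomEquiv (𝟙_ C) Y X.X _).left_inv ((ρ_ _).hom ≫ X.e)
  refine Eq.trans ?_ h
  simp only [Equiv.invFun_as_coe, tensorLeftHomEquiv, Equiv.coe_fn_symm_mk, dualOne]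
  monoidal

theorem tr_mul {Z' Z W V U : C} (g : Z' ⟶ Z ⊗ V) (f : Z ⟶ Y ⊗ W) (h : W ⊗ V ⟶ U) :
    X.tr Y (g ≫ f ▷ V ≫ (α_ Y W V).hom ≫ Y ◁ h) =
      X.X ◁ g ≫ (α_ X.X Z V).inv ≫ X.tr Y f ▷ V ≫ h := by
  calc _ = X.X ◁ g ⊗≫ X.X ◁ f ▷ V ⊗≫ ((X.X ⊗ Y) ◁ h ≫ ε_ Y X.X ▷ U) ⊗≫ 𝟙 _ := by monoidal
    _ = _ := by rw [whisker_exchange]; monoidal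

/-- If `X ⊣ Y`, then `(Y, φ)` is a left transfer morphism. -/
abbrev dual : LeftTransfer A where
  X := Y
  φ := X.dualφ Y
  mul_φ := by
    apply X.tr_inj
    calc _ = 𝟙 _ ⊗≫ X.X ◁ μ[A] ▷ Y ⊗≫ X.tr Y (X.dualφ Y) ⊗≫ 𝟙 _ := by monoidal
      _ = 𝟙 _ ⊗≫ (X.X ◁ μ[A] ≫ X.ψ) ▷ Y ⊗≫ A ◁ ε_ Y X.X ⊗≫ 𝟙 _ := by rw [tr_dualφ]; monoidal
      _ = 𝟙 _ ⊗≫ X.ψ ▷ A ▷ Y ⊗≫ A ◁ X.ψ ▷ Y ⊗≫ (μ[A] ▷ (X.X ⊗ Y) ≫ A ◁ ε_ Y X.X) ⊗≫ 𝟙 _ := by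
          rw [X.mul_ψ]; monoidal
      _ = 𝟙 _ ⊗≫ X.ψ ▷ A ▷ Y ⊗≫ A ◁ X.tr Y (X.dualφ Y) ⊗≫ μ[A] := by
          rw [tr_dualφ, ← whisker_exchange]; monoidal
      _ = 𝟙 _ ⊗≫ (X.ψ ▷ (A ⊗ Y) ≫ (A ⊗ X.X) ◁ X.dualφ Y) ⊗≫ A ◁ ε_ Y X.X ▷ A ⊗≫ μ[A] := by
          monoidal
      _ = 𝟙 _ ⊗≫ X.X ◁ A ◁ X.dualφ Y ⊗≫ X.tr Y (X.dualφ Y) ▷ A ⊗≫ μ[A] := by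
          rw [tr_dualφ, ← whisker_exchange]; monoidal
      _ = 𝟙 _ ⊗≫ X.X ◁ A ◁ X.dualφ Y ⊗≫ X.X ◁ X.dualφ Y ▷ A ⊗≫
            (ε_ Y X.X ▷ (A ⊗ A) ≫ 𝟙_ C ◁ μ[A]) ⊗≫ 𝟙 _ := by
          monoidal
      _ = _ := by rw [← whisker_exchange]; monoidal
  one_φ := by
    apply X.tr_inj
    calc _ = 𝟙 _ ⊗≫ X.X ◁ η[A] ▷ Y ⊗≫ X.tr Y (X.dualφ Y) ⊗≫ 𝟙 _ := by monoidal
      _ = 𝟙 _ ⊗≫ (X.X ◁ η[A] ≫ X.ψ) ▷ Y ⊗≫ A ◁ ε_ Y X.X ⊗≫ 𝟙 _ := by rw [tr_dualφ]; monoidal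
      _ = 𝟙 _ ⊗≫ (η[A] ▷ (X.X ⊗ Y) ≫ A ◁ ε_ Y X.X) ⊗≫ 𝟙 _ := by rw [X.one_ψ]; monoidal
      _ = 𝟙 _ ⊗≫ (ε_ Y X.X ▷ 𝟙_ C ≫ 𝟙_ C ◁ η[A]) ⊗≫ 𝟙 _ := by
          rw [← whisker_exchange]; monoidal
      _ = _ := by rw [← whisker_exchange]; monoidal

end

end RightTransfer

namespace RightTransfer

section

variable {C : Type u} [Category.{v} C] [MonoidalCategory C] {A : C} [MonObj A]
variable (X : RightTransfer A) (Y : C) [ExactPairing Y X.X]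

/-- The transfer morphism of `Y ⊗ Y`. -/
def dualφ2 : A ⊗ (Y ⊗ Y) ⟶ (Y ⊗ Y) ⊗ A :=
  (X.dual Y ⊗ X.dual Y).φ

theorem d2_φ : (X.X ⊗ X.X) ◁ X.dualφ2 Y ⊗≫ X.d2 Y ▷ A ⊗≫ 𝟙 A =
    𝟙 _ ⊗≫ X.X ◁ X.ψ ▷ Y ▷ Y ⊗≫ X.ψ ▷ X.X ▷ Y ▷ Y ⊗≫ A ◁ X.d2 Y ⊗≫ 𝟙 A := by
  simp only [dualφ2, LeftTransfer.tensorObj_φ, d2]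
  calc _ = 𝟙 _ ⊗≫ X.X ◁ X.X ◁ X.dualφ Y ▷ Y ⊗≫ X.X ◁ ((X.X ⊗ Y) ◁ X.dualφ Y ≫
          ε_ Y X.X ▷ (Y ⊗ A)) ⊗≫ ε_ Y X.X ▷ A ⊗≫ 𝟙 _ := by monoidal
    _ = 𝟙 _ ⊗≫ X.X ◁ X.tr Y (X.dualφ Y) ▷ Y ⊗≫ X.tr Y (X.dualφ Y) ⊗≫ 𝟙 _ := by
        rw [whisker_exchange]; monoidal
    _ = 𝟙 _ ⊗≫ X.X ◁ X.ψ ▷ Y ▷ Y ⊗≫ ((X.X ⊗ A) ◁ (ε_ Y X.X ▷ Y) ≫ X.ψ ▷ (𝟙_ C ⊗ Y)) ⊗≫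
          A ◁ ε_ Y X.X ⊗≫ 𝟙 _ := by
        rw [tr_dualφ]; monoidal
    _ = _ := by rw [whisker_exchange]; monoidal

/-- The multiplication `m_Y` is a morphism of `_A^#𝒯`. -/
def dualMulHom [ComonObj X] : X.dual Y ⊗ X.dual Y ⟶ X.dual Y where
  f := X.dualMul Y
  comm := by
    apply X.tr_inj
    change X.tr Y (X.dualφ2 Y ≫ _) = X.tr Y (A ◁ X.dualMul Y ≫ _)
    rw [tr_mul, ← Category.assoc (A ◁ _), tr_mul]
    calc _ = 𝟙 _ ⊗≫ (X.X ◁ X.dualφ2 Y ≫ X.δ ▷ ((Y ⊗ Y) ⊗ A)) ⊗≫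
            A ◁ X.d2 Y ▷ A ⊗≫ μ[A] := by
          rw [tr_dualMul]; monoidal
      _ = 𝟙 _ ⊗≫ X.δ ▷ (A ⊗ Y ⊗ Y) ⊗≫ A ◁ ((X.X ⊗ X.X) ◁ X.dualφ2 Y ⊗≫
            X.d2 Y ▷ A ⊗≫ 𝟙 A) ⊗≫ μ[A] := by
          rw [whisker_exchange]; monoidal
      _ = 𝟙 _ ⊗≫ X.δ ▷ (A ⊗ Y ⊗ Y) ⊗≫ A ◁ X.X ◁ X.ψ ▷ (Y ⊗ Y) ⊗≫ A ◁ X.ψ ▷ (X.X ⊗ Y ⊗ Y) ⊗≫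
            ((A ⊗ A) ◁ X.d2 Y ≫ μ[A] ▷ 𝟙_ C) ⊗≫ 𝟙 _ := by
          rw [d2_φ]; monoidal
      _ = 𝟙 _ ⊗≫ (X.δ ▷ A ⊗≫ A ◁ X.X ◁ X.ψ ⊗≫ A ◁ X.ψ ▷ X.X ⊗≫ μ[A] ▷ (X.X ⊗ X.X)) ▷ (Y ⊗ Y) ⊗≫
            A ◁ X.d2 Y ⊗≫ 𝟙 _ := by
          rw [whisker_exchange]; monoidal
      _ = 𝟙 _ ⊗≫ X.ψ ▷ (Y ⊗ Y) ⊗≫ A ◁ X.δ ▷ (Y ⊗ Y) ⊗≫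
            (μ[A] ▷ ((X.X ⊗ X.X) ⊗ Y ⊗ Y) ≫ A ◁ X.d2 Y) ⊗≫ 𝟙 _ := by
          rw [← ψ_δ]; monoidal
      _ = 𝟙 _ ⊗≫ X.ψ ▷ (Y ⊗ Y) ⊗≫ A ◁ X.tr Y (X.dualMul Y) ⊗≫ μ[A] := by
          rw [← whisker_exchange, tr_dualMul]; monoidal
      _ = 𝟙 _ ⊗≫ (X.ψ ▷ (Y ⊗ Y) ≫ (A ⊗ X.X) ◁ X.dualMul Y) ⊗≫ A ◁ ε_ Y X.X ▷ A ⊗≫ μ[A] := by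
          monoidal
      _ = _ := by rw [← whisker_exchange, tr_dualφ]; monoidal

/-- The unit `η_Y` is a morphism of `_A^#𝒯`. -/
def dualOneHom [ComonObj X] : 𝟙_ (LeftTransfer A) ⟶ X.dual Y where
  f := X.dualOne Y
  comm := by
    apply X.tr_inj
    rw [tr_mul, ← Category.assoc (A ◁ _), tr_mul, tr_dualOne, LeftTransfer.tensorUnit_φ]
    calc _ = 𝟙 _ ⊗≫ (X.e ▷ A ≫ μ[A]) := by
          simp only [LeftTransfer.tensorUnit_X]; monoidal
      _ = 𝟙 _ ⊗≫ X.ψ ⊗≫ A ◁ ((ρ_ X.X).hom ≫ X.e) ⊗≫ μ[A] := by rw [← ψ_e]; monoidal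
      _ = 𝟙 _ ⊗≫ (X.ψ ▷ 𝟙_ C ≫ (A ⊗ X.X) ◁ X.dualOne Y) ⊗≫ A ◁ ε_ Y X.X ▷ A ⊗≫ μ[A] := by
          rw [← tr_dualOne X Y]; monoidal
      _ = _ := by rw [← whisker_exchange, tr_dualφ]; monoidal

theorem d2_one [ComonObj X] :
    (X.X ⊗ X.X) ◁ (X.dualOne Y ▷ Y ⊗≫ Y ◁ X.dualφ Y) ⊗≫ X.d2 Y ▷ A ⊗≫ 𝟙 A =
      𝟙 _ ⊗≫ X.X ◁ X.e ▷ Y ⊗≫ X.ψ ▷ Y ⊗≫ A ◁ ε_ Y X.X ⊗≫ 𝟙 A := by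
  simp only [d2]
  calc _ = 𝟙 _ ⊗≫ X.X ◁ X.X ◁ X.dualOne Y ▷ Y ⊗≫ X.X ◁ ((X.X ⊗ Y) ◁ X.dualφ Y ≫
          ε_ Y X.X ▷ (Y ⊗ A)) ⊗≫ ε_ Y X.X ▷ A ⊗≫ 𝟙 _ := by monoidal
    _ = 𝟙 _ ⊗≫ X.X ◁ X.tr Y (X.dualOne Y) ▷ Y ⊗≫ X.tr Y (X.dualφ Y) ⊗≫ 𝟙 _ := by
        rw [whisker_exchange]; monoidal
    _ = _ := by rw [tr_dualφ, tr_dualOne]; monoidal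

theorem one_d2 [ComonObj X] :
    (X.X ⊗ X.X) ◁ (Y ◁ X.dualOne Y) ⊗≫ X.d2 Y ▷ A ⊗≫ 𝟙 A =
      𝟙 _ ⊗≫ X.e ▷ X.X ▷ Y ⊗≫ A ◁ ε_ Y X.X ⊗≫ 𝟙 A := by
  simp only [d2]
  calc _ = 𝟙 _ ⊗≫ X.X ◁ ((X.X ⊗ Y) ◁ X.dualOne Y ≫ ε_ Y X.X ▷ (Y ⊗ A)) ⊗≫
          ε_ Y X.X ▷ A ⊗≫ 𝟙 _ := by monoidal
    _ = 𝟙 _ ⊗≫ X.X ◁ ε_ Y X.X ⊗≫ X.tr Y (X.dualOne Y) ⊗≫ 𝟙 _ := by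
        rw [whisker_exchange]; monoidal
    _ = 𝟙 _ ⊗≫ (X.X ◁ ε_ Y X.X ≫ X.e ▷ 𝟙_ C) ⊗≫ 𝟙 _ := by rw [tr_dualOne]; monoidal
    _ = _ := by rw [whisker_exchange]; monoidal

theorem d2_mul [ComonObj X] :
    (X.X ⊗ X.X) ◁ (X.dualMul Y ▷ Y ⊗≫ Y ◁ X.dualφ Y) ⊗≫ X.d2 Y ▷ A ⊗≫ 𝟙 A =
      𝟙 _ ⊗≫ (X.X ◁ X.δ ⊗≫ X.ψ ▷ (X.X ⊗ X.X)) ▷ (Y ⊗ Y ⊗ Y) ⊗≫ A ◁ X.X ◁ X.d2 Y ▷ Y ⊗≫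
        A ◁ ε_ Y X.X ⊗≫ 𝟙 A := by
  calc _ = 𝟙 _ ⊗≫ X.X ◁ X.X ◁ X.dualMul Y ▷ Y ⊗≫ X.X ◁ ((X.X ⊗ Y) ◁ X.dualφ Y ≫
          ε_ Y X.X ▷ (Y ⊗ A)) ⊗≫ ε_ Y X.X ▷ A ⊗≫ 𝟙 _ := by simp only [d2]; monoidal
    _ = 𝟙 _ ⊗≫ X.X ◁ X.tr Y (X.dualMul Y) ▷ Y ⊗≫ X.tr Y (X.dualφ Y) ⊗≫ 𝟙 _ := by
        rw [whisker_exchange]; monoidal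
    _ = 𝟙 _ ⊗≫ X.X ◁ X.δ ▷ (Y ⊗ Y ⊗ Y) ⊗≫ ((X.X ⊗ A) ◁ (X.d2 Y ▷ Y) ≫ X.ψ ▷ (𝟙_ C ⊗ Y)) ⊗≫
          A ◁ ε_ Y X.X ⊗≫ 𝟙 _ := by
        rw [tr_dualφ, tr_dualMul]; monoidal
    _ = _ := by rw [whisker_exchange]; monoidal

theorem mul_d2 [ComonObj X] :
    (X.X ⊗ X.X) ◁ (Y ◁ X.dualMul Y) ⊗≫ X.d2 Y ▷ A ⊗≫ 𝟙 A =
      𝟙 _ ⊗≫ X.δ ▷ X.X ▷ (Y ⊗ Y ⊗ Y) ⊗≫ A ◁ X.X ◁ X.d2 Y ▷ Y ⊗≫ A ◁ ε_ Y X.X ⊗≫ 𝟙 A := by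
  calc _ = 𝟙 _ ⊗≫ X.X ◁ ((X.X ⊗ Y) ◁ X.dualMul Y ≫ ε_ Y X.X ▷ (Y ⊗ A)) ⊗≫
          ε_ Y X.X ▷ A ⊗≫ 𝟙 _ := by simp only [d2]; monoidal
    _ = 𝟙 _ ⊗≫ X.X ◁ ε_ Y X.X ▷ (Y ⊗ Y) ⊗≫ X.tr Y (X.dualMul Y) ⊗≫ 𝟙 _ := by
        rw [whisker_exchange]; monoidal
    _ = 𝟙 _ ⊗≫ (X.X ◁ (ε_ Y X.X ▷ (Y ⊗ Y)) ≫ X.δ ▷ (𝟙_ C ⊗ Y ⊗ Y)) ⊗≫ A ◁ X.d2 Y ⊗≫ 𝟙 _ := by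
        rw [tr_dualMul]; monoidal
    _ = _ := by rw [whisker_exchange]; simp only [d2]; monoidal

/-- Postcomposition of a morphism with `m_Y` in `_A^#𝒯`, transposed. -/
theorem tr_comp_dualMul [ComonObj X] {Z : C} (g : Z ⟶ (Y ⊗ Y) ⊗ A) :
    X.tr Y (g ≫ X.dualMul Y ▷ A ≫ (α_ Y A A).hom ≫ Y ◁ μ[A]) =
      X.δ ▷ Z ⊗≫ A ◁ ((X.X ⊗ X.X) ◁ g ⊗≫ X.d2 Y ▷ A ⊗≫ 𝟙 A) ⊗≫ μ[A] := by
  rw [tr_mul]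
  calc _ = 𝟙 _ ⊗≫ (X.X ◁ g ≫ X.δ ▷ ((Y ⊗ Y) ⊗ A)) ⊗≫ A ◁ X.d2 Y ▷ A ⊗≫ μ[A] := by
        rw [tr_dualMul]; monoidal
    _ = _ := by rw [whisker_exchange]; monoidal

/-- The transpose of the identity of `_A^#𝒯`. -/
theorem tr_unit {Z : C} (g : Z ⟶ Y) :
    X.tr Y (g ≫ (ρ_ Y).inv ≫ Y ◁ η[A]) = 𝟙 _ ⊗≫ η[A] ▷ (X.X ⊗ Z) ⊗≫ A ◁ X.X ◁ g ⊗≫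
      A ◁ ε_ Y X.X ⊗≫ 𝟙 A := by
  calc _ = X.X ◁ g ⊗≫ ((X.X ⊗ Y) ◁ η[A] ≫ ε_ Y X.X ▷ A) ⊗≫ 𝟙 _ := by monoidal
    _ = X.X ◁ g ⊗≫ ε_ Y X.X ⊗≫ η[A] := by rw [whisker_exchange]; monoidal
    _ = 𝟙 _ ⊗≫ (𝟙_ C ◁ (X.X ◁ g ≫ ε_ Y X.X) ≫ η[A] ▷ 𝟙_ C) ⊗≫ 𝟙 _ := by monoidal
    _ = _ := by rw [whisker_exchange]; monoidal

/-- If `(A, X, ψ)` is a cowreath and `X ⊣ Y`, then `(Y, φ)` is an algebra in `_A^#𝒯`, with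
multiplication `m_Y` and unit `η_Y`. -/
instance dualMonObj [ComonObj X] : MonObj (X.dual Y) where
  one := X.dualOneHom Y
  mul := X.dualMulHom Y
  one_mul := by
    apply LeftTransfer.hom_ext
    apply X.tr_inj
    have h : (LeftTransfer.Hom.f (λ_ (X.dual Y)).hom) = (λ_ Y).hom ≫ (ρ_ Y).inv ≫ Y ◁ η[A] := rfl
    rw [h, tr_unit]
    change X.tr Y ((X.dualOne Y ▷ Y ≫ (α_ Y A Y).hom ≫ Y ◁ X.dualφ Y ≫ (α_ Y Y A).inv) ≫
      X.dualMul Y ▷ A ≫ (α_ Y A A).hom ≫ Y ◁ μ[A]) = _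
    rw [tr_comp_dualMul]
    calc _ = 𝟙 _ ⊗≫ X.δ ▷ Y ⊗≫ A ◁ ((X.X ⊗ X.X) ◁ (X.dualOne Y ▷ Y ⊗≫ Y ◁ X.dualφ Y) ⊗≫
            X.d2 Y ▷ A ⊗≫ 𝟙 A) ⊗≫ μ[A] := by monoidal
      _ = 𝟙 _ ⊗≫ X.δ ▷ Y ⊗≫ A ◁ X.X ◁ X.e ▷ Y ⊗≫ A ◁ X.ψ ▷ Y ⊗≫
            ((A ⊗ A) ◁ ε_ Y X.X ≫ μ[A] ▷ 𝟙_ C) ⊗≫ 𝟙 _ := by rw [d2_one]; monoidal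
      _ = 𝟙 _ ⊗≫ (X.δ ⊗≫ A ◁ X.X ◁ X.e ⊗≫ A ◁ X.ψ ⊗≫ μ[A] ▷ X.X) ▷ Y ⊗≫ A ◁ ε_ Y X.X ⊗≫
            𝟙 _ := by rw [whisker_exchange]; monoidal
      _ = _ := by rw [δ_e_right]; monoidal
  mul_one := by
    apply LeftTransfer.hom_ext
    apply X.tr_inj
    have h : (LeftTransfer.Hom.f (ρ_ (X.dual Y)).hom) = (ρ_ Y).hom ≫ (ρ_ Y).inv ≫ Y ◁ η[A] := rfl
    rw [h, tr_unit]
    change X.tr Y ((Y ◁ X.dualOne Y ≫ (α_ Y Y A).inv) ≫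
      X.dualMul Y ▷ A ≫ (α_ Y A A).hom ≫ Y ◁ μ[A]) = _
    rw [tr_comp_dualMul]
    calc _ = 𝟙 _ ⊗≫ X.δ ▷ Y ⊗≫ A ◁ ((X.X ⊗ X.X) ◁ (Y ◁ X.dualOne Y) ⊗≫
            X.d2 Y ▷ A ⊗≫ 𝟙 A) ⊗≫ μ[A] := by monoidal
      _ = 𝟙 _ ⊗≫ X.δ ▷ Y ⊗≫ A ◁ X.e ▷ X.X ▷ Y ⊗≫
            ((A ⊗ A) ◁ ε_ Y X.X ≫ μ[A] ▷ 𝟙_ C) ⊗≫ 𝟙 _ := by rw [one_d2]; monoidal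
      _ = 𝟙 _ ⊗≫ (X.δ ⊗≫ A ◁ X.e ▷ X.X ⊗≫ μ[A] ▷ X.X) ▷ Y ⊗≫ A ◁ ε_ Y X.X ⊗≫
            𝟙 _ := by rw [whisker_exchange]; monoidal
      _ = _ := by rw [δ_e_left]; monoidal
  mul_assoc := by
    apply LeftTransfer.hom_ext
    apply X.tr_inj
    have h : LeftTransfer.Hom.f ((α_ (X.dual Y) (X.dual Y) (X.dual Y)).hom ≫
        X.dual Y ◁ X.dualMulHom Y ≫ X.dualMulHom Y) = (α_ Y Y Y).hom ≫
          LeftTransfer.Hom.f (X.dual Y ◁ X.dualMulHom Y ≫ X.dualMulHom Y) := by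
      rw [LeftTransfer.associator_hom_eq, LeftTransfer.of_comp_f]
    rw [h]
    change X.tr Y ((X.dualMul Y ▷ Y ≫ (α_ Y A Y).hom ≫ Y ◁ X.dualφ Y ≫ (α_ Y Y A).inv) ≫
        X.dualMul Y ▷ A ≫ (α_ Y A A).hom ≫ Y ◁ μ[A]) =
      X.tr Y ((α_ Y Y Y).hom ≫ (Y ◁ X.dualMul Y ≫ (α_ Y Y A).inv) ≫
        X.dualMul Y ▷ A ≫ (α_ Y A A).hom ≫ Y ◁ μ[A])
    rw [← Category.assoc (α_ Y Y Y).hom, tr_comp_dualMul, tr_comp_dualMul]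
    calc _ = 𝟙 _ ⊗≫ X.δ ▷ (Y ⊗ Y ⊗ Y) ⊗≫ A ◁ ((X.X ⊗ X.X) ◁ (X.dualMul Y ▷ Y ⊗≫
            Y ◁ X.dualφ Y) ⊗≫ X.d2 Y ▷ A ⊗≫ 𝟙 A) ⊗≫ μ[A] := by monoidal
      _ = 𝟙 _ ⊗≫ (X.δ ⊗≫ A ◁ X.X ◁ X.δ ⊗≫ A ◁ X.ψ ▷ (X.X ⊗ X.X)) ▷ (Y ⊗ Y ⊗ Y) ⊗≫
            ((A ⊗ A) ◁ (X.X ◁ X.d2 Y ▷ Y ⊗≫ ε_ Y X.X) ≫ μ[A] ▷ 𝟙_ C) ⊗≫ 𝟙 _ := by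
          rw [d2_mul]; monoidal
      _ = 𝟙 _ ⊗≫ (X.δ ⊗≫ A ◁ X.X ◁ X.δ ⊗≫ A ◁ X.ψ ▷ (X.X ⊗ X.X) ⊗≫
            μ[A] ▷ (X.X ⊗ X.X ⊗ X.X)) ▷ (Y ⊗ Y ⊗ Y) ⊗≫
            A ◁ (X.X ◁ X.d2 Y ▷ Y ⊗≫ ε_ Y X.X) ⊗≫ 𝟙 _ := by
          rw [whisker_exchange]; monoidal
      _ = 𝟙 _ ⊗≫ X.δ ▷ (Y ⊗ Y ⊗ Y) ⊗≫ A ◁ X.δ ▷ X.X ▷ (Y ⊗ Y ⊗ Y) ⊗≫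
            (μ[A] ▷ ((X.X ⊗ X.X ⊗ X.X) ⊗ Y ⊗ Y ⊗ Y) ≫ A ◁ (𝟙 _ ⊗≫ X.X ◁ X.d2 Y ▷ Y ⊗≫
              ε_ Y X.X)) ⊗≫ 𝟙 _ := by
          rw [δ_δ]; monoidal
      _ = 𝟙 _ ⊗≫ X.δ ▷ (Y ⊗ Y ⊗ Y) ⊗≫ A ◁ ((X.X ⊗ X.X) ◁ (Y ◁ X.dualMul Y) ⊗≫
            X.d2 Y ▷ A ⊗≫ 𝟙 A) ⊗≫ μ[A] := by rw [← whisker_exchange, mul_d2]; monoidal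
      _ = _ := by monoidal

end

end RightTransfer

namespace LeftTransfer

section

variable {C : Type u} [Category.{v} C] [MonoidalCategory C] {A : C} [MonObj A]

/-- The functor `_A^#𝒯 ⥤ C`, `(X, φ) ↦ X ⊗ A`. -/
def toBase (A : C) [MonObj A] : LeftTransfer A ⥤ C where
  obj X := X.X ⊗ A
  map {X Y} f := Hom.f f ▷ A ≫ (α_ Y.X A A).hom ≫ Y.X ◁ μ[A]
  map_id X := by
    rw [id_f]
    calc _ = 𝟙 _ ⊗≫ X.X ◁ (η[A] ▷ A ≫ μ[A]) := by monoidal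
      _ = _ := by rw [MonObj.one_mul]; monoidal
  map_comp {X Y Z} f g := by
    rw [comp_f]
    calc _ = 𝟙 _ ⊗≫ Hom.f f ▷ A ⊗≫ Hom.f g ▷ A ▷ A ⊗≫ Z.X ◁ (μ[A] ▷ A ≫ μ[A]) := by monoidal
      _ = 𝟙 _ ⊗≫ Hom.f f ▷ A ⊗≫ (Hom.f g ▷ (A ⊗ A) ≫ (Z.X ⊗ A) ◁ μ[A]) ⊗≫ Z.X ◁ μ[A] := by
          rw [MonObj.mul_assoc]; monoidal
      _ = _ := by rw [← whisker_exchange]; monoidal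

theorem toBase_of {X Y : LeftTransfer A} (g : X.X ⟶ Y.X) (h : X.φ ≫ g ▷ A = A ◁ g ≫ Y.φ) :
    (toBase A).map (of g h) = g ▷ A := by
  change Hom.f (of g h) ▷ A ≫ _ = _
  rw [of_f]
  calc _ = 𝟙 _ ⊗≫ g ▷ A ⊗≫ Y.X ◁ (η[A] ▷ A ≫ μ[A]) := by monoidal
    _ = _ := by rw [MonObj.one_mul]; monoidal

/-- The morphism `X ⊗ A ⊗ Y ⊗ A ⟶ X ⊗ Y ⊗ A ⊗ A ⟶ X ⊗ Y ⊗ A`. -/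
def toBaseμ (X Y : LeftTransfer A) : (X.X ⊗ A) ⊗ (Y.X ⊗ A) ⟶ (X.X ⊗ Y.X) ⊗ A :=
  (α_ X.X A (Y.X ⊗ A)).hom ≫ X.X ◁ ((α_ A Y.X A).inv ≫ Y.φ ▷ A ≫ (α_ Y.X A A).hom) ≫
    (α_ X.X Y.X (A ⊗ A)).inv ≫ (X.X ⊗ Y.X) ◁ μ[A]

theorem toBaseμ_eq (X Y : LeftTransfer A) :
    toBaseμ X Y = 𝟙 _ ⊗≫ X.X ◁ Y.φ ▷ A ⊗≫ (X.X ⊗ Y.X) ◁ μ[A] := by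
  rw [toBaseμ]; monoidal

theorem toBaseμ_left {X Y : LeftTransfer A} (f : X ⟶ Y) (Z : LeftTransfer A) :
    (toBase A).map f ▷ (Z.X ⊗ A) ≫ toBaseμ Y Z = toBaseμ X Z ≫ (toBase A).map (f ▷ Z) := by
  change (Hom.f f ▷ A ≫ (α_ Y.X A A).hom ≫ Y.X ◁ μ[A]) ▷ (Z.X ⊗ A) ≫ _ =
    _ ≫ Hom.f (f ▷ Z) ▷ A ≫ (α_ (Y.X ⊗ Z.X) A A).hom ≫ (Y.X ⊗ Z.X) ◁ μ[A]
  rw [whiskerRight_f, toBaseμ_eq, toBaseμ_eq]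
  calc _ = 𝟙 _ ⊗≫ Hom.f f ▷ (A ⊗ Z.X ⊗ A) ⊗≫ Y.X ◁ (μ[A] ▷ Z.X ≫ Z.φ) ▷ A ⊗≫
          (Y.X ⊗ Z.X) ◁ μ[A] := by monoidal
    _ = 𝟙 _ ⊗≫ (Hom.f f ▷ (A ⊗ Z.X ⊗ A) ≫ (Y.X ⊗ A) ◁ (𝟙 _ ⊗≫ Z.φ ▷ A)) ⊗≫
          Y.X ◁ Z.φ ▷ A ▷ A ⊗≫ (Y.X ⊗ Z.X) ◁ (μ[A] ▷ A ≫ μ[A]) := by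
        rw [Z.mul_φ]; monoidal
    _ = 𝟙 _ ⊗≫ X.X ◁ Z.φ ▷ A ⊗≫ Hom.f f ▷ (Z.X ⊗ A ⊗ A) ⊗≫
          Y.X ◁ (Z.φ ▷ (A ⊗ A) ≫ (Z.X ⊗ A) ◁ μ[A]) ⊗≫ (Y.X ⊗ Z.X) ◁ μ[A] := by
        rw [← whisker_exchange, MonObj.mul_assoc]; monoidal
    _ = 𝟙 _ ⊗≫ X.X ◁ Z.φ ▷ A ⊗≫ (Hom.f f ▷ (Z.X ⊗ A ⊗ A) ≫ (Y.X ⊗ A) ◁ Z.X ◁ μ[A]) ⊗≫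
          Y.X ◁ Z.φ ▷ A ⊗≫ (Y.X ⊗ Z.X) ◁ μ[A] := by
        rw [← whisker_exchange]; monoidal
    _ = _ := by rw [← whisker_exchange]; monoidal

theorem toBaseμ_right (Z : LeftTransfer A) {X Y : LeftTransfer A} (f : X ⟶ Y) :
    (Z.X ⊗ A) ◁ (toBase A).map f ≫ toBaseμ Z Y = toBaseμ Z X ≫ (toBase A).map (Z ◁ f) := by
  change (Z.X ⊗ A) ◁ (Hom.f f ▷ A ≫ (α_ Y.X A A).hom ≫ Y.X ◁ μ[A]) ≫ _ =
    _ ≫ Hom.f (Z ◁ f) ▷ A ≫ (α_ (Z.X ⊗ Y.X) A A).hom ≫ (Z.X ⊗ Y.X) ◁ μ[A]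
  rw [whiskerLeft_f, toBaseμ_eq, toBaseμ_eq]
  calc _ = 𝟙 _ ⊗≫ Z.X ◁ A ◁ Hom.f f ▷ A ⊗≫ Z.X ◁ ((A ⊗ Y.X) ◁ μ[A] ≫ Y.φ ▷ A) ⊗≫
          (Z.X ⊗ Y.X) ◁ μ[A] := by monoidal
    _ = 𝟙 _ ⊗≫ Z.X ◁ A ◁ Hom.f f ▷ A ⊗≫ Z.X ◁ Y.φ ▷ A ▷ A ⊗≫
          (Z.X ⊗ Y.X) ◁ (A ◁ μ[A] ≫ μ[A]) := by
        rw [whisker_exchange]; monoidal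
    _ = 𝟙 _ ⊗≫ Z.X ◁ (A ◁ Hom.f f ≫ (α_ A Y.X A).inv ≫ Y.φ ▷ A ≫ (α_ Y.X A A).hom ≫
          Y.X ◁ μ[A]) ▷ A ⊗≫ (Z.X ⊗ Y.X) ◁ μ[A] := by
        rw [MonObj.mul_assoc_flip]; monoidal
    _ = 𝟙 _ ⊗≫ Z.X ◁ X.φ ▷ A ⊗≫ Z.X ◁ Hom.f f ▷ A ▷ A ⊗≫ (Z.X ⊗ Y.X) ◁ (μ[A] ▷ A ≫ μ[A]) := by
        rw [← Hom.comm f]; monoidal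
    _ = 𝟙 _ ⊗≫ Z.X ◁ X.φ ▷ A ⊗≫ Z.X ◁ (Hom.f f ▷ (A ⊗ A) ≫ (Y.X ⊗ A) ◁ μ[A]) ⊗≫
          (Z.X ⊗ Y.X) ◁ μ[A] := by
        rw [MonObj.mul_assoc]; monoidal
    _ = _ := by rw [← whisker_exchange]; monoidal

theorem toBaseμ_assoc (X Y Z : LeftTransfer A) :
    toBaseμ X Y ▷ (Z.X ⊗ A) ≫ toBaseμ (X ⊗ Y) Z ≫ (toBase A).map (α_ X Y Z).hom =
      (α_ _ _ _).hom ≫ (X.X ⊗ A) ◁ toBaseμ Y Z ≫ toBaseμ X (Y ⊗ Z) := by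
  rw [associator_hom_eq, toBase_of]
  simp only [toBaseμ_eq, tensorObj_φ, tensorObj_X]
  calc _ = 𝟙 _ ⊗≫ X.X ◁ Y.φ ▷ (A ⊗ Z.X ⊗ A) ⊗≫ (X.X ⊗ Y.X) ◁ (μ[A] ▷ Z.X ≫ Z.φ) ▷ A ⊗≫
          (X.X ⊗ Y.X ⊗ Z.X) ◁ μ[A] := by monoidal
    _ = 𝟙 _ ⊗≫ X.X ◁ (Y.φ ▷ (A ⊗ Z.X ⊗ A) ≫ (Y.X ⊗ A) ◁ (𝟙 _ ⊗≫ Z.φ ▷ A)) ⊗≫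
          (X.X ⊗ Y.X) ◁ Z.φ ▷ A ▷ A ⊗≫ (X.X ⊗ Y.X ⊗ Z.X) ◁ (μ[A] ▷ A ≫ μ[A]) := by
        rw [Z.mul_φ]; monoidal
    _ = 𝟙 _ ⊗≫ X.X ◁ A ◁ Y.X ◁ Z.φ ▷ A ⊗≫ X.X ◁ Y.φ ▷ (Z.X ⊗ A ⊗ A) ⊗≫
          (X.X ⊗ Y.X) ◁ (Z.φ ▷ (A ⊗ A) ≫ (Z.X ⊗ A) ◁ μ[A]) ⊗≫ (X.X ⊗ Y.X ⊗ Z.X) ◁ μ[A] := by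
        rw [← whisker_exchange, MonObj.mul_assoc]; monoidal
    _ = 𝟙 _ ⊗≫ X.X ◁ A ◁ Y.X ◁ Z.φ ▷ A ⊗≫
          X.X ◁ (Y.φ ▷ (Z.X ⊗ A ⊗ A) ≫ (Y.X ⊗ A) ◁ Z.X ◁ μ[A]) ⊗≫
          (X.X ⊗ Y.X) ◁ Z.φ ▷ A ⊗≫ (X.X ⊗ Y.X ⊗ Z.X) ◁ μ[A] := by
        rw [← whisker_exchange]; monoidal
    _ = _ := by rw [← whisker_exchange]; monoidal

theorem toBase_left_unit (X : LeftTransfer A) : (λ_ (X.X ⊗ A)).hom =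
    ((λ_ (𝟙_ C)).inv ≫ 𝟙_ C ◁ η[A]) ▷ (X.X ⊗ A) ≫ toBaseμ (𝟙_ (LeftTransfer A)) X ≫
      (toBase A).map (λ_ X).hom := by
  rw [leftUnitor_hom_eq, toBase_of, toBaseμ_eq]
  symm
  calc _ = 𝟙 _ ⊗≫ (η[A] ▷ X.X ≫ X.φ) ▷ A ⊗≫ X.X ◁ μ[A] := by
        simp only [tensorUnit_X]; monoidal
    _ = 𝟙 _ ⊗≫ X.X ◁ (η[A] ▷ A ≫ μ[A]) := by rw [X.one_φ]; monoidal
    _ = _ := by rw [MonObj.one_mul]; monoidal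

theorem toBase_right_unit (X : LeftTransfer A) : (ρ_ (X.X ⊗ A)).hom =
    (X.X ⊗ A) ◁ ((λ_ (𝟙_ C)).inv ≫ 𝟙_ C ◁ η[A]) ≫ toBaseμ X (𝟙_ (LeftTransfer A)) ≫
      (toBase A).map (ρ_ X).hom := by
  rw [rightUnitor_hom_eq, toBase_of, toBaseμ_eq]
  symm
  calc _ = 𝟙 _ ⊗≫ X.X ◁ (A ◁ η[A] ≫ μ[A]) := by
        simp only [tensorUnit_X, tensorUnit_φ]; monoidal
    _ = _ := by rw [MonObj.mul_one]; monoidal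

/-- The functor `X ↦ X ⊗ A` is lax monoidal. -/
instance : (toBase A).LaxMonoidal :=
  ⟨(λ_ (𝟙_ C)).inv ≫ 𝟙_ C ◁ η[A], toBaseμ, toBaseμ_left, fun Z f => toBaseμ_right Z f,
    toBaseμ_assoc, toBase_left_unit, toBase_right_unit⟩

/-- The multiplication `m_Y : Y ⊗ Y ⟶ Y ⊗ A` of an algebra in `_A^#𝒯`, as a morphism of `C`. -/
def m (Y : LeftTransfer A) [MonObj Y] : Y.X ⊗ Y.X ⟶ Y.X ⊗ A :=
  Hom.f (MonObj.mul (X := Y))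

/-- The unit `η_Y : 𝟙 ⟶ Y ⊗ A` of an algebra in `_A^#𝒯`, as a morphism of `C`. -/
def u (Y : LeftTransfer A) [MonObj Y] : 𝟙_ C ⟶ Y.X ⊗ A :=
  Hom.f (MonObj.one (X := Y))

variable (Y : LeftTransfer A) [MonObj Y]

/-- The multiplication `Y ⊗ A ⊗ Y ⊗ A ⟶ Y ⊗ Y ⊗ A ⊗ A ⟶ Y ⊗ A ⊗ A ⟶ Y ⊗ A` of the wreath product,
`(Y ⊗ m) ∘ (m_Y ⊗ m) ∘ (Y ⊗ φ ⊗ A)`. -/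
def smashMul : (Y.X ⊗ A) ⊗ (Y.X ⊗ A) ⟶ Y.X ⊗ A :=
  (α_ Y.X A (Y.X ⊗ A)).hom ≫ Y.X ◁ ((α_ A Y.X A).inv ≫ Y.φ ▷ A ≫ (α_ Y.X A A).hom) ≫
    (α_ Y.X Y.X (A ⊗ A)).inv ≫ (Y.m ⊗ₘ μ[A]) ≫ (α_ Y.X A A).hom ≫ Y.X ◁ μ[A]

theorem smashMul_eq : Y.smashMul =
    Functor.LaxMonoidal.μ (toBase A) Y Y ≫ (toBase A).map (MonObj.mul (X := Y)) := by
  change _ = toBaseμ Y Y ≫ Y.m ▷ A ≫ (α_ Y.X A A).hom ≫ Y.X ◁ μ[A]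
  rw [smashMul, toBaseμ, MonoidalCategory.tensorHom_def']
  simp only [Category.assoc]

theorem unit_mul_one {Z : C} (f : 𝟙_ C ⟶ Z ⊗ A) :
    f ≫ (ρ_ (Z ⊗ A)).inv ≫ (Z ⊗ A) ◁ η[A] ≫ (α_ Z A A).hom ≫ Z ◁ μ[A] = f := by
  calc _ = f ⊗≫ Z ◁ (A ◁ η[A] ≫ μ[A]) := by monoidal
    _ = _ := by rw [MonObj.mul_one]; monoidal

theorem u_eq : Y.u =
    Functor.LaxMonoidal.ε (toBase A) ≫ (toBase A).map (MonObj.one (X := Y)) := by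
  change Y.u = ((λ_ (𝟙_ C)).inv ≫ 𝟙_ C ◁ η[A]) ≫ Y.u ▷ A ≫ (α_ Y.X A A).hom ≫ Y.X ◁ μ[A]
  rw [Category.assoc, whisker_exchange_assoc]
  conv_lhs => rw [← unit_mul_one Y.u]
  monoidal

/-- The wreath product (generalized smash product) `Y #_φ A`, an algebra in `C` with underlying
object `Y ⊗ A`. -/
@[simps]
def smash : Mon C where
  X := Y.X ⊗ A
  mon :=
    { one := Y.u
      mul := Y.smashMul
      one_mul := by
        rw [u_eq, smashMul_eq]
        exact ((toBase A).monObjObj Y).one_mul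
      mul_one := by
        rw [u_eq, smashMul_eq]
        exact ((toBase A).monObjObj Y).mul_one
      mul_assoc := by
        rw [smashMul_eq]
        exact ((toBase A).monObjObj Y).mul_assoc }

/-- The morphism `A ⟶ Y ⊗ A`, `(Y ⊗ m) ∘ (η_Y ⊗ A)`. -/
def smashIncl : A ⟶ Y.X ⊗ A :=
  (λ_ A).inv ≫ Y.u ▷ A ≫ (α_ Y.X A A).hom ≫ Y.X ◁ μ[A]

/-- The algebra morphism `A ⟶ Y #_φ A`, which makes `Y #_φ A` an algebra extension of `A`. -/
def smashHom : Mon.mk A ⟶ Y.smash where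
  hom := Y.smashIncl
  isMonHom_hom :=
    { one_hom := by
        change η[A] ≫ Y.smashIncl = Y.u
        rw [smashIncl, leftUnitor_inv_naturality_assoc, whisker_exchange_assoc]
        conv_rhs => rw [← unit_mul_one Y.u]
        monoidal
      mul_hom := by
        change μ[A] ≫ Y.smashIncl = (Y.smashIncl ⊗ₘ Y.smashIncl) ≫ Y.smashMul
        let e : 𝟙_ C ⊗ A ⟶ Y.X ⊗ A := (toBase A).map (MonObj.one (X := Y))
        let q : (𝟙_ C ⊗ A) ⊗ (𝟙_ C ⊗ A) ⟶ (𝟙_ C ⊗ 𝟙_ C) ⊗ A :=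
          toBaseμ (𝟙_ (LeftTransfer A)) (𝟙_ (LeftTransfer A))
        let l : (𝟙_ C ⊗ 𝟙_ C) ⊗ A ⟶ 𝟙_ C ⊗ A := (toBase A).map (λ_ (𝟙_ (LeftTransfer A))).hom
        let w : (𝟙_ C ⊗ 𝟙_ C) ⊗ A ⟶ (Y.X ⊗ Y.X) ⊗ A :=
          (toBase A).map (MonObj.one (X := Y) ⊗ₘ MonObj.one (X := Y))
        let k : (Y.X ⊗ Y.X) ⊗ A ⟶ Y.X ⊗ A := (toBase A).map (MonObj.mul (X := Y))
        have h1 : q ≫ l = ((λ_ A).hom ⊗ₘ (λ_ A).hom) ≫ μ[A] ≫ (λ_ A).inv := by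
          have hl : l = (λ_ (𝟙_ C)).hom ▷ A := by
            change (toBase A).map (λ_ (𝟙_ (LeftTransfer A))).hom = _
            rw [leftUnitor_hom_eq, toBase_of]
            rfl
          have hq : q = 𝟙 _ ⊗≫ 𝟙_ C ◁ ((λ_ A).hom ≫ (ρ_ A).inv) ▷ A ⊗≫
              (𝟙_ C ⊗ 𝟙_ C) ◁ μ[A] :=
            (toBaseμ_eq _ _).trans (by simp only [tensorUnit_X, tensorUnit_φ]; monoidal)
          rw [hq, hl, MonoidalCategory.tensorHom_def]
          monoidal
        have h2 : (e ⊗ₘ e) ≫ toBaseμ Y Y = q ≫ w := Functor.LaxMonoidal.μ_natural (toBase A)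
          (MonObj.one (X := Y)) (MonObj.one (X := Y))
        have h3 : w ≫ k = l ≫ e := by
          have h : (MonObj.one (X := Y) ⊗ₘ MonObj.one (X := Y)) ≫ MonObj.mul (X := Y) =
              (λ_ (𝟙_ (LeftTransfer A))).hom ≫ MonObj.one (X := Y) := by simp [unitors_equal]
          have h' := congrArg (toBase A).map h
          rwa [Functor.map_comp, Functor.map_comp] at h'
        have h4 : Y.smashMul = toBaseμ Y Y ≫ k := Y.smashMul_eq
        have h5 : Y.smashIncl = (λ_ A).inv ≫ e := rfl
        rw [h4, h5, ← MonoidalCategory.tensorHom_comp_tensorHom, Category.assoc,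
          reassoc_of% h2, h3, reassoc_of% h1]
        simp [MonoidalCategory.tensorHom_comp_tensorHom_assoc] }

end

end LeftTransfer

section

/-- Every object `Z` of `C` is left coflat: the functor `- ⊗ Z` preserves coequalizers. -/
class LeftCoflat (C : Type u) [Category.{v} C] [MonoidalCategory C] : Prop where
  preserves (Z : C) : PreservesColimitsOfShape WalkingParallelPair (tensorRight Z)

attribute [instance] LeftCoflat.preserves

variable {C : Type u} [Category.{v} C] [MonoidalCategory C]

/-- A right module over an algebra `S` in `C`. -/
structure RightMod (S : Mon C) where
  X : C
  act : X ⊗ S.X ⟶ X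
  act_one : X ◁ η[S.X] ≫ act = (ρ_ X).hom
  act_assoc : X ◁ μ[S.X] ≫ act = (α_ X S.X S.X).inv ≫ act ▷ S.X ≫ act

/-- A left `A`-module `N` is robust if for all `Z : C` and every right `A`-module `M`, the functor
`Z ⊗ -` preserves the coequalizer that defines `M ⊗_A N`, i.e. the canonical morphism
`(Z ⊗ M) ⊗_A N ⟶ Z ⊗ (M ⊗_A N)` is an isomorphism. -/
class IsRobust (A : Mon C) (N : C) [ModObj A.X N] : Prop where
  preserves (Z : C) (M : RightMod A) :
    PreservesColimit (parallelPair (M.act ▷ N)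
      ((α_ M.X A.X N).hom ≫ M.X ◁ ModObj.smul (M := A.X) (X := N))) (tensorLeft Z)

/-- Every left `A`-module is robust. -/
class LeftModulesRobust (A : Mon C) : Prop where
  robust (N : C) [ModObj A.X N] : IsRobust A N

/-- An epimorphism that remains one under `Z ⊗ - ⊗ W`. -/
class TensorEpi {X Y : C} (q : X ⟶ Y) : Prop where
  epi (Z W : C) : Epi (Z ◁ q ▷ W)

namespace TensorEpi

instance {X Y : C} (q : X ⟶ Y) [TensorEpi q] (Z W : C) : Epi (Z ◁ q ▷ W) := epi Z W

instance {X Y : C} (q : X ⟶ Y) [TensorEpi q] (W : C) : Epi (q ▷ W) := by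
  have h : q ▷ W = (λ_ _).inv ≫ 𝟙_ C ◁ q ▷ W ≫ (λ_ _).hom := by simp
  rw [h]; infer_instance

instance {X Y : C} (q : X ⟶ Y) [TensorEpi q] (Z : C) : Epi (Z ◁ q) := by
  have h : Z ◁ q = (ρ_ _).inv ≫ (α_ _ _ _).hom ≫ Z ◁ q ▷ 𝟙_ C ≫ (α_ _ _ _).inv ≫ (ρ_ _).hom := by
    simp
  rw [h]; infer_instance

theorem epi_self {X Y : C} (q : X ⟶ Y) [TensorEpi q] : Epi q := by
  have h : q = (λ_ _).inv ≫ 𝟙_ C ◁ q ≫ (λ_ _).hom := by simp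
  rw [h]; infer_instance

instance {X Y : C} (q : X ⟶ Y) [TensorEpi q] (W : C) : TensorEpi (q ▷ W) where
  epi Z V := by
    have h : Z ◁ (q ▷ W) ▷ V =
      Z ◁ (α_ _ _ _).hom ≫ Z ◁ q ▷ (W ⊗ V) ≫ Z ◁ (α_ _ _ _).inv := by monoidal
    rw [h]; infer_instance

instance {X Y : C} (q : X ⟶ Y) [TensorEpi q] (W : C) : TensorEpi (W ◁ q) where
  epi Z V := by
    have h : Z ◁ (W ◁ q) ▷ V = Z ◁ (α_ _ _ _).hom ≫ (α_ _ _ _).inv ≫ (Z ⊗ W) ◁ q ▷ V ≫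
      (α_ _ _ _).hom ≫ Z ◁ (α_ _ _ _).inv := by monoidal
    rw [h]; infer_instance

instance {X Y Z : C} (q : X ⟶ Y) (r : Y ⟶ Z) [TensorEpi q] [TensorEpi r] :
    TensorEpi (q ≫ r) where
  epi Z V := by
    have h : Z ◁ (q ≫ r) ▷ V = Z ◁ q ▷ V ≫ Z ◁ r ▷ V := by simp
    rw [h]; infer_instance

end TensorEpi

end

namespace BalTensor

section

variable {C : Type u} [Category.{v} C] [MonoidalCategory C] [HasCoequalizers C]
variable {R S T : Mon C}

/-- The underlying object of the tensor product `M ⊗_S N`. -/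
noncomputable def X (M : Bimod R S) (N : Bimod S T) : C :=
  coequalizer (M.actRight ▷ N.X) ((α_ M.X S.X N.X).hom ≫ M.X ◁ N.actLeft)

/-- The projection `M ⊗ N ⟶ M ⊗_S N`. -/
noncomputable def q (M : Bimod R S) (N : Bimod S T) : M.X ⊗ N.X ⟶ X M N :=
  coequalizer.π (M.actRight ▷ N.X) ((α_ M.X S.X N.X).hom ≫ M.X ◁ N.actLeft)

variable (M : Bimod R S) (N : Bimod S T)

theorem q_condition : M.actRight ▷ N.X ≫ q M N =
    (α_ M.X S.X N.X).hom ≫ M.X ◁ N.actLeft ≫ q M N := by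
  exact (coequalizer.condition (M.actRight ▷ N.X) ((α_ M.X S.X N.X).hom ≫ M.X ◁ N.actLeft)).trans
    (Category.assoc _ _ _)

theorem q_condition' : M.X ◁ N.actLeft ≫ q M N =
    (α_ M.X S.X N.X).inv ≫ M.actRight ▷ N.X ≫ q M N := by
  rw [q_condition]; simp

/-- Morphisms out of `M ⊗_S N`. -/
noncomputable def desc {W : C} (f : M.X ⊗ N.X ⟶ W)
    (h : M.actRight ▷ N.X ≫ f = (α_ M.X S.X N.X).hom ≫ M.X ◁ N.actLeft ≫ f) : X M N ⟶ W :=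
  coequalizer.desc f (by simpa using h)

@[simp]
theorem q_desc {W : C} (f : M.X ⊗ N.X ⟶ W)
    (h : M.actRight ▷ N.X ≫ f = (α_ M.X S.X N.X).hom ≫ M.X ◁ N.actLeft ≫ f) :
    q M N ≫ desc M N f h = f :=
  coequalizer.π_desc _ _

/-- The left module underlying a bimodule. -/
@[reducible]
def leftModObj : ModObj S.X N.X where
  smul := N.actLeft
  one_smul := N.one_actLeft
  mul_smul := N.left_assoc

/-- The right module underlying a bimodule. -/
@[simps]
def rightMod : RightMod S where
  X := M.X
  act := M.actRight
  act_one := M.actRight_one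
  act_assoc := M.right_assoc

instance [LeftModulesRobust S] (Z : C) : PreservesColimit (parallelPair (M.actRight ▷ N.X)
    ((α_ M.X S.X N.X).hom ≫ M.X ◁ N.actLeft)) (tensorLeft Z) := by
  let := leftModObj N
  have := LeftModulesRobust.robust (A := S) N.X
  exact IsRobust.preserves (A := S) (N := N.X) Z (rightMod M)

instance [LeftCoflat C] [LeftModulesRobust S] : TensorEpi (q M N) where
  epi Z W := by
    have h1 := isColimitOfHasCoequalizerOfPreservesColimit (tensorLeft Z) (M.actRight ▷ N.X)
      ((α_ M.X S.X N.X).hom ≫ M.X ◁ N.actLeft)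
    have h2 := isColimitCoforkMapOfIsColimit (tensorRight W) _ h1
    have h3 : Epi ((Z ◁ q M N) ▷ W) := Cofork.IsColimit.epi h2
    have h4 : Z ◁ q M N ▷ W = (α_ _ _ _).inv ≫ (Z ◁ q M N) ▷ W ≫ (α_ _ _ _).hom := by simp
    rw [h4]; infer_instance

/-- Morphisms out of `Z ⊗ (M ⊗_S N)`. -/
noncomputable def descL [LeftModulesRobust S] (Z : C) {W : C} (f : Z ⊗ M.X ⊗ N.X ⟶ W)
    (h : Z ◁ M.actRight ▷ N.X ≫ f = Z ◁ (α_ M.X S.X N.X).hom ≫ Z ◁ M.X ◁ N.actLeft ≫ f) :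
    Z ⊗ X M N ⟶ W :=
  Cofork.IsColimit.desc (isColimitOfHasCoequalizerOfPreservesColimit (tensorLeft Z)
    (M.actRight ▷ N.X) ((α_ M.X S.X N.X).hom ≫ M.X ◁ N.actLeft)) f (by simpa using h)

@[simp]
theorem q_descL [LeftModulesRobust S] (Z : C) {W : C} (f : Z ⊗ M.X ⊗ N.X ⟶ W)
    (h : Z ◁ M.actRight ▷ N.X ≫ f = Z ◁ (α_ M.X S.X N.X).hom ≫ Z ◁ M.X ◁ N.actLeft ≫ f) :
    Z ◁ q M N ≫ descL M N Z f h = f :=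
  Cofork.IsColimit.π_desc' (isColimitOfHasCoequalizerOfPreservesColimit (tensorLeft Z)
    (M.actRight ▷ N.X) ((α_ M.X S.X N.X).hom ≫ M.X ◁ N.actLeft)) f _

/-- Morphisms out of `(M ⊗_S N) ⊗ Z`. -/
noncomputable def descR [LeftCoflat C] (Z : C) {W : C} (f : (M.X ⊗ N.X) ⊗ Z ⟶ W)
    (h : M.actRight ▷ N.X ▷ Z ≫ f = (α_ M.X S.X N.X).hom ▷ Z ≫ (M.X ◁ N.actLeft) ▷ Z ≫ f) :
    X M N ⊗ Z ⟶ W :=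
  Cofork.IsColimit.desc (isColimitOfHasCoequalizerOfPreservesColimit (tensorRight Z)
    (M.actRight ▷ N.X) ((α_ M.X S.X N.X).hom ≫ M.X ◁ N.actLeft)) f (by simpa using h)

@[simp]
theorem q_descR [LeftCoflat C] (Z : C) {W : C} (f : (M.X ⊗ N.X) ⊗ Z ⟶ W)
    (h : M.actRight ▷ N.X ▷ Z ≫ f = (α_ M.X S.X N.X).hom ▷ Z ≫ (M.X ◁ N.actLeft) ▷ Z ≫ f) :
    q M N ▷ Z ≫ descR M N Z f h = f :=
  Cofork.IsColimit.π_desc' (isColimitOfHasCoequalizerOfPreservesColimit (tensorRight Z)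
    (M.actRight ▷ N.X) ((α_ M.X S.X N.X).hom ≫ M.X ◁ N.actLeft)) f _

/-- Left action for the tensor product. -/
noncomputable def actL [LeftModulesRobust S] : R.X ⊗ X M N ⟶ X M N :=
  descL M N R.X ((α_ _ _ _).inv ≫ M.actLeft ▷ N.X ≫ q M N) (by
    calc _ = 𝟙 _ ⊗≫ ((α_ _ _ _).hom ≫ R.X ◁ M.actRight ≫ M.actLeft) ▷ N.X ⊗≫ q M N := by monoidal
      _ = 𝟙 _ ⊗≫ M.actLeft ▷ S.X ▷ N.X ⊗≫ (M.actRight ▷ N.X ≫ q M N) := by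
          rw [← M.middle_assoc]; monoidal
      _ = 𝟙 _ ⊗≫ (M.actLeft ▷ (S.X ⊗ N.X) ≫ M.X ◁ N.actLeft) ⊗≫ q M N := by
          rw [q_condition]; monoidal
      _ = _ := by rw [← whisker_exchange]; monoidal)

@[simp]
theorem q_actL [LeftModulesRobust S] :
    R.X ◁ q M N ≫ actL M N = (α_ _ _ _).inv ≫ M.actLeft ▷ N.X ≫ q M N :=
  q_descL _ _ _ _ _

/-- Right action for the tensor product. -/
noncomputable def actR [LeftCoflat C] : X M N ⊗ T.X ⟶ X M N :=
  descR M N T.X ((α_ _ _ _).hom ≫ M.X ◁ N.actRight ≫ q M N) (by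
    calc _ = 𝟙 _ ⊗≫ (M.actRight ▷ (N.X ⊗ T.X) ≫ M.X ◁ N.actRight) ⊗≫ q M N := by monoidal
      _ = 𝟙 _ ⊗≫ M.X ◁ S.X ◁ N.actRight ⊗≫ (M.actRight ▷ N.X ≫ q M N) := by
          rw [← whisker_exchange]; monoidal
      _ = 𝟙 _ ⊗≫ M.X ◁ ((α_ _ _ _).hom ≫ S.X ◁ N.actRight ≫ N.actLeft) ⊗≫ q M N := by
          rw [q_condition]; monoidal
      _ = _ := by rw [← N.middle_assoc]; monoidal)

@[simp]
theorem q_actR [LeftCoflat C] :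
    q M N ▷ T.X ≫ actR M N = (α_ _ _ _).hom ≫ M.X ◁ N.actRight ≫ q M N :=
  q_descR _ _ _ _ _

variable [LeftCoflat C] [LeftModulesRobust S]

/-- The tensor product `M ⊗_S N` of bimodules. -/
noncomputable def tensor : Bimod R T where
  X := X M N
  actLeft := actL M N
  actRight := actR M N
  one_actLeft := by
    rw [← cancel_epi (𝟙_ C ◁ q M N)]
    calc _ = (𝟙_ C ◁ q M N ≫ η[R.X] ▷ X M N) ≫ actL M N := by simp
      _ = η[R.X] ▷ (M.X ⊗ N.X) ≫ (R.X ◁ q M N ≫ actL M N) := by rw [whisker_exchange]; simp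
      _ = 𝟙 _ ⊗≫ (η[R.X] ▷ M.X ≫ M.actLeft) ▷ N.X ⊗≫ q M N := by rw [q_actL]; monoidal
      _ = _ := by rw [M.one_actLeft]; monoidal
  actRight_one := by
    rw [← cancel_epi (q M N ▷ 𝟙_ C)]
    calc _ = (q M N ▷ 𝟙_ C ≫ X M N ◁ η[T.X]) ≫ actR M N := by simp
      _ = (M.X ⊗ N.X) ◁ η[T.X] ≫ (q M N ▷ T.X ≫ actR M N) := by rw [← whisker_exchange]; simp
      _ = 𝟙 _ ⊗≫ M.X ◁ (N.X ◁ η[T.X] ≫ N.actRight) ⊗≫ q M N := by rw [q_actR]; monoidal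
      _ = _ := by rw [N.actRight_one]; monoidal
  left_assoc := by
    rw [← cancel_epi ((R.X ⊗ R.X) ◁ q M N)]
    calc _ = ((R.X ⊗ R.X) ◁ q M N ≫ μ[R.X] ▷ X M N) ≫ actL M N := by simp
      _ = μ[R.X] ▷ (M.X ⊗ N.X) ≫ (R.X ◁ q M N ≫ actL M N) := by rw [whisker_exchange]; simp
      _ = 𝟙 _ ⊗≫ (μ[R.X] ▷ M.X ≫ M.actLeft) ▷ N.X ⊗≫ q M N := by rw [q_actL]; monoidal
      _ = 𝟙 _ ⊗≫ R.X ◁ M.actLeft ▷ N.X ⊗≫ ((α_ _ _ _).inv ≫ M.actLeft ▷ N.X ≫ q M N) := by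
          rw [M.left_assoc]; monoidal
      _ = 𝟙 _ ⊗≫ R.X ◁ M.actLeft ▷ N.X ⊗≫ R.X ◁ q M N ⊗≫ actL M N := by
          rw [← q_actL]; monoidal
      _ = 𝟙 _ ⊗≫ R.X ◁ ((α_ _ _ _).inv ≫ M.actLeft ▷ N.X ≫ q M N) ⊗≫ actL M N := by monoidal
      _ = _ := by rw [← q_actL]; monoidal
  right_assoc := by
    rw [← cancel_epi (q M N ▷ (T.X ⊗ T.X))]
    calc _ = (q M N ▷ (T.X ⊗ T.X) ≫ X M N ◁ μ[T.X]) ≫ actR M N := by simp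
      _ = (M.X ⊗ N.X) ◁ μ[T.X] ≫ (q M N ▷ T.X ≫ actR M N) := by rw [← whisker_exchange]; simp
      _ = 𝟙 _ ⊗≫ M.X ◁ (N.X ◁ μ[T.X] ≫ N.actRight) ⊗≫ q M N := by rw [q_actR]; monoidal
      _ = 𝟙 _ ⊗≫ M.X ◁ N.actRight ▷ T.X ⊗≫ ((α_ _ _ _).hom ≫ M.X ◁ N.actRight ≫ q M N) := by
          rw [N.right_assoc]; monoidal
      _ = 𝟙 _ ⊗≫ M.X ◁ N.actRight ▷ T.X ⊗≫ q M N ▷ T.X ⊗≫ actR M N := by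
          rw [← q_actR]; monoidal
      _ = 𝟙 _ ⊗≫ ((α_ _ _ _).hom ≫ M.X ◁ N.actRight ≫ q M N) ▷ T.X ⊗≫ actR M N := by monoidal
      _ = _ := by rw [← q_actR]; monoidal
  middle_assoc := by
    rw [← cancel_epi ((α_ _ _ _).hom ≫ R.X ◁ q M N ▷ T.X ≫ (α_ _ _ _).inv)]
    calc _ = 𝟙 _ ⊗≫ (R.X ◁ q M N ≫ actL M N) ▷ T.X ⊗≫ actR M N := by monoidal
      _ = 𝟙 _ ⊗≫ M.actLeft ▷ N.X ▷ T.X ⊗≫ (q M N ▷ T.X ≫ actR M N) := by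
          rw [q_actL]; monoidal
      _ = 𝟙 _ ⊗≫ (M.actLeft ▷ (N.X ⊗ T.X) ≫ M.X ◁ N.actRight) ⊗≫ q M N := by
          rw [q_actR]; monoidal
      _ = 𝟙 _ ⊗≫ R.X ◁ M.X ◁ N.actRight ⊗≫ ((α_ _ _ _).inv ≫ M.actLeft ▷ N.X ≫ q M N) := by
          rw [← whisker_exchange]; monoidal
      _ = 𝟙 _ ⊗≫ R.X ◁ ((α_ _ _ _).hom ≫ M.X ◁ N.actRight ≫ q M N) ⊗≫ actL M N := by
          rw [← q_actL]; monoidal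
      _ = _ := by rw [← q_actR]; monoidal

end

end BalTensor

namespace BalTensor

section

variable {C : Type u} [Category.{v} C] [MonoidalCategory C] [HasCoequalizers C] [LeftCoflat C]
variable {R S T U : Mon C} [LeftModulesRobust S]

/-- The projection `M ⊗ N ⟶ M ⊗_S N`. -/
noncomputable def π (M : Bimod R S) (N : Bimod S T) : M.X ⊗ N.X ⟶ (tensor M N).X := q M N

instance (M : Bimod R S) (N : Bimod S T) : TensorEpi (π M N) :=
  inferInstanceAs (TensorEpi (q M N))

instance (M : Bimod R S) (N : Bimod S T) : Epi (π M N) := TensorEpi.epi_self _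

theorem π_condition (M : Bimod R S) (N : Bimod S T) : M.actRight ▷ N.X ≫ π M N =
    (α_ M.X S.X N.X).hom ≫ M.X ◁ N.actLeft ≫ π M N := q_condition M N

theorem π_condition' (M : Bimod R S) (N : Bimod S T) : M.X ◁ N.actLeft ≫ π M N =
    (α_ M.X S.X N.X).inv ≫ M.actRight ▷ N.X ≫ π M N := q_condition' M N

theorem π_actLeft (M : Bimod R S) (N : Bimod S T) : R.X ◁ π M N ≫ (tensor M N).actLeft =
    (α_ _ _ _).inv ≫ M.actLeft ▷ N.X ≫ π M N := q_actL M N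

theorem π_actRight (M : Bimod R S) (N : Bimod S T) : π M N ▷ T.X ≫ (tensor M N).actRight =
    (α_ _ _ _).hom ≫ M.X ◁ N.actRight ≫ π M N := q_actR M N

/-- Morphisms out of `M ⊗_S N`. -/
noncomputable def descT (M : Bimod R S) (N : Bimod S T) {W : C} (f : M.X ⊗ N.X ⟶ W)
    (h : M.actRight ▷ N.X ≫ f = (α_ M.X S.X N.X).hom ≫ M.X ◁ N.actLeft ≫ f) :
    (tensor M N).X ⟶ W := desc M N f h

theorem π_descT (M : Bimod R S) (N : Bimod S T) {W : C} (f : M.X ⊗ N.X ⟶ W) (h) :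
    π M N ≫ descT M N f h = f := q_desc M N f h

/-- Morphisms of bimodules out of a tensor product. -/
noncomputable def lift (M : Bimod R S) (N : Bimod S T) (P : Bimod R T) (f : M.X ⊗ N.X ⟶ P.X)
    (h : M.actRight ▷ N.X ≫ f = (α_ M.X S.X N.X).hom ≫ M.X ◁ N.actLeft ≫ f)
    (hl : R.X ◁ f ≫ P.actLeft = (α_ _ _ _).inv ≫ M.actLeft ▷ N.X ≫ f)
    (hr : f ▷ T.X ≫ P.actRight = (α_ _ _ _).hom ≫ M.X ◁ N.actRight ≫ f) : tensor M N ⟶ P where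
  hom := descT M N f h
  left_act_hom := by
    rw [← cancel_epi (R.X ◁ π M N), ← Category.assoc, π_actLeft, Category.assoc, Category.assoc,
      π_descT, ← hl, ← MonoidalCategory.whiskerLeft_comp_assoc, π_descT]
  right_act_hom := by
    rw [← cancel_epi (π M N ▷ T.X), ← Category.assoc, π_actRight, Category.assoc, Category.assoc,
      π_descT, ← hr, ← MonoidalCategory.comp_whiskerRight_assoc, π_descT]

theorem π_lift (M : Bimod R S) (N : Bimod S T) (P : Bimod R T) (f : M.X ⊗ N.X ⟶ P.X) (h) (hl) (hr) :
    π M N ≫ (lift M N P f h hl hr).hom = f := q_desc M N f h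

/-- The tensor product of morphisms of bimodules. -/
noncomputable def map {M M' : Bimod R S} {N N' : Bimod S T} (f : M ⟶ M') (g : N ⟶ N') :
    tensor M N ⟶ tensor M' N' :=
  lift M N (tensor M' N') ((f.hom ⊗ₘ g.hom) ≫ π M' N')
    (by
      rw [MonoidalCategory.tensorHom_def, Category.assoc]
      calc _ = (M.actRight ≫ f.hom) ▷ N.X ≫ M'.X ◁ g.hom ≫ π M' N' := by monoidal
        _ = f.hom ▷ S.X ▷ N.X ≫ (M'.actRight ▷ N.X ≫ M'.X ◁ g.hom) ≫ π M' N' := by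
            rw [f.right_act_hom]; monoidal
        _ = f.hom ▷ S.X ▷ N.X ≫ (M'.X ⊗ S.X) ◁ g.hom ≫ (M'.actRight ▷ N'.X ≫ π M' N') := by
            rw [← whisker_exchange]; monoidal
        _ = 𝟙 _ ⊗≫ (f.hom ▷ (S.X ⊗ N.X) ≫ M'.X ◁ (S.X ◁ g.hom ≫ N'.actLeft)) ⊗≫ π M' N' := by
            rw [π_condition]; monoidal
        _ = 𝟙 _ ⊗≫ (f.hom ▷ (S.X ⊗ N.X) ≫ M'.X ◁ N.actLeft) ⊗≫ M'.X ◁ g.hom ⊗≫ π M' N' := by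
            rw [← g.left_act_hom]; monoidal
        _ = _ := by rw [← whisker_exchange]; monoidal)
    (by
      rw [MonoidalCategory.tensorHom_def, Category.assoc]
      calc _ = 𝟙 _ ⊗≫ R.X ◁ (f.hom ▷ N.X ≫ M'.X ◁ g.hom) ⊗≫
            (R.X ◁ π M' N' ≫ (tensor M' N').actLeft) := by monoidal
        _ = 𝟙 _ ⊗≫ R.X ◁ f.hom ▷ N.X ⊗≫ ((R.X ⊗ M'.X) ◁ g.hom ≫ M'.actLeft ▷ N'.X) ⊗≫ π M' N' := by
            rw [π_actLeft]; monoidal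
        _ = 𝟙 _ ⊗≫ (R.X ◁ f.hom ≫ M'.actLeft) ▷ N.X ⊗≫ M'.X ◁ g.hom ⊗≫ π M' N' := by
            rw [whisker_exchange]; monoidal
        _ = _ := by rw [← f.left_act_hom]; monoidal)
    (by
      rw [MonoidalCategory.tensorHom_def, Category.assoc]
      calc _ = 𝟙 _ ⊗≫ (f.hom ▷ N.X ≫ M'.X ◁ g.hom) ▷ T.X ⊗≫
            (π M' N' ▷ T.X ≫ (tensor M' N').actRight) := by monoidal
        _ = 𝟙 _ ⊗≫ f.hom ▷ N.X ▷ T.X ⊗≫ M'.X ◁ (g.hom ▷ T.X ≫ N'.actRight) ⊗≫ π M' N' := by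
            rw [π_actRight]; monoidal
        _ = 𝟙 _ ⊗≫ (f.hom ▷ (N.X ⊗ T.X) ≫ M'.X ◁ N.actRight) ⊗≫ M'.X ◁ g.hom ⊗≫ π M' N' := by
            rw [← g.right_act_hom]; monoidal
        _ = _ := by rw [← whisker_exchange]; monoidal)

theorem π_map {M M' : Bimod R S} {N N' : Bimod S T} (f : M ⟶ M') (g : N ⟶ N') :
    π M N ≫ (map f g).hom = (f.hom ⊗ₘ g.hom) ≫ π M' N' := π_lift _ _ _ _ _ _ _

section

variable [LeftModulesRobust T] (M : Bimod R S) (N : Bimod S T) (P : Bimod T U)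

/-- `(M ⊗_S N) ⊗ P ⟶ M ⊗_S (N ⊗_T P)`. -/
noncomputable def assocHomAux : (tensor M N).X ⊗ P.X ⟶ (tensor M (tensor N P)).X :=
  descR M N P.X ((α_ _ _ _).hom ≫ M.X ◁ π N P ≫ π M (tensor N P)) (by
    calc _ = 𝟙 _ ⊗≫ (M.actRight ▷ (N.X ⊗ P.X) ≫ M.X ◁ π N P) ⊗≫ π M (tensor N P) := by monoidal
      _ = 𝟙 _ ⊗≫ M.X ◁ S.X ◁ π N P ⊗≫ (M.actRight ▷ (tensor N P).X ≫ π M (tensor N P)) := by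
          rw [← whisker_exchange]; monoidal
      _ = 𝟙 _ ⊗≫ M.X ◁ (S.X ◁ π N P ≫ (tensor N P).actLeft) ⊗≫ π M (tensor N P) := by
          rw [π_condition]; monoidal
      _ = _ := by rw [π_actLeft]; monoidal)

theorem assocHomAux_eq : π M N ▷ P.X ≫ assocHomAux M N P =
    (α_ _ _ _).hom ≫ M.X ◁ π N P ≫ π M (tensor N P) := q_descR _ _ _ _ _

/-- `M ⊗ (N ⊗_T P) ⟶ (M ⊗_S N) ⊗_T P`. -/
noncomputable def assocInvAux : M.X ⊗ (tensor N P).X ⟶ (tensor (tensor M N) P).X :=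
  descL N P M.X ((α_ _ _ _).inv ≫ π M N ▷ P.X ≫ π (tensor M N) P) (by
    symm
    calc _ = 𝟙 _ ⊗≫ ((M.X ⊗ N.X) ◁ P.actLeft ≫ π M N ▷ P.X) ⊗≫ π (tensor M N) P := by monoidal
      _ = 𝟙 _ ⊗≫ π M N ▷ T.X ▷ P.X ⊗≫ ((tensor M N).X ◁ P.actLeft ≫ π (tensor M N) P) := by
          rw [whisker_exchange]; monoidal
      _ = 𝟙 _ ⊗≫ (π M N ▷ T.X ≫ (tensor M N).actRight) ▷ P.X ⊗≫ π (tensor M N) P := by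
          rw [π_condition']; monoidal
      _ = _ := by rw [π_actRight]; monoidal)

theorem assocInvAux_eq : M.X ◁ π N P ≫ assocInvAux M N P =
    (α_ _ _ _).inv ≫ π M N ▷ P.X ≫ π (tensor M N) P := q_descL _ _ _ _ _

/-- The forward direction of the associator. -/
noncomputable def assocHom : tensor (tensor M N) P ⟶ tensor M (tensor N P) :=
  lift (tensor M N) P _ (assocHomAux M N P)
    (by
      rw [← cancel_epi (π M N ▷ T.X ▷ P.X)]
      calc _ = (π M N ▷ T.X ≫ (tensor M N).actRight) ▷ P.X ≫ assocHomAux M N P := by monoidal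
        _ = 𝟙 _ ⊗≫ M.X ◁ N.actRight ▷ P.X ⊗≫ (π M N ▷ P.X ≫ assocHomAux M N P) := by
            rw [π_actRight]; monoidal
        _ = 𝟙 _ ⊗≫ M.X ◁ (N.actRight ▷ P.X ≫ π N P) ⊗≫ π M (tensor N P) := by
            rw [assocHomAux_eq]; monoidal
        _ = 𝟙 _ ⊗≫ M.X ◁ N.X ◁ P.actLeft ⊗≫ ((α_ _ _ _).hom ≫ M.X ◁ π N P ≫ π M (tensor N P)) := by
            rw [π_condition]; monoidal
        _ = 𝟙 _ ⊗≫ ((M.X ⊗ N.X) ◁ P.actLeft ≫ π M N ▷ P.X) ⊗≫ assocHomAux M N P := by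
            rw [← assocHomAux_eq]; monoidal
        _ = _ := by rw [whisker_exchange]; monoidal)
    (by
      rw [← cancel_epi (R.X ◁ π M N ▷ P.X)]
      calc _ = R.X ◁ (π M N ▷ P.X ≫ assocHomAux M N P) ≫ (tensor M (tensor N P)).actLeft := by
            monoidal
        _ = 𝟙 _ ⊗≫ R.X ◁ M.X ◁ π N P ⊗≫
              (R.X ◁ π M (tensor N P) ≫ (tensor M (tensor N P)).actLeft) := by
            rw [assocHomAux_eq]; monoidal
        _ = 𝟙 _ ⊗≫ ((R.X ⊗ M.X) ◁ π N P ≫ M.actLeft ▷ (tensor N P).X) ⊗≫ π M (tensor N P) := by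
            rw [π_actLeft]; monoidal
        _ = 𝟙 _ ⊗≫ M.actLeft ▷ N.X ▷ P.X ⊗≫
              ((α_ _ _ _).hom ≫ M.X ◁ π N P ≫ π M (tensor N P)) := by
            rw [whisker_exchange]; monoidal
        _ = 𝟙 _ ⊗≫ ((α_ _ _ _).inv ≫ M.actLeft ▷ N.X ≫ π M N) ▷ P.X ⊗≫ assocHomAux M N P := by
            rw [← assocHomAux_eq]; monoidal
        _ = _ := by rw [← π_actLeft]; monoidal)
    (by
      rw [← cancel_epi (π M N ▷ P.X ▷ U.X)]
      calc _ = (π M N ▷ P.X ≫ assocHomAux M N P) ▷ U.X ≫ (tensor M (tensor N P)).actRight := by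
            monoidal
        _ = 𝟙 _ ⊗≫ M.X ◁ π N P ▷ U.X ⊗≫
              (π M (tensor N P) ▷ U.X ≫ (tensor M (tensor N P)).actRight) := by
            rw [assocHomAux_eq]; monoidal
        _ = 𝟙 _ ⊗≫ M.X ◁ (π N P ▷ U.X ≫ (tensor N P).actRight) ⊗≫ π M (tensor N P) := by
            rw [π_actRight]; monoidal
        _ = 𝟙 _ ⊗≫ M.X ◁ N.X ◁ P.actRight ⊗≫
              ((α_ _ _ _).hom ≫ M.X ◁ π N P ≫ π M (tensor N P)) := by
            rw [π_actRight]; monoidal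
        _ = 𝟙 _ ⊗≫ ((M.X ⊗ N.X) ◁ P.actRight ≫ π M N ▷ P.X) ⊗≫ assocHomAux M N P := by
            rw [← assocHomAux_eq]; monoidal
        _ = _ := by rw [whisker_exchange]; monoidal)

theorem π_assocHom : π M N ▷ P.X ≫ π (tensor M N) P ≫ (assocHom M N P).hom =
    (α_ _ _ _).hom ≫ M.X ◁ π N P ≫ π M (tensor N P) := by
  rw [assocHom, π_lift, assocHomAux_eq]

/-- The underlying morphism of the inverse of the associator. -/
noncomputable def assocInv : (tensor M (tensor N P)).X ⟶ (tensor (tensor M N) P).X :=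
  descT M (tensor N P) (assocInvAux M N P) (by
    rw [← cancel_epi ((M.X ⊗ S.X) ◁ π N P)]
    symm
    calc _ = 𝟙 _ ⊗≫ M.X ◁ (S.X ◁ π N P ≫ (tensor N P).actLeft) ≫ assocInvAux M N P := by monoidal
      _ = 𝟙 _ ⊗≫ M.X ◁ N.actLeft ▷ P.X ⊗≫ (M.X ◁ π N P ≫ assocInvAux M N P) := by
          rw [π_actLeft]; monoidal
      _ = 𝟙 _ ⊗≫ (M.X ◁ N.actLeft ≫ π M N) ▷ P.X ⊗≫ π (tensor M N) P := by
          rw [assocInvAux_eq]; monoidal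
      _ = 𝟙 _ ⊗≫ M.actRight ▷ N.X ▷ P.X ⊗≫ ((α_ _ _ _).inv ≫ π M N ▷ P.X ≫ π (tensor M N) P) := by
          rw [π_condition']; monoidal
      _ = 𝟙 _ ⊗≫ (M.actRight ▷ (N.X ⊗ P.X) ≫ M.X ◁ π N P) ⊗≫ assocInvAux M N P := by
          rw [← assocInvAux_eq]; monoidal
      _ = _ := by rw [← whisker_exchange]; monoidal)

theorem π_assocInv : M.X ◁ π N P ≫ π M (tensor N P) ≫ assocInv M N P =
    (α_ _ _ _).inv ≫ π M N ▷ P.X ≫ π (tensor M N) P := by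
  have h : π M (tensor N P) ≫ assocInv M N P = assocInvAux M N P := π_descT _ _ _ _
  rw [h, assocInvAux_eq]

/-- The associator `(M ⊗_S N) ⊗_T P ≅ M ⊗_S (N ⊗_T P)`. -/
noncomputable def assoc : tensor (tensor M N) P ≅ tensor M (tensor N P) :=
  have h1 : (assocHom M N P).hom ≫ assocInv M N P = 𝟙 _ := by
    rw [← cancel_epi (π (tensor M N) P), ← cancel_epi (π M N ▷ P.X)]
    have h := π_assocHom M N P
    calc _ = (π M N ▷ P.X ≫ π (tensor M N) P ≫ (assocHom M N P).hom) ≫ assocInv M N P := by simp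
      _ = (α_ _ _ _).hom ≫ M.X ◁ π N P ≫ π M (tensor N P) ≫ assocInv M N P := by rw [h]; simp
      _ = _ := by rw [π_assocInv]; simp
  have h2 : assocInv M N P ≫ (assocHom M N P).hom = 𝟙 _ := by
    rw [← cancel_epi (π M (tensor N P)), ← cancel_epi (M.X ◁ π N P)]
    calc _ = (M.X ◁ π N P ≫ π M (tensor N P) ≫ assocInv M N P) ≫ (assocHom M N P).hom := by simp
      _ = (α_ _ _ _).inv ≫ π M N ▷ P.X ≫ π (tensor M N) P ≫ (assocHom M N P).hom := by
          rw [π_assocInv]; simp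
      _ = _ := by rw [π_assocHom]; simp
  { hom := assocHom M N P
    inv :=
      { hom := assocInv M N P
        left_act_hom := by
          have : IsIso (assocHom M N P).hom := ⟨_, h1, h2⟩
          rw [← cancel_mono (assocHom M N P).hom]
          calc _ = (tensor M (tensor N P)).actLeft ≫ (assocInv M N P ≫ (assocHom M N P).hom) := by
                simp
            _ = R.X ◁ (assocInv M N P ≫ (assocHom M N P).hom) ≫
                (tensor M (tensor N P)).actLeft := by rw [h2]; simp
            _ = _ := by simp
        right_act_hom := by
          have : IsIso (assocHom M N P).hom := ⟨_, h1, h2⟩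
          rw [← cancel_mono (assocHom M N P).hom]
          calc _ = (tensor M (tensor N P)).actRight ≫ (assocInv M N P ≫ (assocHom M N P).hom) := by
                simp
            _ = (assocInv M N P ≫ (assocHom M N P).hom) ▷ U.X ≫
                (tensor M (tensor N P)).actRight := by rw [h2]; simp
            _ = _ := by simp }
    hom_inv_id := Bimod.hom_ext _ _ h1
    inv_hom_id := Bimod.hom_ext _ _ h2 }

end

end

end BalTensor

namespace BalTensor

section

variable {C : Type u} [Category.{v} C] [MonoidalCategory C] [HasCoequalizers C] [LeftCoflat C]
variable {R S : Mon C}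

/-- The projection `R ⊗ M ⟶ R ⊗_R M`. -/
noncomputable def lπ [LeftModulesRobust R] (M : Bimod R S) :
    R.X ⊗ M.X ⟶ (tensor (Bimod.regular R) M).X := π (Bimod.regular R) M

theorem lπ_condition [LeftModulesRobust R] (M : Bimod R S) :
    R.X ◁ M.actLeft ≫ lπ M = (α_ R.X R.X M.X).inv ≫ μ[R.X] ▷ M.X ≫ lπ M :=
  π_condition' (Bimod.regular R) M

instance [LeftModulesRobust R] (M : Bimod R S) : Epi (lπ M) :=
  inferInstanceAs (Epi (π (Bimod.regular R) M))

/-- The morphism `R ⊗_R M ⟶ M`. -/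
noncomputable def leftUnitHom [LeftModulesRobust R] (M : Bimod R S) :
    tensor (Bimod.regular R) M ⟶ M :=
  lift (Bimod.regular R) M M M.actLeft M.left_assoc
    (by
      change R.X ◁ M.actLeft ≫ M.actLeft = (α_ R.X R.X M.X).inv ≫ μ[R.X] ▷ M.X ≫ M.actLeft
      rw [M.left_assoc]; simp)
    M.middle_assoc

theorem lπ_leftUnitHom [LeftModulesRobust R] (M : Bimod R S) :
    lπ M ≫ (leftUnitHom M).hom = M.actLeft := π_lift _ _ _ _ _ _ _

/-- The left unitor `R ⊗_R M ≅ M`. -/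
noncomputable def leftUnit [LeftModulesRobust R] (M : Bimod R S) :
    tensor (Bimod.regular R) M ≅ M :=
  Bimod.isoOfIso
    { hom := (leftUnitHom M).hom
      inv := (λ_ M.X).inv ≫ η[R.X] ▷ M.X ≫ lπ M
      hom_inv_id := by
        rw [← cancel_epi (lπ M)]
        calc _ = (lπ M ≫ (leftUnitHom M).hom) ≫ (λ_ M.X).inv ≫ η[R.X] ▷ M.X ≫ lπ M := by simp
          _ = 𝟙 _ ⊗≫ (𝟙_ C ◁ M.actLeft ≫ η[R.X] ▷ M.X) ⊗≫ lπ M := by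
              rw [lπ_leftUnitHom]; monoidal
          _ = 𝟙 _ ⊗≫ η[R.X] ▷ (R.X ⊗ M.X) ⊗≫ (R.X ◁ M.actLeft ≫ lπ M) := by
              rw [whisker_exchange]; monoidal
          _ = 𝟙 _ ⊗≫ (η[R.X] ▷ R.X ≫ μ[R.X]) ▷ M.X ⊗≫ lπ M := by
              rw [lπ_condition]; monoidal
          _ = 𝟙 _ ⊗≫ lπ M := by rw [MonObj.one_mul]; monoidal
          _ = _ := by monoidal
      inv_hom_id := by
        rw [Category.assoc, Category.assoc, lπ_leftUnitHom, M.one_actLeft]; simp }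
    (leftUnitHom M).left_act_hom (leftUnitHom M).right_act_hom

/-- The projection `M ⊗ S ⟶ M ⊗_S S`. -/
noncomputable def rπ [LeftModulesRobust S] (M : Bimod R S) :
    M.X ⊗ S.X ⟶ (tensor M (Bimod.regular S)).X := π M (Bimod.regular S)

theorem rπ_condition [LeftModulesRobust S] (M : Bimod R S) :
    M.actRight ▷ S.X ≫ rπ M = (α_ M.X S.X S.X).hom ≫ M.X ◁ μ[S.X] ≫ rπ M :=
  π_condition M (Bimod.regular S)

instance [LeftModulesRobust S] (M : Bimod R S) : TensorEpi (rπ M) :=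
  inferInstanceAs (TensorEpi (π M (Bimod.regular S)))

instance [LeftModulesRobust S] (M : Bimod R S) : Epi (rπ M) := TensorEpi.epi_self _

/-- The morphism `M ⊗_S S ⟶ M`. -/
noncomputable def rightUnitHom [LeftModulesRobust S] (M : Bimod R S) :
    tensor M (Bimod.regular S) ⟶ M :=
  lift M (Bimod.regular S) M M.actRight
    (by
      change M.actRight ▷ S.X ≫ M.actRight = (α_ M.X S.X S.X).hom ≫ M.X ◁ μ[S.X] ≫ M.actRight
      rw [M.right_assoc]; simp)
    (by
      change R.X ◁ M.actRight ≫ M.actLeft = (α_ R.X M.X S.X).inv ≫ M.actLeft ▷ S.X ≫ M.actRight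
      rw [M.middle_assoc]; simp)
    (by
      change M.actRight ▷ S.X ≫ M.actRight = (α_ M.X S.X S.X).hom ≫ M.X ◁ μ[S.X] ≫ M.actRight
      rw [M.right_assoc]; simp)

theorem rπ_rightUnitHom [LeftModulesRobust S] (M : Bimod R S) :
    rπ M ≫ (rightUnitHom M).hom = M.actRight := π_lift _ _ _ _ _ _ _

/-- The right unitor `M ⊗_S S ≅ M`. -/
noncomputable def rightUnit [LeftModulesRobust S] (M : Bimod R S) :
    tensor M (Bimod.regular S) ≅ M :=
  Bimod.isoOfIso
    { hom := (rightUnitHom M).hom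
      inv := (ρ_ M.X).inv ≫ M.X ◁ η[S.X] ≫ rπ M
      hom_inv_id := by
        rw [← cancel_epi (rπ M)]
        calc _ = (rπ M ≫ (rightUnitHom M).hom) ≫ (ρ_ M.X).inv ≫ M.X ◁ η[S.X] ≫ rπ M := by simp
          _ = 𝟙 _ ⊗≫ (M.actRight ▷ 𝟙_ C ≫ M.X ◁ η[S.X]) ⊗≫ rπ M := by
              rw [rπ_rightUnitHom]; monoidal
          _ = 𝟙 _ ⊗≫ (M.X ⊗ S.X) ◁ η[S.X] ⊗≫ (M.actRight ▷ S.X ≫ rπ M) := by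
              rw [← whisker_exchange]; monoidal
          _ = 𝟙 _ ⊗≫ M.X ◁ (S.X ◁ η[S.X] ≫ μ[S.X]) ⊗≫ rπ M := by
              rw [rπ_condition]; monoidal
          _ = 𝟙 _ ⊗≫ rπ M := by rw [MonObj.mul_one]; monoidal
          _ = _ := by monoidal
      inv_hom_id := by
        rw [Category.assoc, Category.assoc, rπ_rightUnitHom, M.actRight_one]; simp }
    (rightUnitHom M).left_act_hom (rightUnitHom M).right_act_hom

end

section

variable {C : Type u} [Category.{v} C] [MonoidalCategory C] [HasCoequalizers C] [LeftCoflat C]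
variable (A : Mon C) [LeftModulesRobust A]

noncomputable instance : MonoidalCategoryStruct (Bimod A A) where
  tensorObj M N := tensor M N
  tensorUnit := Bimod.regular A
  tensorHom f g := map f g
  whiskerLeft M _ _ g := map (𝟙 M) g
  whiskerRight f N := map f (𝟙 N)
  associator M N P := assoc M N P
  leftUnitor M := leftUnit M
  rightUnitor M := rightUnit M

/-- The monoidal category `_A C_A` of `A`-bimodules, with tensor product `⊗_A` and unit `A`. -/
noncomputable instance : MonoidalCategory (Bimod A A) :=
  MonoidalCategory.ofTensorHom
    (id_tensorHom_id := fun M N => by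
      apply Bimod.hom_ext
      change (map (𝟙 M) (𝟙 N)).hom = 𝟙 (tensor M N).X
      rw [← cancel_epi (π M N), π_map]
      simp)
    (id_tensorHom := fun _ _ _ _ => rfl)
    (tensorHom_id := fun _ _ => rfl)
    (tensorHom_comp_tensorHom := fun {M₁ N₁ O₁ M₂ N₂ O₂} f₁ f₂ g₁ g₂ => by
      apply Bimod.hom_ext
      change (map f₁ f₂).hom ≫ (map g₁ g₂).hom = (map (f₁ ≫ g₁) (f₂ ≫ g₂)).hom
      rw [← cancel_epi (π M₁ M₂), π_map, ← Category.assoc, π_map, Category.assoc, π_map]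
      simp)
    (associator_naturality := fun {M N P M' N' P'} f g h => by
      apply Bimod.hom_ext
      change (map (map f g) h).hom ≫ (assocHom M' N' P').hom =
        (assocHom M N P).hom ≫ (map f (map g h)).hom
      rw [← cancel_epi (π (tensor M N) P), ← cancel_epi (π M N ▷ P.X)]
      calc _ = π M N ▷ P.X ≫ (π (tensor M N) P ≫ (map (map f g) h).hom) ≫
            (assocHom M' N' P').hom := by simp
        _ = (π M N ≫ (map f g).hom) ▷ P.X ≫ (tensor M' N').X ◁ h.hom ≫ π (tensor M' N') P' ≫
            (assocHom M' N' P').hom := by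
            rw [π_map, MonoidalCategory.tensorHom_def]; simp
        _ = (f.hom ⊗ₘ g.hom) ▷ P.X ≫ (π M' N' ▷ P.X ≫ (tensor M' N').X ◁ h.hom) ≫
            π (tensor M' N') P' ≫ (assocHom M' N' P').hom := by
            rw [π_map]; simp
        _ = ((f.hom ⊗ₘ g.hom) ⊗ₘ h.hom) ≫ π M' N' ▷ P'.X ≫ π (tensor M' N') P' ≫
            (assocHom M' N' P').hom := by
            rw [← whisker_exchange, MonoidalCategory.tensorHom_def (f.hom ⊗ₘ g.hom)]; simp
        _ = (α_ _ _ _).hom ≫ (f.hom ⊗ₘ ((g.hom ⊗ₘ h.hom) ≫ π N' P')) ≫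
            π M' (tensor N' P') := by
            rw [π_assocHom]; simp [MonoidalCategory.tensorHom_def]
        _ = (α_ _ _ _).hom ≫ M.X ◁ π N P ≫ (f.hom ⊗ₘ (map g h).hom) ≫ π M' (tensor N' P') := by
            rw [← π_map]; simp [MonoidalCategory.tensorHom_def']
        _ = (α_ _ _ _).hom ≫ M.X ◁ π N P ≫ π M (tensor N P) ≫ (map f (map g h)).hom := by
            rw [π_map]
        _ = (π M N ▷ P.X ≫ π (tensor M N) P ≫ (assocHom M N P).hom) ≫ (map f (map g h)).hom := by
            rw [π_assocHom]; simp
        _ = _ := by simp)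
    (leftUnitor_naturality := fun {M N} f => by
      apply Bimod.hom_ext
      change (map (𝟙 (Bimod.regular A)) f).hom ≫ (leftUnitHom N).hom =
        (leftUnitHom M).hom ≫ f.hom
      have h : lπ M ≫ (map (𝟙 (Bimod.regular A)) f).hom = (𝟙 A.X ⊗ₘ f.hom) ≫ lπ N := π_map _ _
      rw [← cancel_epi (lπ M), ← Category.assoc, h, Category.assoc, lπ_leftUnitHom,
        ← Category.assoc, lπ_leftUnitHom, f.left_act_hom]
      simp)
    (rightUnitor_naturality := fun {M N} f => by
      apply Bimod.hom_ext
      change (map f (𝟙 (Bimod.regular A))).hom ≫ (rightUnitHom N).hom =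
        (rightUnitHom M).hom ≫ f.hom
      have h : rπ M ≫ (map f (𝟙 (Bimod.regular A))).hom = (f.hom ⊗ₘ 𝟙 A.X) ≫ rπ N := π_map _ _
      rw [← cancel_epi (rπ M), ← Category.assoc, h, Category.assoc, rπ_rightUnitHom,
        ← Category.assoc, rπ_rightUnitHom, f.right_act_hom]
      simp)
    (pentagon := fun M N P Q => by
      apply Bimod.hom_ext
      change (map (assocHom M N P) (𝟙 Q)).hom ≫ (assocHom M (tensor N P) Q).hom ≫
          (map (𝟙 M) (assocHom N P Q)).hom =
        (assocHom (tensor M N) P Q).hom ≫ (assocHom M N (tensor P Q)).hom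
      rw [← cancel_epi (π (tensor (tensor M N) P) Q), ← cancel_epi (π (tensor M N) P ▷ Q.X),
        ← cancel_epi (π M N ▷ P.X ▷ Q.X)]
      calc _ = π M N ▷ P.X ▷ Q.X ≫ π (tensor M N) P ▷ Q.X ≫ (π (tensor (tensor M N) P) Q ≫
            (map (assocHom M N P) (𝟙 Q)).hom) ≫ (assocHom M (tensor N P) Q).hom ≫
            (map (𝟙 M) (assocHom N P Q)).hom := by simp
        _ = (π M N ▷ P.X ≫ π (tensor M N) P ≫ (assocHom M N P).hom) ▷ Q.X ≫
            π (tensor M (tensor N P)) Q ≫ (assocHom M (tensor N P) Q).hom ≫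
            (map (𝟙 M) (assocHom N P Q)).hom := by rw [π_map]; simp
        _ = (α_ _ _ _).hom ▷ Q.X ≫ (M.X ◁ π N P) ▷ Q.X ≫ (π M (tensor N P) ▷ Q.X ≫
            π (tensor M (tensor N P)) Q ≫ (assocHom M (tensor N P) Q).hom) ≫
            (map (𝟙 M) (assocHom N P Q)).hom := by rw [π_assocHom]; simp
        _ = (α_ _ _ _).hom ▷ Q.X ≫ (M.X ◁ π N P) ▷ Q.X ≫ (α_ _ _ _).hom ≫
            M.X ◁ π (tensor N P) Q ≫ (π M (tensor (tensor N P) Q) ≫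
            (map (𝟙 M) (assocHom N P Q)).hom) := by rw [π_assocHom]; simp
        _ = (α_ _ _ _).hom ▷ Q.X ≫ (α_ _ _ _).hom ≫ M.X ◁ (π N P ▷ Q.X ≫
            π (tensor N P) Q ≫ (assocHom N P Q).hom) ≫ π M (tensor N (tensor P Q)) := by
            rw [π_map]; simp
        _ = 𝟙 _ ⊗≫ (M.X ⊗ N.X) ◁ π P Q ⊗≫ ((α_ _ _ _).hom ≫ M.X ◁ π N (tensor P Q) ≫
            π M (tensor N (tensor P Q))) := by rw [π_assocHom]; monoidal
        _ = 𝟙 _ ⊗≫ ((M.X ⊗ N.X) ◁ π P Q ≫ π M N ▷ (tensor P Q).X) ⊗≫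
            π (tensor M N) (tensor P Q) ≫ (assocHom M N (tensor P Q)).hom := by
            rw [← π_assocHom]; monoidal
        _ = 𝟙 _ ⊗≫ π M N ▷ P.X ▷ Q.X ⊗≫ ((α_ _ _ _).hom ≫ (tensor M N).X ◁ π P Q ≫
            π (tensor M N) (tensor P Q)) ⊗≫ (assocHom M N (tensor P Q)).hom := by
            rw [whisker_exchange]; monoidal
        _ = _ := by rw [← π_assocHom]; monoidal)
    (triangle := fun M N => by
      apply Bimod.hom_ext
      change (assocHom M (Bimod.regular A) N).hom ≫ (map (𝟙 M) (leftUnit N).hom).hom =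
        (map (rightUnit M).hom (𝟙 N)).hom
      rw [← cancel_epi (π (tensor M (Bimod.regular A)) N),
        ← cancel_epi (rπ M ▷ N.X)]
      have h1 : rπ M ▷ N.X ≫ π (tensor M (Bimod.regular A)) N ≫
          (assocHom M (Bimod.regular A) N).hom = (α_ M.X A.X N.X).hom ≫ M.X ◁ lπ N ≫
            π M (tensor (Bimod.regular A) N) := π_assocHom _ _ _
      have h2 : π M (tensor (Bimod.regular A) N) ≫ (map (𝟙 M) (leftUnit N).hom).hom =
          M.X ◁ (leftUnitHom N).hom ≫ π M N := by
        rw [π_map]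
        change (𝟙 M.X ⊗ₘ (leftUnitHom N).hom) ≫ π M N = _
        simp
      have h3 : π (tensor M (Bimod.regular A)) N ≫ (map (rightUnit M).hom (𝟙 N)).hom =
          (rightUnitHom M).hom ▷ N.X ≫ π M N := by
        rw [π_map]
        change ((rightUnitHom M).hom ⊗ₘ 𝟙 N.X) ≫ π M N = _
        simp
      calc _ = (rπ M ▷ N.X ≫ π (tensor M (Bimod.regular A)) N ≫
            (assocHom M (Bimod.regular A) N).hom) ≫ (map (𝟙 M) (leftUnit N).hom).hom := by simp
        _ = (α_ M.X A.X N.X).hom ≫ M.X ◁ lπ N ≫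
            (π M (tensor (Bimod.regular A) N) ≫ (map (𝟙 M) (leftUnit N).hom).hom) := by
            rw [h1]; simp
        _ = (α_ M.X A.X N.X).hom ≫ M.X ◁ (lπ N ≫ (leftUnitHom N).hom) ≫ π M N := by
            rw [h2]; simp
        _ = M.actRight ▷ N.X ≫ π M N := by rw [lπ_leftUnitHom, π_condition]
        _ = rπ M ▷ N.X ≫ (rightUnitHom M).hom ▷ N.X ≫ π M N := by
            rw [← MonoidalCategory.comp_whiskerRight_assoc, rπ_rightUnitHom]
        _ = _ := by rw [h3])

end

end BalTensor

section

variable {D : Type u} [Category.{v} D] [MonoidalCategory D]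

/-- An algebra `S` in a monoidal category is separable if its multiplication `S ⊗ S ⟶ S` has a
section that is a morphism of `S`-bimodules. -/
def IsSeparableAlgebra (S : D) [MonObj S] : Prop :=
  ∃ σ : S ⟶ S ⊗ S, σ ≫ μ[S] = 𝟙 S ∧
    μ[S] ≫ σ = S ◁ σ ≫ (α_ S S S).inv ≫ μ[S] ▷ S ∧
    μ[S] ≫ σ = σ ▷ S ≫ (α_ S S S).hom ≫ S ◁ μ[S]

/-- A bicomodule over a coalgebra `K` in a monoidal category. -/
structure Bicomodule (K : D) [ComonObj K] where
  X : D
  coactLeft : X ⟶ K ⊗ X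
  coactRight : X ⟶ X ⊗ K
  left_counit : coactLeft ≫ ComonObj.counit (X := K) ▷ X = (λ_ X).inv
  left_coassoc : coactLeft ≫ ComonObj.comul (X := K) ▷ X =
    coactLeft ≫ K ◁ coactLeft ≫ (α_ K K X).inv
  right_counit : coactRight ≫ X ◁ ComonObj.counit (X := K) = (ρ_ X).inv
  right_coassoc : coactRight ≫ X ◁ ComonObj.comul (X := K) =
    coactRight ≫ coactRight ▷ K ≫ (α_ X K K).hom
  middle_coassoc : coactLeft ≫ K ◁ coactRight =
    coactRight ≫ coactLeft ▷ K ≫ (α_ K X K).hom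

namespace Bicomodule

/-- A coalgebra as a bicomodule over itself. -/
@[simps]
def regular (K : D) [ComonObj K] : Bicomodule K where
  X := K
  coactLeft := ComonObj.comul
  coactRight := ComonObj.comul
  left_counit := ComonObj.counit_comul K
  left_coassoc := by rw [ComonObj.comul_assoc_flip]
  right_counit := ComonObj.comul_counit K
  right_coassoc := ComonObj.comul_assoc K
  middle_coassoc := ComonObj.comul_assoc K

/-- A morphism between the underlying objects of two bicomodules is bicolinear. -/
structure IsBicolinear {K : D} [ComonObj K] {M N : Bicomodule K} (f : M.X ⟶ N.X) : Prop where
  left : f ≫ N.coactLeft = M.coactLeft ≫ K ◁ f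
  right : f ≫ N.coactRight = M.coactRight ≫ f ▷ K

end Bicomodule

/-- A coalgebra `K` is coseparable if it is a relative injective `K`-bicomodule: if a bicolinear
morphism `i : M ⟶ N` has a left inverse `p` in the underlying category, then each bicolinear
`f : M ⟶ K` factors through `i` by a bicolinear morphism `g : N ⟶ K`. -/
def IsCoseparableCoalgebra (K : D) [ComonObj K] : Prop :=
  ∀ (M N : Bicomodule K) (i : M.X ⟶ N.X) (p : N.X ⟶ M.X) (f : M.X ⟶ (Bicomodule.regular K).X),
    Bicomodule.IsBicolinear (M := M) (N := N) i → i ≫ p = 𝟙 M.X →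
    Bicomodule.IsBicolinear (M := M) (N := Bicomodule.regular K) f →
    ∃ g : N.X ⟶ (Bicomodule.regular K).X,
      Bicomodule.IsBicolinear (M := N) (N := Bicomodule.regular K) g ∧ i ≫ g = f

/-- `P` is a left `⊗`-generator: if `f, g : Y ⊗ Z ⟶ W` satisfy `f ∘ (h ⊗ Z) = g ∘ (h ⊗ Z)` for all
`h : P ⟶ Y`, then `f = g`. -/
def IsLeftTensorGenerator (P : D) : Prop :=
  ∀ (Y Z W : D) (f g : Y ⊗ Z ⟶ W), (∀ h : P ⟶ Y, h ▷ Z ≫ f = h ▷ Z ≫ g) → f = g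

end

/-- A functor `F` is separable if the maps `Hom(X, Y) → Hom(F X, F Y)` have left inverses that are
natural in `X` and `Y`. -/
def IsSeparableFunctor {D : Type*} [Category D] {E : Type*} [Category E] (F : D ⥤ E) : Prop :=
  ∃ P : ∀ X Y : D, (F.obj X ⟶ F.obj Y) → (X ⟶ Y),
    (∀ (X Y : D) (f : X ⟶ Y), P X Y (F.map f) = f) ∧
    ∀ (X' X Y Y' : D) (f : X' ⟶ X) (g : F.obj X ⟶ F.obj Y) (h : Y ⟶ Y'),
      P X' Y' (F.map f ≫ g ≫ F.map h) = f ≫ P X Y g ≫ h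

namespace RightMod

section

variable {C : Type u} [Category.{v} C] [MonoidalCategory C]

/-- A morphism of right `S`-modules. -/
@[ext]
structure Hom {S : Mon C} (M N : RightMod S) where
  f : M.X ⟶ N.X
  act_comm : M.act ≫ f = f ▷ S.X ≫ N.act

/-- The category `C_S` of right `S`-modules. -/
instance (S : Mon C) : Category (RightMod S) where
  Hom M N := Hom M N
  id M := { f := 𝟙 M.X, act_comm := by simp }
  comp {M N P} f g := { f := f.f ≫ g.f
                        act_comm := by
                          rw [← Category.assoc, f.act_comm, Category.assoc, g.act_comm]; simp }
  id_comp f := Hom.ext (Category.id_comp f.f)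
  comp_id f := Hom.ext (Category.comp_id f.f)
  assoc f g h := Hom.ext (Category.assoc f.f g.f h.f)

/-- Restriction of scalars along an algebra morphism `i : A ⟶ S`. -/
def restrictScalars {A S : Mon C} (i : A ⟶ S) : RightMod S ⥤ RightMod A where
  obj M :=
    { X := M.X
      act := M.X ◁ i.hom ≫ M.act
      act_one := by
        rw [← MonoidalCategory.whiskerLeft_comp_assoc, IsMonHom.one_hom, M.act_one]
      act_assoc := by
        calc _ = M.X ◁ (μ[A.X] ≫ i.hom) ≫ M.act := by
              rw [MonoidalCategory.whiskerLeft_comp, Category.assoc]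
          _ = 𝟙 _ ⊗≫ M.X ◁ i.hom ▷ A.X ⊗≫ M.X ◁ S.X ◁ i.hom ⊗≫ (M.X ◁ μ[S.X] ≫ M.act) := by
              rw [IsMonHom.mul_hom, MonoidalCategory.tensorHom_def]; monoidal
          _ = 𝟙 _ ⊗≫ M.X ◁ i.hom ▷ A.X ⊗≫ ((M.X ⊗ S.X) ◁ i.hom ≫ M.act ▷ S.X) ⊗≫ M.act := by
              rw [M.act_assoc]; monoidal
          _ = _ := by rw [whisker_exchange]; monoidal }
  map {M N} f :=
    { f := Hom.f (S := S) f
      act_comm := by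
        have h := Hom.act_comm (S := S) f
        change (M.X ◁ i.hom ≫ M.act) ≫ Hom.f (S := S) f =
          Hom.f (S := S) f ▷ A.X ≫ N.X ◁ i.hom ≫ N.act
        rw [Category.assoc, h, whisker_exchange_assoc] }

end

end RightMod

namespace BalTensor

section

variable {C : Type u} [Category.{v} C] [MonoidalCategory C] [HasCoequalizers C] [LeftCoflat C]
variable {A : Mon C} [LeftModulesRobust A]

/-- An algebra in `_A C_A` whose multiplication is induced by a morphism `m : B ⊗ B ⟶ B`. -/
@[reducible]
noncomputable def monObjOfMul (B : Bimod A A) (e : Bimod.regular A ⟶ B) (f : tensor B B ⟶ B)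
    (u : A.X ⟶ B.X) (hu : e.hom = u) (m : B.X ⊗ B.X ⟶ B.X) (hf : π B B ≫ f.hom = m)
    (h1 : u ▷ B.X ≫ m = B.actLeft)
    (h2 : B.X ◁ u ≫ m = B.actRight)
    (h3 : m ▷ B.X ≫ m = (α_ B.X B.X B.X).hom ≫ B.X ◁ m ≫ m) : MonObj B where
  one := e
  mul := f
  one_mul := by
    apply Bimod.hom_ext
    change (map e (𝟙 B)).hom ≫ f.hom = (leftUnitHom B).hom
    have h : lπ B ≫ (map e (𝟙 B)).hom = (u ⊗ₘ 𝟙 B.X) ≫ π B B := by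
      rw [← hu]; exact π_map _ _
    rw [← cancel_epi (lπ B), ← Category.assoc, h, Category.assoc, hf, lπ_leftUnitHom, ← h1]
    simp
  mul_one := by
    apply Bimod.hom_ext
    change (map (𝟙 B) e).hom ≫ f.hom = (rightUnitHom B).hom
    have h : rπ B ≫ (map (𝟙 B) e).hom = (𝟙 B.X ⊗ₘ u) ≫ π B B := by
      rw [← hu]; exact π_map _ _
    rw [← cancel_epi (rπ B), ← Category.assoc, h, Category.assoc, hf, rπ_rightUnitHom, ← h2]
    simp
  mul_assoc := by
    apply Bimod.hom_ext
    change (map f (𝟙 B)).hom ≫ f.hom = (assocHom B B B).hom ≫ (map (𝟙 B) f).hom ≫ f.hom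
    rw [← cancel_epi (π (tensor B B) B), ← cancel_epi (π B B ▷ B.X)]
    calc _ = π B B ▷ B.X ≫ (π (tensor B B) B ≫ (map f (𝟙 B)).hom) ≫ f.hom := by simp
      _ = (π B B ≫ f.hom) ▷ B.X ≫ π B B ≫ f.hom := by rw [π_map]; simp
      _ = (α_ B.X B.X B.X).hom ≫ B.X ◁ (π B B ≫ f.hom) ≫ π B B ≫ f.hom := by rw [hf, h3]
      _ = (α_ B.X B.X B.X).hom ≫ B.X ◁ π B B ≫ (π B (tensor B B) ≫ (map (𝟙 B) f).hom) ≫ f.hom := by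
          rw [π_map]; simp
      _ = (π B B ▷ B.X ≫ π (tensor B B) B ≫ (assocHom B B B).hom) ≫ (map (𝟙 B) f).hom ≫ f.hom := by
          rw [π_assocHom]; simp
      _ = _ := by simp

end

end BalTensor

namespace AlgExtension

section

variable {C : Type u} [Category.{v} C] [MonoidalCategory C] {A S : Mon C} (i : A ⟶ S)

theorem one_act : η[A.X] ▷ S.X ≫ i.hom ▷ S.X ≫ μ[S.X] = (λ_ S.X).hom := by
  rw [← MonoidalCategory.comp_whiskerRight_assoc, IsMonHom.one_hom, MonObj.one_mul]

theorem act_one : S.X ◁ η[A.X] ≫ S.X ◁ i.hom ≫ μ[S.X] = (ρ_ S.X).hom := by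
  rw [← MonoidalCategory.whiskerLeft_comp_assoc, IsMonHom.one_hom, MonObj.mul_one]

theorem left_assoc : μ[A.X] ▷ S.X ≫ i.hom ▷ S.X ≫ μ[S.X] =
    (α_ A.X A.X S.X).hom ≫ A.X ◁ (i.hom ▷ S.X ≫ μ[S.X]) ≫ i.hom ▷ S.X ≫ μ[S.X] := by
  calc _ = (μ[A.X] ≫ i.hom) ▷ S.X ≫ μ[S.X] := by
        rw [MonoidalCategory.comp_whiskerRight, Category.assoc]
    _ = 𝟙 _ ⊗≫ A.X ◁ i.hom ▷ S.X ⊗≫ i.hom ▷ S.X ▷ S.X ⊗≫ (μ[S.X] ▷ S.X ≫ μ[S.X]) := by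
        rw [IsMonHom.mul_hom, MonoidalCategory.tensorHom_def']; monoidal
    _ = 𝟙 _ ⊗≫ A.X ◁ i.hom ▷ S.X ⊗≫ (i.hom ▷ (S.X ⊗ S.X) ≫ S.X ◁ μ[S.X]) ⊗≫ μ[S.X] := by
        rw [MonObj.mul_assoc]; monoidal
    _ = _ := by rw [← whisker_exchange]; monoidal

theorem right_assoc : S.X ◁ μ[A.X] ≫ S.X ◁ i.hom ≫ μ[S.X] =
    (α_ S.X A.X A.X).inv ≫ (S.X ◁ i.hom ≫ μ[S.X]) ▷ A.X ≫ S.X ◁ i.hom ≫ μ[S.X] := by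
  calc _ = S.X ◁ (μ[A.X] ≫ i.hom) ≫ μ[S.X] := by
        rw [MonoidalCategory.whiskerLeft_comp, Category.assoc]
    _ = 𝟙 _ ⊗≫ S.X ◁ i.hom ▷ A.X ⊗≫ S.X ◁ S.X ◁ i.hom ⊗≫ (S.X ◁ μ[S.X] ≫ μ[S.X]) := by
        rw [IsMonHom.mul_hom, MonoidalCategory.tensorHom_def]; monoidal
    _ = 𝟙 _ ⊗≫ S.X ◁ i.hom ▷ A.X ⊗≫ ((S.X ⊗ S.X) ◁ i.hom ≫ μ[S.X] ▷ S.X) ⊗≫ μ[S.X] := by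
        rw [MonObj.mul_assoc_flip]; monoidal
    _ = _ := by rw [whisker_exchange]; monoidal

/-- `S` as an `A`-bimodule, along an algebra morphism `i : A ⟶ S`. -/
@[simps]
def bimod : Bimod A A where
  X := S.X
  actLeft := i.hom ▷ S.X ≫ μ[S.X]
  actRight := S.X ◁ i.hom ≫ μ[S.X]
  one_actLeft := one_act i
  actRight_one := act_one i
  left_assoc := left_assoc i
  right_assoc := right_assoc i
  middle_assoc := by
    calc _ = 𝟙 _ ⊗≫ i.hom ▷ S.X ▷ A.X ⊗≫ (μ[S.X] ▷ A.X ≫ S.X ◁ i.hom) ⊗≫ μ[S.X] := by monoidal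
      _ = 𝟙 _ ⊗≫ i.hom ▷ S.X ▷ A.X ⊗≫ (S.X ⊗ S.X) ◁ i.hom ⊗≫ (μ[S.X] ▷ S.X ≫ μ[S.X]) := by
          rw [← whisker_exchange]; monoidal
      _ = 𝟙 _ ⊗≫ (i.hom ▷ (S.X ⊗ A.X) ≫ S.X ◁ (S.X ◁ i.hom ≫ μ[S.X])) ⊗≫ μ[S.X] := by
          rw [MonObj.mul_assoc]; monoidal
      _ = _ := by rw [← whisker_exchange]; monoidal

/-- `S` as an `(S, A)`-bimodule. -/
@[simps]
def leftBimod : Bimod S A where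
  X := S.X
  actLeft := μ[S.X]
  actRight := S.X ◁ i.hom ≫ μ[S.X]
  actRight_one := act_one i
  right_assoc := right_assoc i
  middle_assoc := by
    calc _ = (μ[S.X] ▷ A.X ≫ S.X ◁ i.hom) ≫ μ[S.X] := by simp
      _ = 𝟙 _ ⊗≫ S.X ◁ S.X ◁ i.hom ⊗≫ (μ[S.X] ▷ S.X ≫ μ[S.X]) := by
          rw [← whisker_exchange]; monoidal
      _ = _ := by rw [MonObj.mul_assoc]; monoidal

/-- `S` as an `(A, S)`-bimodule. -/
@[simps]
def rightBimod : Bimod A S where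
  X := S.X
  actLeft := i.hom ▷ S.X ≫ μ[S.X]
  actRight := μ[S.X]
  one_actLeft := one_act i
  left_assoc := left_assoc i
  middle_assoc := by
    calc _ = 𝟙 _ ⊗≫ i.hom ▷ S.X ▷ S.X ⊗≫ (μ[S.X] ▷ S.X ≫ μ[S.X]) := by monoidal
      _ = 𝟙 _ ⊗≫ (i.hom ▷ (S.X ⊗ S.X) ≫ S.X ◁ μ[S.X]) ⊗≫ μ[S.X] := by
          rw [MonObj.mul_assoc]; monoidal
      _ = _ := by rw [← whisker_exchange]; monoidal

theorem balanced : (S.X ◁ i.hom ≫ μ[S.X]) ▷ S.X ≫ μ[S.X] =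
    (α_ S.X A.X S.X).hom ≫ S.X ◁ (i.hom ▷ S.X ≫ μ[S.X]) ≫ μ[S.X] := by
  calc _ = 𝟙 _ ⊗≫ S.X ◁ i.hom ▷ S.X ⊗≫ (μ[S.X] ▷ S.X ≫ μ[S.X]) := by monoidal
    _ = _ := by rw [MonObj.mul_assoc]; monoidal

variable [HasCoequalizers C] [LeftCoflat C] [LeftModulesRobust A]

/-- The multiplication `S ⊗_A S ⟶ S`, as a morphism of `S`-bimodules. -/
noncomputable def mulOver :
    BalTensor.tensor (leftBimod i) (rightBimod i) ⟶ Bimod.regular S :=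
  BalTensor.lift (leftBimod i) (rightBimod i) (Bimod.regular S) μ[S.X] (balanced i)
    (MonObj.mul_assoc_flip S.X) (MonObj.mul_assoc S.X)

/-- The extension `i : A ⟶ S` is separable: the multiplication `S ⊗_A S ⟶ S` is a split epimorphism
of `S`-bimodules. -/
def IsSeparable : Prop := IsSplitEpi (mulOver i)

/-- The unit of the `A`-ring `S`. -/
def ringOne : Bimod.regular A ⟶ bimod i where
  hom := i.hom
  left_act_hom := by
    change μ[A.X] ≫ i.hom = A.X ◁ i.hom ≫ i.hom ▷ S.X ≫ μ[S.X]
    rw [IsMonHom.mul_hom, MonoidalCategory.tensorHom_def', Category.assoc]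
  right_act_hom := by
    change μ[A.X] ≫ i.hom = i.hom ▷ A.X ≫ S.X ◁ i.hom ≫ μ[S.X]
    rw [IsMonHom.mul_hom, MonoidalCategory.tensorHom_def, Category.assoc]

/-- The multiplication of the `A`-ring `S`. -/
noncomputable def ringMul : BalTensor.tensor (bimod i) (bimod i) ⟶ bimod i :=
  BalTensor.lift (bimod i) (bimod i) (bimod i) μ[S.X] (balanced i)
    (by
      change A.X ◁ μ[S.X] ≫ i.hom ▷ S.X ≫ μ[S.X] =
        (α_ A.X S.X S.X).inv ≫ (i.hom ▷ S.X ≫ μ[S.X]) ▷ S.X ≫ μ[S.X]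
      calc _ = (A.X ◁ μ[S.X] ≫ i.hom ▷ S.X) ≫ μ[S.X] := by simp
        _ = 𝟙 _ ⊗≫ i.hom ▷ (S.X ⊗ S.X) ⊗≫ (S.X ◁ μ[S.X] ≫ μ[S.X]) := by
            rw [whisker_exchange]; monoidal
        _ = _ := by rw [MonObj.mul_assoc_flip]; monoidal)
    (by
      change μ[S.X] ▷ A.X ≫ S.X ◁ i.hom ≫ μ[S.X] =
        (α_ S.X S.X A.X).hom ≫ S.X ◁ (S.X ◁ i.hom ≫ μ[S.X]) ≫ μ[S.X]
      calc _ = (μ[S.X] ▷ A.X ≫ S.X ◁ i.hom) ≫ μ[S.X] := by simp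
        _ = 𝟙 _ ⊗≫ S.X ◁ S.X ◁ i.hom ⊗≫ (μ[S.X] ▷ S.X ≫ μ[S.X]) := by
            rw [← whisker_exchange]; monoidal
        _ = _ := by rw [MonObj.mul_assoc]; monoidal)

/-- The `A`-ring `S`: the algebra in `_A C_A` that corresponds to the extension `i : A ⟶ S`. -/
noncomputable instance ring : MonObj (bimod i) :=
  BalTensor.monObjOfMul (bimod i) (ringOne i) (ringMul i) i.hom rfl μ[S.X] (BalTensor.π_lift _ _ _ _ _ _ _)
    rfl rfl (MonObj.mul_assoc S.X)

end

end AlgExtension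

/-!
All five assertions are compared through two intermediate conditions.

*Separability of `Y` and of the extension `A ⟶ S`, `S = Y ⊗ A`.* A morphism `Z ⟶ W` in `_A^#𝒯` is
the same as an `A`-bilinear morphism `Z ⊗ A ⟶ W ⊗ A`, where `A` acts on the left of `Z ⊗ A` through
the transfer morphism of `Z` (`LeftTransfer.toBase_injective`, `LeftTransfer.exists_toBase_eq`),
and `(Y ⊗ Y) ⊗ A` is a model of `S ⊗_A S`: the morphism `S ⊗ S ⟶ (Y ⊗ Y) ⊗ A` is a split
coequalizer of the `A`-balancing relation. A bilinear section of the multiplication of `Y` is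
therefore the same as a bilinear section of `S ⊗_A S ⟶ S`
(`LeftTransfer.isSeparableAlgebra_iff_section`). Separability of the extension and of the `A`-ring
`S` also amount to such a section (`AlgExtension.isSeparable_iff`,
`AlgExtension.isSeparableAlgebra_bimod_iff`); for the `A`-ring this is checked after precomposition
with the epimorphism `S ⊗ S ⟶ S ⊗_A S`, and an `S`-bilinear section is automatically `A`-bilinear.

*Coseparability of `X` and separability of `Y`.* An algebra `Y` is separable exactly if it has a
normalised Casimir element `t : 𝟙 ⟶ Y ⊗ Y` (`isSeparableAlgebra_iff_casimir`), and a coalgebra `X`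
is coseparable exactly if it has a normalised form `κ : X ⊗ X ⟶ 𝟙` with `(X ⊗ κ) ∘ (δ ⊗ X) = (κ ⊗
X) ∘ (X ⊗ δ)` (`isCoseparableCoalgebra_iff_form`). In `C`, such `t` and `κ` are morphisms `𝟙 ⟶ (Y ⊗
Y) ⊗ A` and `X ⊗ X ⟶ A`, which correspond to each other by transposition along `X ⊗ X ⊣ Y ⊗ Y`.
Each condition on `t`, including that of being a morphism of `_A^#𝒯`, transposes to the matching
condition on `κ` (`RightTransfer.mate_comm_iff`, `RightTransfer.casimir_iff_form`).

*Restriction of scalars.* Given a bilinear section `σ`, averaging a right `A`-linear `g : M ⟶ N`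
over the separability idempotent `σ(1)`, i.e. `x ↦ ∑ g(x e') e''`, gives a natural `S`-linear
morphism, and leaves `g` unchanged if it is `S`-linear
(`AlgExtension.isSeparableFunctor_of_section`); robustness makes this morphism exist. Conversely, a
natural left inverse of the functor on hom sets turns the `A`-linear morphism `s ↦ s ⊗ 1` into a
right `S`-linear section `S ⟶ S ⊗_A S`. Naturality shows that it commutes with left multiplication
by each `x : 𝟙 ⟶ S`, which is left `S`-linearity if `𝟙` is a left `⊗`-generator
(`AlgExtension.exists_section_of_isSeparableFunctor`).
-/

/-! ### Separability of extensions and of `A`-rings, tested in `C` -/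

namespace BalTensor

section

variable {C : Type u} [Category.{v} C] [MonoidalCategory C] [HasCoequalizers C] [LeftCoflat C]
variable {A : Mon C} [LeftModulesRobust A] {B : Bimod A A}

/-- Left linearity in `_A C_A` of a morphism `B ⟶ B ⊗_A B`, tested in `C`: precomposing with the
epimorphism `B ⊗ B ⟶ B ⊗_A B` removes the inner balanced tensor product. Here `L` is the action of
`B` on `B ⊗_A B` that `m` induces. -/
theorem left_linear_iff {m : tensor B B ⟶ B} {m' : B.X ⊗ B.X ⟶ B.X} (hm : π B B ≫ m.hom = m')
    {L : B.X ⊗ (tensor B B).X ⟶ (tensor B B).X}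
    (hL : B.X ◁ π B B ≫ L = (α_ B.X B.X B.X).inv ≫ m' ▷ B.X ≫ π B B) (σ : B ⟶ tensor B B) :
    m ≫ σ = map (𝟙 B) σ ≫ (assoc B B B).inv ≫ map m (𝟙 B) ↔ m' ≫ σ.hom = B.X ◁ σ.hom ≫ L := by
  have h1 : π B B ≫ (map (𝟙 B) σ).hom = B.X ◁ σ.hom ≫ π B (tensor B B) := by
    rw [π_map]; simp
  have h2 : π B (tensor B B) ≫ assocInv B B B ≫ (map m (𝟙 B)).hom = L := by
    have h4 : π (tensor B B) B ≫ (map m (𝟙 B)).hom = m.hom ▷ B.X ≫ π B B := by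
      rw [π_map]; simp
    rw [← cancel_epi (B.X ◁ π B B), hL]
    calc _ = (B.X ◁ π B B ≫ π B (tensor B B) ≫ assocInv B B B) ≫ (map m (𝟙 B)).hom := by simp
      _ = (α_ B.X B.X B.X).inv ≫ (π B B ≫ m.hom) ▷ B.X ≫ π B B := by
          rw [π_assocInv, Category.assoc, Category.assoc, h4]; simp
      _ = _ := by rw [hm]
  have h3 : π B B ≫ (map (𝟙 B) σ ≫ (assoc B B B).inv ≫ map m (𝟙 B)).hom = B.X ◁ σ.hom ≫ L := by
    change π B B ≫ (map (𝟙 B) σ).hom ≫ assocInv B B B ≫ (map m (𝟙 B)).hom = _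
    rw [reassoc_of% h1, h2]
  have h4 : π B B ≫ (m ≫ σ).hom = m' ≫ σ.hom := by
    rw [← hm, Category.assoc]; rfl
  rw [← h3, ← h4, cancel_epi]
  exact ⟨congrArg _, Bimod.hom_ext _ _⟩

/-- Right linearity in `_A C_A` of a morphism `B ⟶ B ⊗_A B`, tested in `C`. -/
theorem right_linear_iff {m : tensor B B ⟶ B} {m' : B.X ⊗ B.X ⟶ B.X} (hm : π B B ≫ m.hom = m')
    {R : (tensor B B).X ⊗ B.X ⟶ (tensor B B).X}
    (hR : π B B ▷ B.X ≫ R = (α_ B.X B.X B.X).hom ≫ B.X ◁ m' ≫ π B B) (σ : B ⟶ tensor B B) :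
    m ≫ σ = map σ (𝟙 B) ≫ (assoc B B B).hom ≫ map (𝟙 B) m ↔ m' ≫ σ.hom = σ.hom ▷ B.X ≫ R := by
  have h1 : π B B ≫ (map σ (𝟙 B)).hom = σ.hom ▷ B.X ≫ π (tensor B B) B := by
    rw [π_map]; simp
  have h2 : π (tensor B B) B ≫ (assocHom B B B).hom ≫ (map (𝟙 B) m).hom = R := by
    have h4 : π B (tensor B B) ≫ (map (𝟙 B) m).hom = B.X ◁ m.hom ≫ π B B := by
      rw [π_map]; simp
    rw [← cancel_epi (π B B ▷ B.X), hR]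
    calc _ = (π B B ▷ B.X ≫ π (tensor B B) B ≫ (assocHom B B B).hom) ≫ (map (𝟙 B) m).hom := by
          simp
      _ = (α_ B.X B.X B.X).hom ≫ B.X ◁ (π B B ≫ m.hom) ≫ π B B := by
          rw [π_assocHom, Category.assoc, Category.assoc, h4]; simp
      _ = _ := by rw [hm]
  have h3 : π B B ≫ (map σ (𝟙 B) ≫ (assoc B B B).hom ≫ map (𝟙 B) m).hom = σ.hom ▷ B.X ≫ R := by
    change π B B ≫ (map σ (𝟙 B)).hom ≫ (assocHom B B B).hom ≫ (map (𝟙 B) m).hom = _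
    rw [reassoc_of% h1, h2]
  have h4 : π B B ≫ (m ≫ σ).hom = m' ≫ σ.hom := by
    rw [← hm, Category.assoc]; rfl
  rw [← h3, ← h4, cancel_epi]
  exact ⟨congrArg _, Bimod.hom_ext _ _⟩

end

end BalTensor

namespace AlgExtension

section

variable {C : Type u} [Category.{v} C] [MonoidalCategory C] {A S : Mon C} (i : A ⟶ S)
variable [HasCoequalizers C] [LeftCoflat C] [LeftModulesRobust A]

/-- The `S`-bimodule `S ⊗_A S`. -/
noncomputable abbrev sq : Bimod S S :=
  BalTensor.tensor (leftBimod i) (rightBimod i)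

/-- The projection `S ⊗ S ⟶ S ⊗_A S`. -/
noncomputable abbrev proj : S.X ⊗ S.X ⟶ (sq i).X :=
  BalTensor.π (leftBimod i) (rightBimod i)

instance : TensorEpi (proj i) :=
  inferInstanceAs (TensorEpi (BalTensor.π (leftBimod i) (rightBimod i)))

theorem proj_actLeft : S.X ◁ proj i ≫ (sq i).actLeft =
    (α_ S.X S.X S.X).inv ≫ μ[S.X] ▷ S.X ≫ proj i :=
  BalTensor.π_actLeft (leftBimod i) (rightBimod i)

theorem proj_actRight : proj i ▷ S.X ≫ (sq i).actRight =
    (α_ S.X S.X S.X).hom ≫ S.X ◁ μ[S.X] ≫ proj i :=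
  BalTensor.π_actRight (leftBimod i) (rightBimod i)

/-- The multiplication `S ⊗_A S ⟶ S`, as a morphism of `C`. -/
noncomputable def mulSq : (sq i).X ⟶ S.X := (mulOver i).hom

theorem proj_mulSq : proj i ≫ mulSq i = μ[S.X] :=
  BalTensor.π_lift (leftBimod i) (rightBimod i) (Bimod.regular S) _ _ _ _

/-- A morphism `S ⟶ S ⊗_A S` of `C` is a bilinear section if it is a morphism of `S`-bimodules and
a section of the multiplication. -/
structure IsBilinearSection (σ : S.X ⟶ (sq i).X) : Prop where
  comp_mulSq : σ ≫ mulSq i = 𝟙 S.X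
  left : μ[S.X] ≫ σ = S.X ◁ σ ≫ (sq i).actLeft
  right : μ[S.X] ≫ σ = σ ▷ S.X ≫ (sq i).actRight

theorem isSeparable_iff : IsSeparable i ↔ ∃ σ, IsBilinearSection i σ := by
  constructor
  · rintro ⟨⟨s⟩⟩
    exact ⟨s.section_.hom, congrArg Bimod.Hom.hom s.id, s.section_.left_act_hom,
      s.section_.right_act_hom⟩
  · rintro ⟨σ, h1, h2, h3⟩
    exact ⟨⟨⟨{ hom := σ, left_act_hom := h2, right_act_hom := h3 }, Bimod.hom_ext _ _ h1⟩⟩⟩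

variable {i} in
/-- A left `S`-linear section is left `A`-linear for the action of `A` restricted along `i`. -/
theorem IsBilinearSection.left_restrict {σ : S.X ⟶ (sq i).X} (h : IsBilinearSection i σ)
    {L : A.X ⊗ (sq i).X ⟶ (sq i).X}
    (hL : A.X ◁ proj i ≫ L = (α_ _ _ _).inv ≫ (i.hom ▷ S.X ≫ μ[S.X]) ▷ S.X ≫ proj i) :
    (i.hom ▷ S.X ≫ μ[S.X]) ≫ σ = A.X ◁ σ ≫ L := by
  have h6 : i.hom ▷ (sq i).X ≫ (sq i).actLeft = L := by
    rw [← cancel_epi (A.X ◁ proj i), hL, whisker_exchange_assoc, proj_actLeft]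
    monoidal
  rw [Category.assoc, h.left, ← whisker_exchange_assoc, h6]

variable {i} in
/-- A right `S`-linear section is right `A`-linear for the action of `A` restricted along `i`. -/
theorem IsBilinearSection.right_restrict {σ : S.X ⟶ (sq i).X} (h : IsBilinearSection i σ)
    {R : (sq i).X ⊗ A.X ⟶ (sq i).X}
    (hR : proj i ▷ A.X ≫ R = (α_ _ _ _).hom ≫ S.X ◁ (S.X ◁ i.hom ≫ μ[S.X]) ≫ proj i) :
    (S.X ◁ i.hom ≫ μ[S.X]) ≫ σ = σ ▷ A.X ≫ R := by
  have h6 : (sq i).X ◁ i.hom ≫ (sq i).actRight = R := by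
    rw [← cancel_epi (proj i ▷ A.X), hR, ← whisker_exchange_assoc, proj_actRight]
    monoidal
  rw [Category.assoc, h.right, whisker_exchange_assoc, h6]

/-- An `A`-ring is separable exactly if the corresponding algebra extension is. -/
theorem isSeparableAlgebra_bimod_iff :
    IsSeparableAlgebra (bimod i) ↔ ∃ σ, IsBilinearSection i σ := by
  have hm : BalTensor.π (bimod i) (bimod i) ≫ (ringMul i).hom = μ[S.X] :=
    BalTensor.π_lift _ _ _ _ _ _ _
  have hl := BalTensor.left_linear_iff hm (proj_actLeft i)
  have hr := BalTensor.right_linear_iff hm (proj_actRight i)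
  constructor
  · rintro ⟨σ, h1, h2, h3⟩
    exact ⟨Bimod.Hom.hom σ, congrArg Bimod.Hom.hom h1, (hl σ).1 h2, (hr σ).1 h3⟩
  · rintro ⟨σ, h⟩
    let σ' : bimod i ⟶ BalTensor.tensor (bimod i) (bimod i) :=
      { hom := σ
        left_act_hom := h.left_restrict (BalTensor.π_actLeft (bimod i) (bimod i))
        right_act_hom := h.right_restrict (BalTensor.π_actRight (bimod i) (bimod i)) }
    exact ⟨σ', Bimod.hom_ext _ _ h.comp_mulSq, (hl σ').2 h.left, (hr σ').2 h.right⟩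

end

end AlgExtension

/-! ### Separability of restriction of scalars -/

namespace AlgExtension

section

variable {C : Type u} [Category.{v} C] [MonoidalCategory C] {A S : Mon C} (i : A ⟶ S)
variable [HasCoequalizers C] [LeftCoflat C] [LeftModulesRobust A]

section

variable {M N : RightMod S} (g : M.X ⟶ N.X)
  (hg : (M.X ◁ i.hom ≫ M.act) ≫ g = g ▷ A.X ≫ N.X ◁ i.hom ≫ N.act)

/-- For a right `A`-linear `g : M ⟶ N` between right `S`-modules, the morphism
`M ⊗ (S ⊗_A S) ⟶ N` given on elements by `x ⊗ (s ⊗ t) ↦ g(xs)t`. It exists because `M ⊗ -`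
preserves the coequalizer `S ⊗_A S`. -/
noncomputable def sandwich : M.X ⊗ (sq i).X ⟶ N.X :=
  BalTensor.descL (leftBimod i) (rightBimod i) M.X
    ((α_ M.X S.X S.X).inv ≫ (M.act ≫ g) ▷ S.X ≫ N.act) (by
      change M.X ◁ (S.X ◁ i.hom ≫ μ[S.X]) ▷ S.X ≫ _ =
        M.X ◁ (α_ S.X A.X S.X).hom ≫ M.X ◁ S.X ◁ (i.hom ▷ S.X ≫ μ[S.X]) ≫ _
      calc _ = 𝟙 _ ⊗≫ M.X ◁ S.X ◁ i.hom ▷ S.X ⊗≫ (M.X ◁ μ[S.X] ≫ M.act) ▷ S.X ⊗≫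
            g ▷ S.X ⊗≫ N.act := by monoidal
        _ = 𝟙 _ ⊗≫ ((M.X ⊗ S.X) ◁ i.hom ≫ M.act ▷ S.X) ▷ S.X ⊗≫ M.act ▷ S.X ⊗≫
            g ▷ S.X ⊗≫ N.act := by rw [M.act_assoc]; monoidal
        _ = 𝟙 _ ⊗≫ M.act ▷ A.X ▷ S.X ⊗≫ ((M.X ◁ i.hom ≫ M.act) ≫ g) ▷ S.X ⊗≫ N.act := by
            rw [whisker_exchange]; monoidal
        _ = 𝟙 _ ⊗≫ M.act ▷ A.X ▷ S.X ⊗≫ g ▷ A.X ▷ S.X ⊗≫ N.X ◁ i.hom ▷ S.X ⊗≫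
            ((α_ _ _ _).inv ≫ N.act ▷ S.X ≫ N.act) := by
            rw [hg]; monoidal
        _ = 𝟙 _ ⊗≫ ((M.act ≫ g) ▷ (A.X ⊗ S.X) ≫ N.X ◁ (i.hom ▷ S.X ≫ μ[S.X])) ⊗≫ N.act := by
            rw [← N.act_assoc]; monoidal
        _ = _ := by rw [← whisker_exchange]; monoidal)

theorem proj_sandwich : M.X ◁ proj i ≫ sandwich i g hg =
    (α_ M.X S.X S.X).inv ≫ (M.act ≫ g) ▷ S.X ≫ N.act :=
  BalTensor.q_descL _ _ _ _ _

theorem actLeft_sandwich : M.X ◁ (sq i).actLeft ≫ sandwich i g hg =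
    (α_ _ _ _).inv ≫ M.act ▷ (sq i).X ≫ sandwich i g hg := by
  rw [← cancel_epi (M.X ◁ S.X ◁ proj i)]
  calc _ = M.X ◁ (S.X ◁ proj i ≫ (sq i).actLeft) ≫ sandwich i g hg := by simp
    _ = 𝟙 _ ⊗≫ M.X ◁ μ[S.X] ▷ S.X ≫ (M.X ◁ proj i ≫ sandwich i g hg) := by
        rw [proj_actLeft]; monoidal
    _ = 𝟙 _ ⊗≫ (M.X ◁ μ[S.X] ≫ M.act) ▷ S.X ⊗≫ g ▷ S.X ⊗≫ N.act := by
        rw [proj_sandwich i g hg]; monoidal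
    _ = 𝟙 _ ⊗≫ M.act ▷ S.X ▷ S.X ⊗≫
          ((α_ M.X S.X S.X).inv ≫ (M.act ≫ g) ▷ S.X ≫ N.act) := by
        rw [M.act_assoc]; monoidal
    _ = 𝟙 _ ⊗≫ (M.act ▷ (S.X ⊗ S.X) ≫ M.X ◁ proj i) ≫ sandwich i g hg := by
        rw [← proj_sandwich i g hg]; monoidal
    _ = _ := by rw [← whisker_exchange]; monoidal

theorem sandwich_act : sandwich i g hg ▷ S.X ≫ N.act =
    (α_ _ _ _).hom ≫ M.X ◁ (sq i).actRight ≫ sandwich i g hg := by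
  rw [← cancel_epi ((α_ _ _ _).hom ≫ M.X ◁ proj i ▷ S.X ≫ (α_ _ _ _).inv)]
  calc _ = 𝟙 _ ⊗≫ (M.X ◁ proj i ≫ sandwich i g hg) ▷ S.X ≫ N.act := by monoidal
    _ = 𝟙 _ ⊗≫ (M.act ≫ g) ▷ S.X ▷ S.X ⊗≫ ((α_ _ _ _).inv ≫ N.act ▷ S.X ≫ N.act) := by
        rw [proj_sandwich i g hg]; monoidal
    _ = 𝟙 _ ⊗≫ ((M.act ≫ g) ▷ (S.X ⊗ S.X) ≫ N.X ◁ μ[S.X]) ⊗≫ N.act := by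
        rw [← N.act_assoc]; monoidal
    _ = 𝟙 _ ⊗≫ M.X ◁ S.X ◁ μ[S.X] ⊗≫
          ((α_ M.X S.X S.X).inv ≫ (M.act ≫ g) ▷ S.X ≫ N.act) := by
        rw [← whisker_exchange]; monoidal
    _ = 𝟙 _ ⊗≫ M.X ◁ ((α_ _ _ _).hom ≫ S.X ◁ μ[S.X] ≫ proj i) ⊗≫ sandwich i g hg := by
        rw [← proj_sandwich i g hg]; monoidal
    _ = _ := by rw [← proj_actRight]; monoidal

/-- The right `S`-linear morphism obtained from a right `A`-linear one by averaging over the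
separability idempotent `η ≫ σ`. -/
noncomputable def average (σ : S.X ⟶ (sq i).X) : M.X ⟶ N.X :=
  (ρ_ M.X).inv ≫ M.X ◁ (η[S.X] ≫ σ) ≫ sandwich i g hg

variable {i}

theorem act_average {σ : S.X ⟶ (sq i).X} (h : IsBilinearSection i σ) :
    M.act ≫ average i g hg σ = M.X ◁ σ ≫ sandwich i g hg := by
  calc _ = 𝟙 _ ⊗≫ (M.act ▷ 𝟙_ C ≫ M.X ◁ (η[S.X] ≫ σ)) ≫ sandwich i g hg := by
        rw [average]; monoidal
    _ = 𝟙 _ ⊗≫ M.X ◁ S.X ◁ (η[S.X] ≫ σ) ⊗≫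
          ((α_ _ _ _).inv ≫ M.act ▷ (sq i).X ≫ sandwich i g hg) := by
        rw [← whisker_exchange]; monoidal
    _ = 𝟙 _ ⊗≫ M.X ◁ S.X ◁ η[S.X] ⊗≫ M.X ◁ (S.X ◁ σ ≫ (sq i).actLeft) ≫ sandwich i g hg := by
        rw [← actLeft_sandwich i g hg]; monoidal
    _ = 𝟙 _ ⊗≫ M.X ◁ (S.X ◁ η[S.X] ≫ μ[S.X]) ≫ M.X ◁ σ ≫ sandwich i g hg := by
        rw [← h.left]; monoidal
    _ = _ := by rw [MonObj.mul_one]; monoidal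

theorem average_act {σ : S.X ⟶ (sq i).X} (h : IsBilinearSection i σ) :
    average i g hg σ ▷ S.X ≫ N.act = M.X ◁ σ ≫ sandwich i g hg := by
  calc _ = 𝟙 _ ⊗≫ M.X ◁ (η[S.X] ≫ σ) ▷ S.X ⊗≫ (sandwich i g hg ▷ S.X ≫ N.act) := by
        rw [average]; monoidal
    _ = 𝟙 _ ⊗≫ M.X ◁ η[S.X] ▷ S.X ⊗≫ M.X ◁ (σ ▷ S.X ≫ (sq i).actRight) ≫ sandwich i g hg := by
        rw [sandwich_act i g hg]; monoidal
    _ = 𝟙 _ ⊗≫ M.X ◁ (η[S.X] ▷ S.X ≫ μ[S.X]) ≫ M.X ◁ σ ≫ sandwich i g hg := by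
        rw [← h.right]; monoidal
    _ = _ := by rw [MonObj.one_mul]; monoidal

end

variable {i}

/-- Restriction of scalars along a separable extension is a separable functor. -/
theorem isSeparableFunctor_of_section {σ : S.X ⟶ (sq i).X} (h : IsBilinearSection i σ) :
    IsSeparableFunctor (RightMod.restrictScalars i) := by
  have hg : ∀ {M N : RightMod S}
      (g : (RightMod.restrictScalars i).obj M ⟶ (RightMod.restrictScalars i).obj N),
      (M.X ◁ i.hom ≫ M.act) ≫ RightMod.Hom.f (S := A) g =
        RightMod.Hom.f (S := A) g ▷ A.X ≫ N.X ◁ i.hom ≫ N.act :=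
    fun g => RightMod.Hom.act_comm (S := A) g
  refine ⟨fun M N g => RightMod.Hom.mk (average i (RightMod.Hom.f (S := A) g) (hg g) σ)
    ((act_average _ _ h).trans (average_act _ _ h).symm), ?_, ?_⟩
  · intro M N f
    apply RightMod.Hom.ext
    have hf : M.act ≫ RightMod.Hom.f (S := S) f = RightMod.Hom.f (S := S) f ▷ S.X ≫ N.act :=
      RightMod.Hom.act_comm (S := S) f
    have key : ∀ (f' : M.X ⟶ N.X) (h' : M.act ≫ f' = f' ▷ S.X ≫ N.act) (hg'),
        average i f' hg' σ = f' := by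
      intro f' h' hg'
      have e : sandwich i f' hg' = M.X ◁ mulSq i ≫ M.act ≫ f' := by
        rw [← cancel_epi (M.X ◁ proj i), proj_sandwich]
        calc _ = 𝟙 _ ⊗≫ M.act ▷ S.X ⊗≫ (f' ▷ S.X ≫ N.act) := by monoidal
          _ = ((α_ _ _ _).inv ≫ M.act ▷ S.X ≫ M.act) ≫ f' := by rw [← h']; monoidal
          _ = M.X ◁ (proj i ≫ mulSq i) ≫ M.act ≫ f' := by
              rw [← M.act_assoc, proj_mulSq, Category.assoc]
          _ = _ := by rw [MonoidalCategory.whiskerLeft_comp, Category.assoc]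
      rw [average, e]
      calc _ = (ρ_ M.X).inv ≫ M.X ◁ (η[S.X] ≫ σ ≫ mulSq i) ≫ M.act ≫ f' := by
            simp only [MonoidalCategory.whiskerLeft_comp, Category.assoc]
        _ = (ρ_ M.X).inv ≫ (M.X ◁ η[S.X] ≫ M.act) ≫ f' := by
            rw [h.comp_mulSq, Category.comp_id, Category.assoc]
        _ = f' := by rw [M.act_one]; simp
    exact key _ hf _
  · intro M' M N N' f g k
    apply RightMod.Hom.ext
    have key : ∀ (f' : M'.X ⟶ M.X) (hf : M'.act ≫ f' = f' ▷ S.X ≫ M.act) (g' : M.X ⟶ N.X) (hg')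
        (k' : N.X ⟶ N'.X) (hk : N.act ≫ k' = k' ▷ S.X ≫ N'.act) (hg''),
        average i (f' ≫ g' ≫ k') hg'' σ = f' ≫ average i g' hg' σ ≫ k' := by
      intro f' hf g' hg' k' hk hg''
      have e : sandwich i (f' ≫ g' ≫ k') hg'' = f' ▷ (sq i).X ≫ sandwich i g' hg' ≫ k' := by
        rw [← cancel_epi (M'.X ◁ proj i), proj_sandwich, whisker_exchange_assoc]
        calc _ = 𝟙 _ ⊗≫ (M'.act ≫ f') ▷ S.X ⊗≫ g' ▷ S.X ⊗≫ (k' ▷ S.X ≫ N'.act) := by monoidal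
          _ = f' ▷ (S.X ⊗ S.X) ≫ ((α_ M.X S.X S.X).inv ≫ (M.act ≫ g') ▷ S.X ≫ N.act) ≫ k' := by
              rw [hf, ← hk]; monoidal
          _ = _ := by rw [← proj_sandwich i g' hg', Category.assoc]
      rw [average, e, average]
      calc _ = 𝟙 _ ⊗≫ (M'.X ◁ (η[S.X] ≫ σ) ≫ f' ▷ (sq i).X) ≫ sandwich i g' hg' ≫ k' := by
            monoidal
        _ = _ := by rw [whisker_exchange]; monoidal
    exact key _ (RightMod.Hom.act_comm (S := S) f) _ (hg g) _ (RightMod.Hom.act_comm (S := S) k) _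

/-- If restriction of scalars along `i` is a separable functor, then the left inverse of the
functor on hom sets turns the right `A`-linear morphism `s ↦ s ⊗ 1` into a right `S`-linear section
of `S ⊗_A S ⟶ S`. By naturality it commutes with left multiplication by each `𝟙_ C ⟶ S`, hence is
left `S`-linear if these detect morphisms. -/
theorem exists_section_of_isSeparableFunctor (hgen : IsLeftTensorGenerator (𝟙_ C))
    (hF : IsSeparableFunctor (RightMod.restrictScalars i)) : ∃ σ, IsBilinearSection i σ := by
  obtain ⟨P, hP, hnat⟩ := hF
  let R : RightMod S := ⟨S.X, μ[S.X], MonObj.mul_one S.X, MonObj.mul_assoc_flip S.X⟩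
  let Q : RightMod S := BalTensor.rightMod (sq i)
  let j : S.X ⟶ (sq i).X := (ρ_ S.X).inv ≫ S.X ◁ η[S.X] ≫ proj i
  have hj : (S.X ◁ i.hom ≫ μ[S.X]) ≫ j = j ▷ A.X ≫ (sq i).X ◁ i.hom ≫ (sq i).actRight := by
    have hb : (S.X ◁ i.hom ≫ μ[S.X]) ▷ S.X ≫ proj i =
        (α_ _ _ _).hom ≫ S.X ◁ (i.hom ▷ S.X ≫ μ[S.X]) ≫ proj i :=
      BalTensor.π_condition (leftBimod i) (rightBimod i)
    calc _ = 𝟙 _ ⊗≫ ((S.X ◁ i.hom ≫ μ[S.X]) ▷ 𝟙_ C ≫ S.X ◁ η[S.X]) ≫ proj i := by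
          dsimp only [j]; monoidal
      _ = 𝟙 _ ⊗≫ (S.X ⊗ A.X) ◁ η[S.X] ⊗≫ (S.X ◁ i.hom ≫ μ[S.X]) ▷ S.X ≫ proj i := by
          rw [← whisker_exchange]; monoidal
      _ = 𝟙 _ ⊗≫ S.X ◁ (A.X ◁ η[S.X] ≫ i.hom ▷ S.X) ⊗≫ S.X ◁ μ[S.X] ≫ proj i := by
          rw [hb]; monoidal
      _ = 𝟙 _ ⊗≫ S.X ◁ i.hom ⊗≫ S.X ◁ (S.X ◁ η[S.X] ≫ μ[S.X]) ≫ proj i := by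
          rw [whisker_exchange]; monoidal
      _ = 𝟙 _ ⊗≫ S.X ◁ i.hom ⊗≫ S.X ◁ (η[S.X] ▷ S.X ≫ μ[S.X]) ≫ proj i := by
          rw [MonObj.mul_one, MonObj.one_mul]; monoidal
      _ = 𝟙 _ ⊗≫ S.X ◁ (𝟙_ C ◁ i.hom ≫ η[S.X] ▷ S.X) ⊗≫
            ((α_ S.X S.X S.X).hom ≫ S.X ◁ μ[S.X] ≫ proj i) := by monoidal
      _ = 𝟙 _ ⊗≫ S.X ◁ η[S.X] ▷ A.X ⊗≫ ((S.X ⊗ S.X) ◁ i.hom ≫ proj i ▷ S.X) ≫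
            (sq i).actRight := by
          rw [whisker_exchange, ← proj_actRight]; monoidal
      _ = _ := by rw [whisker_exchange]; dsimp only [j]; monoidal
  have hjmul : j ≫ mulSq i = 𝟙 S.X := by
    calc _ = (ρ_ S.X).inv ≫ S.X ◁ η[S.X] ≫ (proj i ≫ mulSq i) := by
          dsimp only [j]; simp only [Category.assoc]
      _ = _ := by rw [proj_mulSq, MonObj.mul_one, Iso.inv_hom_id]
  let jF : (RightMod.restrictScalars i).obj R ⟶ (RightMod.restrictScalars i).obj Q :=
    RightMod.Hom.mk j hj
  let mQ : Q ⟶ R := RightMod.Hom.mk (mulSq i) (mulOver i).right_act_hom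
  let ν : R ⟶ Q := P R Q jF
  let σ : S.X ⟶ (sq i).X := RightMod.Hom.f (S := S) ν
  have hν : ν ≫ mQ = 𝟙 R := by
    have h := hnat R R Q R (𝟙 R) jF mQ
    rw [Category.id_comp] at h
    have e : (RightMod.restrictScalars i).map (𝟙 R) ≫ jF ≫ (RightMod.restrictScalars i).map mQ =
        (RightMod.restrictScalars i).map (𝟙 R) := by
      apply RightMod.Hom.ext
      change 𝟙 S.X ≫ j ≫ mulSq i = 𝟙 S.X
      rw [Category.id_comp, hjmul]
    exact h.symm.trans ((congrArg (P R R) e).trans (hP R R (𝟙 R)))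
  refine ⟨σ, congrArg (RightMod.Hom.f (S := S)) hν, ?_, RightMod.Hom.act_comm (S := S) ν⟩
  refine hgen _ _ _ _ _ fun x => ?_
  -- Left multiplication by `x : 𝟙_ C ⟶ S`, on `S` and on `S ⊗_A S`.
  let xR : R ⟶ R := RightMod.Hom.mk ((λ_ S.X).inv ≫ x ▷ S.X ≫ μ[S.X]) (by
    change μ[S.X] ≫ (λ_ S.X).inv ≫ x ▷ S.X ≫ μ[S.X] =
      ((λ_ S.X).inv ≫ x ▷ S.X ≫ μ[S.X]) ▷ S.X ≫ μ[S.X]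
    calc _ = 𝟙 _ ⊗≫ (𝟙_ C ◁ μ[S.X] ≫ x ▷ S.X) ≫ μ[S.X] := by monoidal
      _ = 𝟙 _ ⊗≫ x ▷ (S.X ⊗ S.X) ≫ (S.X ◁ μ[S.X] ≫ μ[S.X]) := by
          rw [whisker_exchange]; monoidal
      _ = _ := by rw [MonObj.mul_assoc_flip]; monoidal)
  let xQ : Q ⟶ Q := RightMod.Hom.mk ((λ_ (sq i).X).inv ≫ x ▷ (sq i).X ≫ (sq i).actLeft) (by
    change (sq i).actRight ≫ (λ_ (sq i).X).inv ≫ x ▷ (sq i).X ≫ (sq i).actLeft =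
      ((λ_ (sq i).X).inv ≫ x ▷ (sq i).X ≫ (sq i).actLeft) ▷ S.X ≫ (sq i).actRight
    calc _ = 𝟙 _ ⊗≫ (𝟙_ C ◁ (sq i).actRight ≫ x ▷ (sq i).X) ≫ (sq i).actLeft := by monoidal
      _ = 𝟙 _ ⊗≫ x ▷ (sq i).X ▷ S.X ⊗≫
            ((α_ _ _ _).hom ≫ S.X ◁ (sq i).actRight ≫ (sq i).actLeft) := by
          rw [whisker_exchange]; monoidal
      _ = _ := by rw [← (sq i).middle_assoc]; monoidal)
  have hx : xR ≫ ν = ν ≫ xQ := by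
    have h1 := hnat R R Q Q xR jF (𝟙 Q)
    have h2 := hnat R R Q Q (𝟙 R) jF xQ
    rw [Category.comp_id] at h1
    rw [Category.id_comp] at h2
    rw [← h1, ← h2]
    congr 1
    apply RightMod.Hom.ext
    change ((λ_ S.X).inv ≫ x ▷ S.X ≫ μ[S.X]) ≫ j ≫ 𝟙 _ =
      𝟙 _ ≫ j ≫ (λ_ (sq i).X).inv ≫ x ▷ (sq i).X ≫ (sq i).actLeft
    calc _ = 𝟙 _ ⊗≫ x ▷ S.X ⊗≫ (μ[S.X] ▷ 𝟙_ C ≫ S.X ◁ η[S.X]) ≫ proj i := by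
          dsimp only [j]; monoidal
      _ = 𝟙 _ ⊗≫ (x ▷ (S.X ⊗ 𝟙_ C) ≫ S.X ◁ S.X ◁ η[S.X]) ⊗≫
            ((α_ _ _ _).inv ≫ μ[S.X] ▷ S.X ≫ proj i) := by
          rw [← whisker_exchange]; monoidal
      _ = 𝟙 _ ⊗≫ S.X ◁ η[S.X] ⊗≫ (x ▷ (S.X ⊗ S.X) ≫ S.X ◁ proj i) ≫ (sq i).actLeft := by
          rw [← proj_actLeft, ← whisker_exchange]; monoidal
      _ = _ := by rw [← whisker_exchange]; dsimp only [j]; monoidal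
  have hx' : ((λ_ S.X).inv ≫ x ▷ S.X ≫ μ[S.X]) ≫ σ =
      σ ≫ (λ_ (sq i).X).inv ≫ x ▷ (sq i).X ≫ (sq i).actLeft :=
    congrArg (RightMod.Hom.f (S := S)) hx
  calc _ = (λ_ S.X).hom ≫ ((λ_ S.X).inv ≫ x ▷ S.X ≫ μ[S.X]) ≫ σ := by simp
    _ = 𝟙_ C ◁ σ ≫ x ▷ (sq i).X ≫ (sq i).actLeft := by rw [hx']; simp
    _ = _ := by rw [whisker_exchange_assoc]

end

end AlgExtension

/-! ### The functor `_A^#𝒯 ⥤ C` as a full embedding into `A`-bimodules -/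

namespace LeftTransfer

section

variable {C : Type u} [Category.{v} C] [MonoidalCategory C] {A : C} [MonObj A]

/-- The left action of `A` on `Z ⊗ A`, which moves `A` past `Z` by `φ`. -/
def actL (Z : LeftTransfer A) : A ⊗ (Z.X ⊗ A) ⟶ Z.X ⊗ A :=
  (α_ A Z.X A).inv ≫ Z.φ ▷ A ≫ (α_ Z.X A A).hom ≫ Z.X ◁ μ[A]

/-- The right action of `A` on `Z ⊗ A`. -/
def actR (Z : LeftTransfer A) : (Z.X ⊗ A) ⊗ A ⟶ Z.X ⊗ A :=
  (α_ Z.X A A).hom ≫ Z.X ◁ μ[A]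

theorem f_eq_toBase {Z W : LeftTransfer A} (g : Z ⟶ W) :
    Hom.f g = (ρ_ Z.X).inv ≫ Z.X ◁ η[A] ≫ (toBase A).map g := by
  change _ = _ ≫ _ ≫ Hom.f g ▷ A ≫ (α_ W.X A A).hom ≫ W.X ◁ μ[A]
  rw [whisker_exchange_assoc]
  calc _ = Hom.f g ⊗≫ 𝟙 _ := by monoidal
    _ = Hom.f g ⊗≫ W.X ◁ (A ◁ η[A] ≫ μ[A]) := by rw [MonObj.mul_one]; monoidal
    _ = _ := by monoidal

theorem toBase_injective {Z W : LeftTransfer A} {g h : Z ⟶ W}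
    (e : (toBase A).map g = (toBase A).map h) : g = h := by
  ext
  rw [f_eq_toBase, f_eq_toBase, e]

/-- The functor `(Z, φ) ↦ Z ⊗ A` is full onto the `A`-bilinear morphisms. -/
theorem exists_toBase_eq {Z W : LeftTransfer A} (f : Z.X ⊗ A ⟶ W.X ⊗ A)
    (hl : Z.actL ≫ f = A ◁ f ≫ W.actL) (hr : Z.actR ≫ f = f ▷ A ≫ W.actR) :
    ∃ g : Z ⟶ W, (toBase A).map g = f := by
  have key : ((ρ_ Z.X).inv ≫ Z.X ◁ η[A] ≫ f) ▷ A ≫ W.actR = f := by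
    calc _ = 𝟙 _ ⊗≫ Z.X ◁ η[A] ▷ A ⊗≫ (f ▷ A ≫ W.actR) := by monoidal
      _ = 𝟙 _ ⊗≫ Z.X ◁ (η[A] ▷ A ≫ μ[A]) ≫ f := by rw [← hr, actR]; monoidal
      _ = _ := by rw [MonObj.one_mul]; monoidal
  refine ⟨Hom.mk ((ρ_ Z.X).inv ≫ Z.X ◁ η[A] ≫ f) ?_, key⟩
  change Z.φ ≫ ((ρ_ Z.X).inv ≫ Z.X ◁ η[A] ≫ f) ▷ A ≫ W.actR =
    A ◁ ((ρ_ Z.X).inv ≫ Z.X ◁ η[A] ≫ f) ≫ W.actL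
  rw [key]
  symm
  calc _ = 𝟙 _ ⊗≫ A ◁ Z.X ◁ η[A] ⊗≫ (A ◁ f ≫ W.actL) := by monoidal
    _ = 𝟙 _ ⊗≫ ((A ⊗ Z.X) ◁ η[A] ≫ Z.φ ▷ A) ⊗≫ Z.X ◁ μ[A] ≫ f := by rw [← hl, actL]; monoidal
    _ = 𝟙 _ ⊗≫ Z.φ ⊗≫ Z.X ◁ (A ◁ η[A] ≫ μ[A]) ≫ f := by rw [whisker_exchange]; monoidal
    _ = _ := by rw [MonObj.mul_one]; monoidal

/-- A section of the projection `toBaseμ : (X ⊗ A) ⊗ (Y ⊗ A) ⟶ (X ⊗ Y) ⊗ A`. -/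
def toBaseι (X Y : LeftTransfer A) : (X.X ⊗ Y.X) ⊗ A ⟶ (X.X ⊗ A) ⊗ (Y.X ⊗ A) :=
  (α_ X.X Y.X A).hom ≫ ((ρ_ X.X).inv ≫ X.X ◁ η[A]) ▷ (Y.X ⊗ A)

theorem toBaseι_toBaseμ (X Y : LeftTransfer A) : toBaseι X Y ≫ toBaseμ X Y = 𝟙 _ := by
  rw [toBaseι, toBaseμ_eq]
  calc _ = 𝟙 _ ⊗≫ X.X ◁ (η[A] ▷ Y.X ≫ Y.φ) ▷ A ⊗≫ (X.X ⊗ Y.X) ◁ μ[A] := by monoidal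
    _ = 𝟙 _ ⊗≫ (X.X ⊗ Y.X) ◁ (η[A] ▷ A ≫ μ[A]) := by rw [Y.one_φ]; monoidal
    _ = _ := by rw [MonObj.one_mul]; monoidal

instance (X Y : LeftTransfer A) : Epi (toBaseμ X Y) :=
  have := toBaseι_toBaseμ X Y
  (SplitEpi.mk _ this).epi

theorem toBaseμ_balanced (X Y : LeftTransfer A) : X.actR ▷ (Y.X ⊗ A) ≫ toBaseμ X Y =
    (α_ _ _ _).hom ≫ (X.X ⊗ A) ◁ Y.actL ≫ toBaseμ X Y := by
  simp only [actL, actR, toBaseμ_eq]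
  calc _ = 𝟙 _ ⊗≫ X.X ◁ (μ[A] ▷ Y.X ≫ Y.φ) ▷ A ⊗≫ (X.X ⊗ Y.X) ◁ μ[A] := by monoidal
    _ = 𝟙 _ ⊗≫ X.X ◁ A ◁ Y.φ ▷ A ⊗≫ X.X ◁ Y.φ ▷ A ▷ A ⊗≫
          (X.X ⊗ Y.X) ◁ (μ[A] ▷ A ≫ μ[A]) := by
        rw [Y.mul_φ]; monoidal
    _ = 𝟙 _ ⊗≫ X.X ◁ A ◁ Y.φ ▷ A ⊗≫ X.X ◁ (Y.φ ▷ (A ⊗ A) ≫ (Y.X ⊗ A) ◁ μ[A]) ⊗≫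
          (X.X ⊗ Y.X) ◁ μ[A] := by
        rw [MonObj.mul_assoc]; monoidal
    _ = _ := by rw [← whisker_exchange]; monoidal

/-- An `A`-balanced morphism out of `(X ⊗ A) ⊗ (Y ⊗ A)` factors through `(X ⊗ Y) ⊗ A`. -/
theorem toBaseμ_factor (X Y : LeftTransfer A) {W : C} (p : (X.X ⊗ A) ⊗ (Y.X ⊗ A) ⟶ W)
    (hp : X.actR ▷ (Y.X ⊗ A) ≫ p = (α_ _ _ _).hom ≫ (X.X ⊗ A) ◁ Y.actL ≫ p) :
    toBaseμ X Y ≫ toBaseι X Y ≫ p = p := by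
  symm
  calc _ = 𝟙 _ ⊗≫ X.X ◁ (η[A] ▷ A ≫ μ[A]) ▷ (Y.X ⊗ A) ⊗≫ p := by rw [MonObj.one_mul]; monoidal
    _ = 𝟙 _ ⊗≫ X.X ◁ η[A] ▷ A ▷ (Y.X ⊗ A) ⊗≫ (X.actR ▷ (Y.X ⊗ A) ≫ p) := by
        rw [actR]; monoidal
    _ = 𝟙 _ ⊗≫ X.X ◁ (η[A] ▷ (A ⊗ Y.X ⊗ A) ≫ A ◁ Y.actL) ⊗≫ p := by rw [hp]; monoidal
    _ = _ := by rw [← whisker_exchange, toBaseι, toBaseμ, actL]; monoidal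

theorem toBaseμ_unit_left (Z : LeftTransfer A) :
    (λ_ A).inv ▷ (Z.X ⊗ A) ≫ toBaseμ (𝟙_ (LeftTransfer A)) Z ≫ (toBase A).map (λ_ Z).hom =
      Z.actL := by
  rw [leftUnitor_hom_eq, toBase_of, toBaseμ_eq, actL]
  simp only [tensorUnit_X]
  monoidal

theorem toBaseμ_unit_right (Z : LeftTransfer A) :
    (Z.X ⊗ A) ◁ (λ_ A).inv ≫ toBaseμ Z (𝟙_ (LeftTransfer A)) ≫ (toBase A).map (ρ_ Z).hom =
      Z.actR := by
  rw [rightUnitor_hom_eq, toBase_of, toBaseμ_eq, actR]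
  simp only [tensorUnit_X, tensorUnit_φ]
  monoidal

variable (Y : LeftTransfer A) [MonObj Y]

/-- The action of `A` on a module over the wreath product, restricted along `A ⟶ Y ⊗ A`. -/
theorem smashIncl_left (Z : LeftTransfer A) (a : Y ⊗ Z ⟶ Z) (ha : η[Y] ▷ Z ≫ a = (λ_ Z).hom) :
    Y.smashIncl ▷ (Z.X ⊗ A) ≫ toBaseμ Y Z ≫ (toBase A).map a = Z.actL := by
  let e : 𝟙_ C ⊗ A ⟶ Y.X ⊗ A := (toBase A).map η[Y]
  let q : (𝟙_ C ⊗ A) ⊗ (Z.X ⊗ A) ⟶ (𝟙_ C ⊗ Z.X) ⊗ A := toBaseμ (𝟙_ (LeftTransfer A)) Z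
  let w : (𝟙_ C ⊗ Z.X) ⊗ A ⟶ (Y.X ⊗ Z.X) ⊗ A := (toBase A).map (η[Y] ▷ Z)
  let k : (Y.X ⊗ Z.X) ⊗ A ⟶ Z.X ⊗ A := (toBase A).map a
  have h1 : e ▷ (Z.X ⊗ A) ≫ toBaseμ Y Z = q ≫ w := toBaseμ_left (MonObj.one (X := Y)) Z
  have h2 : w ≫ k = (toBase A).map (λ_ Z).hom :=
    ((toBase A).map_comp _ _).symm.trans (congrArg (toBase A).map ha)
  have h : Y.smashIncl = (λ_ A).inv ≫ e := rfl
  change Y.smashIncl ▷ (Z.X ⊗ A) ≫ toBaseμ Y Z ≫ k = Z.actL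
  rw [h, MonoidalCategory.comp_whiskerRight, Category.assoc, reassoc_of% h1, h2]
  exact toBaseμ_unit_left Z

theorem smashIncl_right (Z : LeftTransfer A) (a : Z ⊗ Y ⟶ Z) (ha : Z ◁ η[Y] ≫ a = (ρ_ Z).hom) :
    (Z.X ⊗ A) ◁ Y.smashIncl ≫ toBaseμ Z Y ≫ (toBase A).map a = Z.actR := by
  let e : 𝟙_ C ⊗ A ⟶ Y.X ⊗ A := (toBase A).map η[Y]
  let q : (Z.X ⊗ A) ⊗ (𝟙_ C ⊗ A) ⟶ (Z.X ⊗ 𝟙_ C) ⊗ A := toBaseμ Z (𝟙_ (LeftTransfer A))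
  let w : (Z.X ⊗ 𝟙_ C) ⊗ A ⟶ (Z.X ⊗ Y.X) ⊗ A := (toBase A).map (Z ◁ η[Y])
  let k : (Z.X ⊗ Y.X) ⊗ A ⟶ Z.X ⊗ A := (toBase A).map a
  have h1 : (Z.X ⊗ A) ◁ e ≫ toBaseμ Z Y = q ≫ w := toBaseμ_right Z (MonObj.one (X := Y))
  have h2 : w ≫ k = (toBase A).map (ρ_ Z).hom :=
    ((toBase A).map_comp _ _).symm.trans (congrArg (toBase A).map ha)
  have h : Y.smashIncl = (λ_ A).inv ≫ e := rfl
  change (Z.X ⊗ A) ◁ Y.smashIncl ≫ toBaseμ Z Y ≫ k = Z.actR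
  rw [h, MonoidalCategory.whiskerLeft_comp, Category.assoc, reassoc_of% h1, h2]
  exact toBaseμ_unit_right Z

end

end LeftTransfer

/-! ### Algebras in `_A^#𝒯` and their wreath products -/

namespace LeftTransfer

section

variable {C : Type u} [Category.{v} C] [MonoidalCategory C] {A : C} [MonObj A]
variable (Y : LeftTransfer A) [MonObj Y]

/-- The left action of the wreath product `S = Y ⊗ A` on `(Y ⊗ Y) ⊗ A`, a model of `S ⊗_A S`. -/
def sqL : (Y.X ⊗ A) ⊗ ((Y.X ⊗ Y.X) ⊗ A) ⟶ (Y.X ⊗ Y.X) ⊗ A :=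
  toBaseμ Y (Y ⊗ Y) ≫ (toBase A).map ((α_ Y Y Y).inv ≫ μ[Y] ▷ Y)

/-- The right action of the wreath product `S = Y ⊗ A` on `(Y ⊗ Y) ⊗ A`, a model of `S ⊗_A S`. -/
def sqR : ((Y.X ⊗ Y.X) ⊗ A) ⊗ (Y.X ⊗ A) ⟶ (Y.X ⊗ Y.X) ⊗ A :=
  toBaseμ (Y ⊗ Y) Y ≫ (toBase A).map ((α_ Y Y Y).hom ≫ Y ◁ μ[Y])

theorem toBaseμ_sqL : (Y.X ⊗ A) ◁ toBaseμ Y Y ≫ Y.sqL =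
    (α_ _ _ _).inv ≫ Y.smashMul ▷ (Y.X ⊗ A) ≫ toBaseμ Y Y := by
  let k : (Y.X ⊗ Y.X) ⊗ A ⟶ Y.X ⊗ A := (toBase A).map μ[Y]
  let w : (Y.X ⊗ Y.X ⊗ Y.X) ⊗ A ⟶ (Y.X ⊗ Y.X) ⊗ A :=
    (toBase A).map ((α_ Y Y Y).inv ≫ μ[Y] ▷ Y)
  let l : ((Y.X ⊗ Y.X) ⊗ Y.X) ⊗ A ⟶ (Y.X ⊗ Y.X ⊗ Y.X) ⊗ A := (toBase A).map (α_ Y Y Y).hom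
  let q : ((Y.X ⊗ Y.X) ⊗ A) ⊗ (Y.X ⊗ A) ⟶ ((Y.X ⊗ Y.X) ⊗ Y.X) ⊗ A := toBaseμ (Y ⊗ Y) Y
  let q' : (Y.X ⊗ A) ⊗ ((Y.X ⊗ Y.X) ⊗ A) ⟶ (Y.X ⊗ Y.X ⊗ Y.X) ⊗ A := toBaseμ Y (Y ⊗ Y)
  let r : ((Y.X ⊗ Y.X) ⊗ Y.X) ⊗ A ⟶ (Y.X ⊗ Y.X) ⊗ A := (toBase A).map (μ[Y] ▷ Y)
  have h1 : toBaseμ Y Y ▷ (Y.X ⊗ A) ≫ q ≫ l = (α_ _ _ _).hom ≫ (Y.X ⊗ A) ◁ toBaseμ Y Y ≫ q' :=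
    toBaseμ_assoc Y Y Y
  have h2 : l ≫ w = r := ((toBase A).map_comp _ _).symm.trans (congrArg (toBase A).map (by simp))
  have h3 : k ▷ (Y.X ⊗ A) ≫ toBaseμ Y Y = q ≫ r := toBaseμ_left μ[Y] Y
  have h4 : Y.smashMul = toBaseμ Y Y ≫ k := Y.smashMul_eq
  change (Y.X ⊗ A) ◁ toBaseμ Y Y ≫ q' ≫ w = _
  rw [← cancel_epi (α_ _ _ _).hom, ← reassoc_of% h1, h2, ← h3, h4]
  simp

theorem toBaseμ_sqR : toBaseμ Y Y ▷ (Y.X ⊗ A) ≫ Y.sqR =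
    (α_ _ _ _).hom ≫ (Y.X ⊗ A) ◁ Y.smashMul ≫ toBaseμ Y Y := by
  let k : (Y.X ⊗ Y.X) ⊗ A ⟶ Y.X ⊗ A := (toBase A).map μ[Y]
  let w : ((Y.X ⊗ Y.X) ⊗ Y.X) ⊗ A ⟶ (Y.X ⊗ Y.X) ⊗ A :=
    (toBase A).map ((α_ Y Y Y).hom ≫ Y ◁ μ[Y])
  let l : ((Y.X ⊗ Y.X) ⊗ Y.X) ⊗ A ⟶ (Y.X ⊗ Y.X ⊗ Y.X) ⊗ A := (toBase A).map (α_ Y Y Y).hom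
  let q : ((Y.X ⊗ Y.X) ⊗ A) ⊗ (Y.X ⊗ A) ⟶ ((Y.X ⊗ Y.X) ⊗ Y.X) ⊗ A := toBaseμ (Y ⊗ Y) Y
  let q' : (Y.X ⊗ A) ⊗ ((Y.X ⊗ Y.X) ⊗ A) ⟶ (Y.X ⊗ Y.X ⊗ Y.X) ⊗ A := toBaseμ Y (Y ⊗ Y)
  let r : (Y.X ⊗ Y.X ⊗ Y.X) ⊗ A ⟶ (Y.X ⊗ Y.X) ⊗ A := (toBase A).map (Y ◁ μ[Y])
  have h1 : toBaseμ Y Y ▷ (Y.X ⊗ A) ≫ q ≫ l = (α_ _ _ _).hom ≫ (Y.X ⊗ A) ◁ toBaseμ Y Y ≫ q' :=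
    toBaseμ_assoc Y Y Y
  have h2 : w = l ≫ r := (toBase A).map_comp _ _
  have h3 : (Y.X ⊗ A) ◁ k ≫ toBaseμ Y Y = q' ≫ r := toBaseμ_right Y μ[Y]
  have h4 : Y.smashMul = toBaseμ Y Y ≫ k := Y.smashMul_eq
  change toBaseμ Y Y ▷ (Y.X ⊗ A) ≫ q ≫ w = _
  rw [h2, reassoc_of% h1, ← h3, h4]
  simp

theorem smashIncl_sqL : Y.smashIncl ▷ ((Y.X ⊗ Y.X) ⊗ A) ≫ Y.sqL = (Y ⊗ Y).actL :=
  Y.smashIncl_left (Y ⊗ Y) _ (by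
    rw [associator_inv_naturality_left_assoc, ← MonoidalCategory.comp_whiskerRight,
      MonObj.one_mul]
    simp)

theorem smashIncl_sqR : ((Y.X ⊗ Y.X) ⊗ A) ◁ Y.smashIncl ≫ Y.sqR = (Y ⊗ Y).actR :=
  Y.smashIncl_right (Y ⊗ Y) _ (by
    rw [associator_naturality_right_assoc, ← MonoidalCategory.whiskerLeft_comp, MonObj.mul_one]
    simp)

theorem smashIncl_smashMul : Y.smashIncl ▷ (Y.X ⊗ A) ≫ Y.smashMul = Y.actL := by
  rw [smashMul_eq]
  exact Y.smashIncl_left Y _ (MonObj.one_mul Y)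

theorem smashMul_smashIncl : (Y.X ⊗ A) ◁ Y.smashIncl ≫ Y.smashMul = Y.actR := by
  rw [smashMul_eq]
  exact Y.smashIncl_right Y _ (MonObj.mul_one Y)

/-- Left linearity over `Y` in `_A^#𝒯` amounts to left linearity over `Y ⊗ A` in `C`. -/
theorem left_linear_iff (g : Y ⟶ Y ⊗ Y) {f : Y.X ⊗ A ⟶ (Y.X ⊗ Y.X) ⊗ A}
    (hf : (toBase A).map g = f) : Y.smashMul ≫ f = (Y.X ⊗ A) ◁ f ≫ Y.sqL ↔
      μ[Y] ≫ g = Y ◁ g ≫ (α_ Y Y Y).inv ≫ μ[Y] ▷ Y := by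
  let k : (Y.X ⊗ Y.X) ⊗ A ⟶ Y.X ⊗ A := (toBase A).map μ[Y]
  let w : (Y.X ⊗ Y.X ⊗ Y.X) ⊗ A ⟶ (Y.X ⊗ Y.X) ⊗ A :=
    (toBase A).map ((α_ Y Y Y).inv ≫ μ[Y] ▷ Y)
  let r : (Y.X ⊗ Y.X) ⊗ A ⟶ (Y.X ⊗ Y.X ⊗ Y.X) ⊗ A := (toBase A).map (Y ◁ g)
  let q' : (Y.X ⊗ A) ⊗ ((Y.X ⊗ Y.X) ⊗ A) ⟶ (Y.X ⊗ Y.X ⊗ Y.X) ⊗ A := toBaseμ Y (Y ⊗ Y)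
  have h1 : (Y.X ⊗ A) ◁ f ≫ q' = toBaseμ Y Y ≫ r := hf ▸ toBaseμ_right Y g
  have h2 : k ≫ f = (toBase A).map (μ[Y] ≫ g) := hf ▸ ((toBase A).map_comp _ _).symm
  have h3 : r ≫ w = (toBase A).map (Y ◁ g ≫ (α_ Y Y Y).inv ≫ μ[Y] ▷ Y) :=
    ((toBase A).map_comp _ _).symm
  have h4 : Y.smashMul = toBaseμ Y Y ≫ k := Y.smashMul_eq
  have h5 : (Y.X ⊗ A) ◁ f ≫ Y.sqL = toBaseμ Y Y ≫ r ≫ w := by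
    change (Y.X ⊗ A) ◁ f ≫ q' ≫ w = _
    rw [reassoc_of% h1]
  rw [h5, h4, Category.assoc, cancel_epi, h2, h3]
  exact ⟨fun h => toBase_injective h, congrArg _⟩

/-- Right linearity over `Y` in `_A^#𝒯` amounts to right linearity over `Y ⊗ A` in `C`. -/
theorem right_linear_iff (g : Y ⟶ Y ⊗ Y) {f : Y.X ⊗ A ⟶ (Y.X ⊗ Y.X) ⊗ A}
    (hf : (toBase A).map g = f) : Y.smashMul ≫ f = f ▷ (Y.X ⊗ A) ≫ Y.sqR ↔
      μ[Y] ≫ g = g ▷ Y ≫ (α_ Y Y Y).hom ≫ Y ◁ μ[Y] := by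
  let k : (Y.X ⊗ Y.X) ⊗ A ⟶ Y.X ⊗ A := (toBase A).map μ[Y]
  let w : ((Y.X ⊗ Y.X) ⊗ Y.X) ⊗ A ⟶ (Y.X ⊗ Y.X) ⊗ A :=
    (toBase A).map ((α_ Y Y Y).hom ≫ Y ◁ μ[Y])
  let r : (Y.X ⊗ Y.X) ⊗ A ⟶ ((Y.X ⊗ Y.X) ⊗ Y.X) ⊗ A := (toBase A).map (g ▷ Y)
  let q : ((Y.X ⊗ Y.X) ⊗ A) ⊗ (Y.X ⊗ A) ⟶ ((Y.X ⊗ Y.X) ⊗ Y.X) ⊗ A := toBaseμ (Y ⊗ Y) Y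
  have h1 : f ▷ (Y.X ⊗ A) ≫ q = toBaseμ Y Y ≫ r := hf ▸ toBaseμ_left g Y
  have h2 : k ≫ f = (toBase A).map (μ[Y] ≫ g) := hf ▸ ((toBase A).map_comp _ _).symm
  have h3 : r ≫ w = (toBase A).map (g ▷ Y ≫ (α_ Y Y Y).hom ≫ Y ◁ μ[Y]) :=
    ((toBase A).map_comp _ _).symm
  have h4 : Y.smashMul = toBaseμ Y Y ≫ k := Y.smashMul_eq
  have h5 : f ▷ (Y.X ⊗ A) ≫ Y.sqR = toBaseμ Y Y ≫ r ≫ w := by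
    change f ▷ (Y.X ⊗ A) ≫ q ≫ w = _
    rw [reassoc_of% h1]
  rw [h5, h4, Category.assoc, cancel_epi, h2, h3]
  exact ⟨fun h => toBase_injective h, congrArg _⟩

/-- An algebra `Y` in `_A^#𝒯` is separable exactly if the multiplication of its wreath product
`S = Y ⊗ A` has a bilinear section `S ⟶ (Y ⊗ Y) ⊗ A`. -/
theorem isSeparableAlgebra_iff : IsSeparableAlgebra Y ↔
    ∃ f : Y.X ⊗ A ⟶ (Y.X ⊗ Y.X) ⊗ A, f ≫ (toBase A).map μ[Y] = 𝟙 (Y.X ⊗ A) ∧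
      Y.smashMul ≫ f = (Y.X ⊗ A) ◁ f ≫ Y.sqL ∧ Y.smashMul ≫ f = f ▷ (Y.X ⊗ A) ≫ Y.sqR := by
  constructor
  · rintro ⟨g, h1, h2, h3⟩
    refine ⟨(toBase A).map g, ?_, (Y.left_linear_iff g rfl).2 h2, (Y.right_linear_iff g rfl).2 h3⟩
    exact ((toBase A).map_comp _ _).symm.trans ((congrArg _ h1).trans ((toBase A).map_id Y))
  · rintro ⟨f, h1, h2, h3⟩
    obtain ⟨g, hg⟩ : ∃ g : Y ⟶ Y ⊗ Y, (toBase A).map g = f := by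
      apply exists_toBase_eq
      · rw [← smashIncl_smashMul, ← smashIncl_sqL, Category.assoc, h2, ← whisker_exchange_assoc]
      · rw [← smashMul_smashIncl, ← smashIncl_sqR, Category.assoc, h3, whisker_exchange_assoc]
    refine ⟨g, toBase_injective ?_, (Y.left_linear_iff g hg).1 h2, (Y.right_linear_iff g hg).1 h3⟩
    rw [Functor.map_comp, hg]
    exact h1.trans ((toBase A).map_id Y).symm

/-- The algebra `Y` in `_A^#𝒯` is separable exactly if the multiplication of `S = Y ⊗ A` has a
bilinear section `S ⟶ Q`, where `p : S ⊗ S ⟶ Q` is any coequalizer of the `A`-balancing relation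
to which the multiplication and the two actions of `S` descend: `θ` identifies `Q` with
`(Y ⊗ Y) ⊗ A`. -/
theorem isSeparableAlgebra_iff_of_factor {Q : C} (p : (Y.X ⊗ A) ⊗ (Y.X ⊗ A) ⟶ Q) [TensorEpi p]
    (hp : Y.actR ▷ (Y.X ⊗ A) ≫ p = (α_ _ _ _).hom ≫ (Y.X ⊗ A) ◁ Y.actL ≫ p)
    (θ : Q ⟶ (Y.X ⊗ Y.X) ⊗ A) (hθ : p ≫ θ = toBaseμ Y Y)
    (m : Q ⟶ Y.X ⊗ A) (hm : p ≫ m = Y.smashMul) (L : (Y.X ⊗ A) ⊗ Q ⟶ Q)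
    (hL : (Y.X ⊗ A) ◁ p ≫ L = (α_ _ _ _).inv ≫ Y.smashMul ▷ (Y.X ⊗ A) ≫ p)
    (R : Q ⊗ (Y.X ⊗ A) ⟶ Q)
    (hR : p ▷ (Y.X ⊗ A) ≫ R = (α_ _ _ _).hom ≫ (Y.X ⊗ A) ◁ Y.smashMul ≫ p) :
    IsSeparableAlgebra Y ↔ ∃ σ : Y.X ⊗ A ⟶ Q, σ ≫ m = 𝟙 (Y.X ⊗ A) ∧
      Y.smashMul ≫ σ = (Y.X ⊗ A) ◁ σ ≫ L ∧ Y.smashMul ≫ σ = σ ▷ (Y.X ⊗ A) ≫ R := by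
  have : Epi p := TensorEpi.epi_self p
  let k : (Y.X ⊗ Y.X) ⊗ A ⟶ Y.X ⊗ A := (toBase A).map μ[Y]
  let ζ : (Y.X ⊗ Y.X) ⊗ A ⟶ Q := toBaseι Y Y ≫ p
  have e1 : ζ ≫ θ = 𝟙 _ := by
    rw [Category.assoc, hθ, toBaseι_toBaseμ]
  have e2 : θ ≫ ζ = 𝟙 _ := by
    rw [← cancel_epi p, reassoc_of% hθ, toBaseμ_factor Y Y p hp, Category.comp_id]
  have e3 : m = θ ≫ k := by
    rw [← cancel_epi p, hm, reassoc_of% hθ]; exact Y.smashMul_eq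
  have e4 : L ≫ θ = (Y.X ⊗ A) ◁ θ ≫ Y.sqL := by
    rw [← cancel_epi ((Y.X ⊗ A) ◁ p), reassoc_of% hL, hθ,
      ← MonoidalCategory.whiskerLeft_comp_assoc, hθ, toBaseμ_sqL]
  have e5 : R ≫ θ = θ ▷ (Y.X ⊗ A) ≫ Y.sqR := by
    rw [← cancel_epi (p ▷ (Y.X ⊗ A)), reassoc_of% hR, hθ,
      ← MonoidalCategory.comp_whiskerRight_assoc, hθ, toBaseμ_sqR]
  have : IsIso θ := ⟨ζ, e2, e1⟩
  rw [isSeparableAlgebra_iff]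
  constructor
  · rintro ⟨f, h1, h2, h3⟩
    have hf : f = (f ≫ ζ) ≫ θ := by rw [Category.assoc, e1, Category.comp_id]
    refine ⟨f ≫ ζ, ?_, ?_, ?_⟩
    · rw [e3, ← Category.assoc, ← hf]; exact h1
    · rw [← cancel_mono θ, Category.assoc, ← hf, h2, Category.assoc, e4,
        ← MonoidalCategory.whiskerLeft_comp_assoc, ← hf]
    · rw [← cancel_mono θ, Category.assoc, ← hf, h3, Category.assoc, e5,
        ← MonoidalCategory.comp_whiskerRight_assoc, ← hf]
  · rintro ⟨σ, h1, h2, h3⟩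
    refine ⟨σ ≫ θ, ?_, ?_, ?_⟩
    · rw [e3] at h1; exact (Category.assoc _ _ _).trans h1
    · rw [reassoc_of% h2, e4, MonoidalCategory.whiskerLeft_comp, Category.assoc]
    · rw [reassoc_of% h3, e5, MonoidalCategory.comp_whiskerRight, Category.assoc]

/-- An algebra in `_A^#𝒯` is separable exactly if its wreath product is a separable extension. -/
theorem isSeparableAlgebra_iff_section [HasCoequalizers C] [LeftCoflat C]
    [LeftModulesRobust (Mon.mk A)] :
    IsSeparableAlgebra Y ↔ ∃ σ, AlgExtension.IsBilinearSection Y.smashHom σ := by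
  have hl : ((Y.X ⊗ A) ◁ Y.smashIncl ≫ Y.smashMul) = Y.actR := Y.smashMul_smashIncl
  have hr : (Y.smashIncl ▷ (Y.X ⊗ A) ≫ Y.smashMul) = Y.actL := Y.smashIncl_smashMul
  let p : (Y.X ⊗ A) ⊗ (Y.X ⊗ A) ⟶ (AlgExtension.sq Y.smashHom).X := AlgExtension.proj Y.smashHom
  have : TensorEpi p := inferInstanceAs (TensorEpi (AlgExtension.proj Y.smashHom))
  have hp : ((Y.X ⊗ A) ◁ Y.smashIncl ≫ Y.smashMul) ▷ (Y.X ⊗ A) ≫ p = (α_ _ _ _).hom ≫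
      (Y.X ⊗ A) ◁ (Y.smashIncl ▷ (Y.X ⊗ A) ≫ Y.smashMul) ≫ p :=
    BalTensor.π_condition (AlgExtension.leftBimod Y.smashHom) (AlgExtension.rightBimod Y.smashHom)
  rw [hl, hr] at hp
  have hq : ((Y.X ⊗ A) ◁ Y.smashIncl ≫ Y.smashMul) ▷ (Y.X ⊗ A) ≫ toBaseμ Y Y = (α_ _ _ _).hom ≫
      (Y.X ⊗ A) ◁ (Y.smashIncl ▷ (Y.X ⊗ A) ≫ Y.smashMul) ≫ toBaseμ Y Y := by
    rw [hl, hr]; exact toBaseμ_balanced Y Y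
  refine (Y.isSeparableAlgebra_iff_of_factor p hp
    (BalTensor.descT (AlgExtension.leftBimod Y.smashHom) (AlgExtension.rightBimod Y.smashHom)
      (toBaseμ Y Y) hq)
    (BalTensor.π_descT (AlgExtension.leftBimod Y.smashHom) (AlgExtension.rightBimod Y.smashHom) _ _)
    (AlgExtension.mulSq Y.smashHom) (AlgExtension.proj_mulSq Y.smashHom)
    (AlgExtension.sq Y.smashHom).actLeft (AlgExtension.proj_actLeft Y.smashHom)
    (AlgExtension.sq Y.smashHom).actRight (AlgExtension.proj_actRight Y.smashHom)).trans ?_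
  exact ⟨fun ⟨σ, h1, h2, h3⟩ => ⟨σ, h1, h2, h3⟩, fun ⟨σ, h1, h2, h3⟩ => ⟨σ, h1, h2, h3⟩⟩

end

end LeftTransfer

/-! ### Casimir elements and coseparability forms -/

section

open scoped ComonObj

variable {D : Type u} [Category.{v} D] [MonoidalCategory D]

/-- Separability of an algebra `S` in terms of a Casimir element `t : 𝟙_ D ⟶ S ⊗ S`: the bilinear
section `σ` and the element `t` determine each other by `t = η ≫ σ`. -/
theorem isSeparableAlgebra_iff_casimir (S : D) [MonObj S] : IsSeparableAlgebra S ↔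
    ∃ t : 𝟙_ D ⟶ S ⊗ S, t ≫ μ[S] = η[S] ∧
      (ρ_ S).inv ≫ S ◁ t ≫ (α_ S S S).inv ≫ μ[S] ▷ S =
        (λ_ S).inv ≫ t ▷ S ≫ (α_ S S S).hom ≫ S ◁ μ[S] := by
  constructor
  · rintro ⟨σ, h1, h2, h3⟩
    refine ⟨η[S] ≫ σ, by rw [Category.assoc, h1, Category.comp_id], ?_⟩
    rw [MonoidalCategory.whiskerLeft_comp, MonoidalCategory.comp_whiskerRight, Category.assoc,
      Category.assoc, ← h2, ← h3]
    simp
  · rintro ⟨t, h1, h2⟩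
    refine ⟨(ρ_ S).inv ≫ S ◁ t ≫ (α_ S S S).inv ≫ μ[S] ▷ S, ?_, ?_, ?_⟩
    · calc _ = 𝟙 _ ⊗≫ S ◁ t ⊗≫ (μ[S] ▷ S ≫ μ[S]) := by monoidal
        _ = 𝟙 _ ⊗≫ S ◁ (t ≫ μ[S]) ≫ μ[S] := by rw [MonObj.mul_assoc]; monoidal
        _ = 𝟙 _ ⊗≫ (S ◁ η[S] ≫ μ[S]) := by rw [h1]
        _ = _ := by rw [MonObj.mul_one]; monoidal
    · calc _ = 𝟙 _ ⊗≫ (μ[S] ▷ 𝟙_ D ≫ S ◁ t) ⊗≫ μ[S] ▷ S := by monoidal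
        _ = 𝟙 _ ⊗≫ (S ⊗ S) ◁ t ⊗≫ (μ[S] ▷ S ≫ μ[S]) ▷ S := by
            rw [← whisker_exchange]; monoidal
        _ = _ := by rw [MonObj.mul_assoc]; monoidal
    · rw [h2]
      calc _ = 𝟙 _ ⊗≫ (𝟙_ D ◁ μ[S] ≫ t ▷ S) ⊗≫ S ◁ μ[S] := by monoidal
        _ = 𝟙 _ ⊗≫ t ▷ (S ⊗ S) ⊗≫ S ◁ (S ◁ μ[S] ≫ μ[S]) := by
            rw [whisker_exchange]; monoidal
        _ = _ := by rw [MonObj.mul_assoc_flip]; monoidal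

/-- The cofree bicomodule `K ⊗ K`. -/
@[simps]
def Bicomodule.cofree (K : D) [ComonObj K] : Bicomodule K where
  X := K ⊗ K
  coactLeft := Δ[K] ▷ K ≫ (α_ K K K).hom
  coactRight := K ◁ Δ[K] ≫ (α_ K K K).inv
  left_counit := by
    calc _ = (Δ[K] ≫ ε[K] ▷ K) ▷ K ⊗≫ 𝟙 _ := by monoidal
      _ = _ := by rw [ComonObj.counit_comul]; monoidal
  left_coassoc := by
    calc _ = (Δ[K] ≫ Δ[K] ▷ K) ▷ K ⊗≫ 𝟙 _ := by monoidal
      _ = _ := by rw [ComonObj.comul_assoc_flip]; monoidal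
  right_counit := by
    calc _ = K ◁ (Δ[K] ≫ K ◁ ε[K]) ⊗≫ 𝟙 _ := by monoidal
      _ = _ := by rw [ComonObj.comul_counit]; monoidal
  right_coassoc := by
    calc _ = K ◁ (Δ[K] ≫ K ◁ Δ[K]) ⊗≫ 𝟙 _ := by monoidal
      _ = _ := by rw [ComonObj.comul_assoc]; monoidal
  middle_coassoc := by
    calc _ = (Δ[K] ▷ K ≫ (K ⊗ K) ◁ Δ[K]) ⊗≫ 𝟙 _ := by monoidal
      _ = _ := by rw [← whisker_exchange]; monoidal

/-- A bicolinear retraction `r` of the comultiplication makes `K` relative injective: `f` extends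
along `j : M ⟶ N` to `N ⟶ K ⊗ N ⊗ K ⟶ K ⊗ K ⊗ K ⟶ K`, built from the coactions of `N`, the
morphism `p ≫ f`, and `r` twice. -/
theorem Bicomodule.exists_extension {K : D} [ComonObj K] {r : K ⊗ K ⟶ K} (h : Δ[K] ≫ r = 𝟙 K)
    (hl : r ≫ Δ[K] = Δ[K] ▷ K ≫ (α_ K K K).hom ≫ K ◁ r)
    (hr : r ≫ Δ[K] = K ◁ Δ[K] ≫ (α_ K K K).inv ≫ r ▷ K) {M N : Bicomodule K} {j : M.X ⟶ N.X}
    {p : N.X ⟶ M.X} (hj : IsBicolinear j) (hjp : j ≫ p = 𝟙 M.X) {f : M.X ⟶ K}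
    (hfl : f ≫ Δ[K] = M.coactLeft ≫ K ◁ f) (hfr : f ≫ Δ[K] = M.coactRight ≫ f ▷ K) :
    ∃ g : N.X ⟶ K, g ≫ Δ[K] = N.coactLeft ≫ K ◁ g ∧ g ≫ Δ[K] = N.coactRight ≫ g ▷ K ∧
      j ≫ g = f := by
  obtain ⟨k, hk⟩ : ∃ k : N.X ⟶ K, k = p ≫ f := ⟨_, rfl⟩
  have hjk : j ≫ k = f := by rw [hk, reassoc_of% hjp]
  obtain ⟨e, he⟩ : ∃ e : N.X ⟶ K, e = N.coactRight ≫ k ▷ K ≫ r := ⟨_, rfl⟩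
  have he' : e ≫ Δ[K] = N.coactRight ≫ e ▷ K := by
    calc _ = N.coactRight ≫ k ▷ K ≫ (r ≫ Δ[K]) := by simp [he]
      _ = N.coactRight ≫ (k ▷ K ≫ K ◁ Δ[K]) ≫ (α_ K K K).inv ≫ r ▷ K := by rw [hr]; simp
      _ = (N.coactRight ≫ N.X ◁ Δ[K]) ≫ k ▷ (K ⊗ K) ≫ (α_ K K K).inv ≫ r ▷ K := by
          rw [← whisker_exchange]; simp
      _ = _ := by rw [N.right_coassoc, he]; simp
  have hje : j ≫ e = f := by
    calc _ = (j ≫ N.coactRight) ≫ k ▷ K ≫ r := by simp [he]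
      _ = M.coactRight ≫ (j ≫ k) ▷ K ≫ r := by rw [hj.right]; simp
      _ = _ := by rw [hjk, ← reassoc_of% hfr, h, Category.comp_id]
  refine ⟨N.coactLeft ≫ K ◁ e ≫ r, ?_, ?_, ?_⟩
  · calc _ = N.coactLeft ≫ K ◁ e ≫ (r ≫ Δ[K]) := by simp
      _ = N.coactLeft ≫ (K ◁ e ≫ Δ[K] ▷ K) ≫ (α_ K K K).hom ≫ K ◁ r := by rw [hl]; simp
      _ = (N.coactLeft ≫ Δ[K] ▷ N.X) ≫ (K ⊗ K) ◁ e ≫ (α_ K K K).hom ≫ K ◁ r := by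
          rw [whisker_exchange]; simp
      _ = _ := by rw [N.left_coassoc]; simp
  · calc _ = N.coactLeft ≫ K ◁ e ≫ (r ≫ Δ[K]) := by simp
      _ = N.coactLeft ≫ K ◁ (e ≫ Δ[K]) ≫ (α_ K K K).inv ≫ r ▷ K := by rw [hr]; simp
      _ = (N.coactLeft ≫ K ◁ N.coactRight) ≫ K ◁ e ▷ K ≫ (α_ K K K).inv ≫ r ▷ K := by
          rw [he']; simp
      _ = _ := by rw [N.middle_coassoc]; simp
  · calc _ = (j ≫ N.coactLeft) ≫ K ◁ e ≫ r := by simp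
      _ = M.coactLeft ≫ K ◁ (j ≫ e) ≫ r := by rw [hj.left]; simp
      _ = f := by rw [hje, ← reassoc_of% hfl, h, Category.comp_id]

/-- Coseparability of a coalgebra `K` in terms of a form `κ : K ⊗ K ⟶ 𝟙_ D`, dual to the Casimir
element of a separable algebra. -/
theorem isCoseparableCoalgebra_iff_form (K : D) [ComonObj K] : IsCoseparableCoalgebra K ↔
    ∃ κ : K ⊗ K ⟶ 𝟙_ D, Δ[K] ≫ κ = ε[K] ∧
      Δ[K] ▷ K ≫ (α_ K K K).hom ≫ K ◁ κ ≫ (ρ_ K).hom =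
        K ◁ Δ[K] ≫ (α_ K K K).inv ≫ κ ▷ K ≫ (λ_ K).hom := by
  constructor
  · intro H
    obtain ⟨r, h, hl, hr⟩ : ∃ r : K ⊗ K ⟶ K, Δ[K] ≫ r = 𝟙 K ∧
        r ≫ Δ[K] = (Δ[K] ▷ K ≫ (α_ K K K).hom) ≫ K ◁ r ∧
        r ≫ Δ[K] = (K ◁ Δ[K] ≫ (α_ K K K).inv) ≫ r ▷ K := by
      have e1 : Δ[K] ≫ Δ[K] ▷ K ≫ (α_ K K K).hom = Δ[K] ≫ K ◁ Δ[K] :=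
        (ComonObj.comul_assoc K).symm
      have e2 : Δ[K] ≫ K ◁ Δ[K] ≫ (α_ K K K).inv = Δ[K] ≫ Δ[K] ▷ K :=
        (ComonObj.comul_assoc_flip K).symm
      have e3 : Δ[K] ≫ ε[K] ▷ K ≫ (λ_ K).hom = 𝟙 K := by
        rw [ComonObj.counit_comul_assoc, Iso.inv_hom_id]
      have e4 : 𝟙 K ≫ Δ[K] = Δ[K] ≫ K ◁ 𝟙 K := by simp
      have e5 : 𝟙 K ≫ Δ[K] = Δ[K] ≫ 𝟙 K ▷ K := by simp
      obtain ⟨r, hr, h⟩ := H (Bicomodule.regular K) (Bicomodule.cofree K) Δ[K]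
        (ε[K] ▷ K ≫ (λ_ K).hom) (𝟙 K) ⟨e1, e2⟩ e3 ⟨e4, e5⟩
      exact ⟨r, h, hr.left, hr.right⟩
    refine ⟨r ≫ ε[K], by rw [reassoc_of% h], ?_⟩
    trans r
    · calc _ = ((Δ[K] ▷ K ≫ (α_ K K K).hom) ≫ K ◁ r) ≫ K ◁ ε[K] ≫ (ρ_ K).hom := by simp
        _ = _ := by rw [← hl]; simp
    · symm
      calc _ = ((K ◁ Δ[K] ≫ (α_ K K K).inv) ≫ r ▷ K) ≫ ε[K] ▷ K ≫ (λ_ K).hom := by simp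
        _ = _ := by rw [← hr]; simp
  · rintro ⟨κ, h1, h2⟩
    suffices H : ∃ r : K ⊗ K ⟶ K, Δ[K] ≫ r = 𝟙 K ∧
        r ≫ Δ[K] = Δ[K] ▷ K ≫ (α_ K K K).hom ≫ K ◁ r ∧
        r ≫ Δ[K] = K ◁ Δ[K] ≫ (α_ K K K).inv ≫ r ▷ K by
      obtain ⟨r, h, hl, hr⟩ := H
      intro M N j p f hj hjp hf
      obtain ⟨g, hg1, hg2, hg3⟩ := Bicomodule.exists_extension h hl hr hj hjp hf.left hf.right
      exact ⟨g, ⟨hg1, hg2⟩, hg3⟩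
    refine ⟨Δ[K] ▷ K ≫ (α_ K K K).hom ≫ K ◁ κ ≫ (ρ_ K).hom, ?_, ?_, ?_⟩
    · rw [← ComonObj.comul_assoc_assoc, ← MonoidalCategory.whiskerLeft_comp_assoc, h1]
      simp
    · calc _ = Δ[K] ▷ K ⊗≫ (K ◁ κ ≫ Δ[K] ▷ 𝟙_ D) ⊗≫ 𝟙 _ := by monoidal
        _ = (Δ[K] ≫ Δ[K] ▷ K) ▷ K ⊗≫ (K ⊗ K) ◁ κ ⊗≫ 𝟙 _ := by rw [whisker_exchange]; monoidal
        _ = _ := by rw [ComonObj.comul_assoc_flip]; monoidal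
    · rw [h2]
      calc _ = K ◁ Δ[K] ⊗≫ (κ ▷ K ≫ 𝟙_ D ◁ Δ[K]) ⊗≫ 𝟙 _ := by monoidal
        _ = K ◁ (Δ[K] ≫ K ◁ Δ[K]) ⊗≫ κ ▷ (K ⊗ K) ⊗≫ 𝟙 _ := by rw [← whisker_exchange]; monoidal
        _ = _ := by rw [ComonObj.comul_assoc]; monoidal

end

/-! ### Transposition along `X ⊗ X ⊣ Y ⊗ Y` -/

namespace RightTransfer

section

variable {C : Type u} [Category.{v} C] [MonoidalCategory C] {A : C} [MonObj A]
variable (X : RightTransfer A) (Y : C) [ExactPairing Y X.X]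

/-- Transposition `C(Z, (Y ⊗ Y) ⊗ W) → C((X ⊗ X) ⊗ Z, W)` along the adjunction
`X ⊗ X ⊣ Y ⊗ Y`. -/
def tr2 {Z W : C} (f : Z ⟶ (Y ⊗ Y) ⊗ W) : (X.X ⊗ X.X) ⊗ Z ⟶ W :=
  (X.X ⊗ X.X) ◁ f ⊗≫ X.d2 Y ▷ W ⊗≫ 𝟙 W

theorem tr2_eq {Z W : C} (f : Z ⟶ (Y ⊗ Y) ⊗ W) :
    X.tr2 Y f = (α_ _ _ _).hom ≫ X.tr Y (X.tr Y (f ≫ (α_ _ _ _).hom)) := by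
  rw [tr2, d2]; monoidal

variable {Y} in
theorem tr2_inj {Z W : C} {f g : Z ⟶ (Y ⊗ Y) ⊗ W} (h : X.tr2 Y f = X.tr2 Y g) : f = g := by
  rw [tr2_eq, tr2_eq, cancel_epi] at h
  exact (cancel_mono _).1 (X.tr_inj (X.tr_inj h))

theorem tr2_surj {Z W : C} (g : (X.X ⊗ X.X) ⊗ Z ⟶ W) : ∃ f, X.tr2 Y f = g := by
  obtain ⟨a, ha⟩ := (tensorLeftHomEquiv _ Y X.X _).symm.surjective ((α_ _ _ _).inv ≫ g)
  obtain ⟨b, hb⟩ := (tensorLeftHomEquiv _ Y X.X _).symm.surjective a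
  have ha' : X.tr Y a = (α_ _ _ _).inv ≫ g := ha
  have hb' : X.tr Y b = a := hb
  refine ⟨b ≫ (α_ _ _ _).inv, ?_⟩
  rw [tr2_eq, Category.assoc, Iso.inv_hom_id, Category.comp_id, hb', ha', Iso.hom_inv_id_assoc]

variable {Y} in
/-- Evaluating the last factor `X` against `Y` is transposition along `- ⊗ Y ⊣ - ⊗ X`, hence
loses no information. -/
theorem counit_inj {Z W : C} {f g : Z ⟶ W ⊗ X.X}
    (h : f ▷ Y ⊗≫ W ◁ ε_ Y X.X ⊗≫ 𝟙 W = g ▷ Y ⊗≫ W ◁ ε_ Y X.X ⊗≫ 𝟙 W) : f = g := by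
  apply (tensorRightHomEquiv Z Y X.X W).symm.injective
  refine Eq.trans ?_ (h.trans ?_)
  · change f ▷ Y ≫ (α_ _ _ _).hom ≫ W ◁ ε_ Y X.X ≫ (ρ_ W).hom = _
    monoidal
  · change _ = g ▷ Y ≫ (α_ _ _ _).hom ≫ W ◁ ε_ Y X.X ≫ (ρ_ W).hom
    monoidal

section

variable {Y} {t : 𝟙_ C ⟶ (Y ⊗ Y) ⊗ A} {g : X.X ⊗ X.X ⟶ A} (h : X.tr2 Y t = (ρ_ _).hom ≫ g)
include h

/-- An element `t` of `(Y ⊗ Y) ⊗ A` is a morphism of `_A^#𝒯` exactly if its transpose `g` is a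
morphism of `𝒯_A^#`. -/
theorem mate_comm_iff :
    (ρ_ A).hom ≫ (λ_ A).inv ≫ t ▷ A ≫ (α_ _ _ _).hom ≫ (Y ⊗ Y) ◁ μ[A] =
        A ◁ t ≫ (α_ _ _ _).inv ≫ X.dualφ2 Y ▷ A ≫ (α_ _ _ _).hom ≫ (Y ⊗ Y) ◁ μ[A] ↔
      (X ⊗ X).ψ ≫ A ◁ g ≫ μ[A] = g ▷ A ≫ μ[A] := by
  have h1 : X.tr2 Y ((ρ_ A).hom ≫ (λ_ A).inv ≫ t ▷ A ≫ (α_ _ _ _).hom ≫ (Y ⊗ Y) ◁ μ[A]) =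
      (X.X ⊗ X.X) ◁ (ρ_ A).hom ≫ g ▷ A ≫ μ[A] := by
    calc _ = 𝟙 _ ⊗≫ (X.X ⊗ X.X) ◁ t ▷ A ⊗≫ (((X.X ⊗ X.X) ⊗ Y ⊗ Y) ◁ μ[A] ≫ X.d2 Y ▷ A) ⊗≫ 𝟙 A := by
          rw [tr2]; monoidal
      _ = 𝟙 _ ⊗≫ X.tr2 Y t ▷ A ≫ μ[A] := by rw [whisker_exchange, tr2]; monoidal
      _ = _ := by rw [h]; monoidal
  have h2 : X.tr2 Y (A ◁ t ≫ (α_ _ _ _).inv ≫ X.dualφ2 Y ▷ A ≫ (α_ _ _ _).hom ≫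
      (Y ⊗ Y) ◁ μ[A]) = (X.X ⊗ X.X) ◁ (ρ_ A).hom ≫ (X ⊗ X).ψ ≫ A ◁ g ≫ μ[A] := by
    calc _ = 𝟙 _ ⊗≫ (X.X ⊗ X.X) ◁ A ◁ t ⊗≫ (X.X ⊗ X.X) ◁ X.dualφ2 Y ▷ A ⊗≫
            (((X.X ⊗ X.X) ⊗ Y ⊗ Y) ◁ μ[A] ≫ X.d2 Y ▷ A) ⊗≫ 𝟙 A := by
          rw [tr2]; monoidal
      _ = 𝟙 _ ⊗≫ (X.X ⊗ X.X) ◁ A ◁ t ⊗≫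
            ((X.X ⊗ X.X) ◁ X.dualφ2 Y ⊗≫ X.d2 Y ▷ A ⊗≫ 𝟙 A) ▷ A ⊗≫ μ[A] := by
          rw [whisker_exchange]; monoidal
      _ = 𝟙 _ ⊗≫ ((X.X ⊗ X.X ⊗ A) ◁ t ≫
            (X.X ◁ X.ψ ⊗≫ X.ψ ▷ X.X ⊗≫ 𝟙 (A ⊗ X.X ⊗ X.X)) ▷ ((Y ⊗ Y) ⊗ A)) ⊗≫
            A ◁ X.d2 Y ▷ A ⊗≫ μ[A] := by
          rw [d2_φ]; monoidal
      _ = 𝟙 _ ⊗≫ X.X ◁ X.ψ ⊗≫ X.ψ ▷ X.X ⊗≫ A ◁ X.tr2 Y t ⊗≫ μ[A] := by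
          rw [whisker_exchange, tr2]; monoidal
      _ = _ := by rw [h, tensorObj_ψ]; monoidal
  rw [← cancel_epi ((X.X ⊗ X.X) ◁ (ρ_ A).hom), ← h2, ← h1]
  exact ⟨fun e => (congrArg (X.tr2 Y) e).symm, fun e => (X.tr2_inj e).symm⟩

variable [ComonObj X]

/-- The normalisation `m_Y ∘ t = η_Y` of a Casimir element is the transpose of `g ∘ δ = ε`. -/
theorem mate_unit_iff :
    t ≫ X.dualMul Y ▷ A ≫ (α_ Y A A).hom ≫ Y ◁ μ[A] = X.dualOne Y ↔
      X.δ ≫ A ◁ g ≫ μ[A] = X.e := by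
  have h1 : X.tr Y (t ≫ X.dualMul Y ▷ A ≫ (α_ Y A A).hom ≫ Y ◁ μ[A]) =
      (ρ_ _).hom ≫ X.δ ≫ A ◁ g ≫ μ[A] := by
    rw [tr_comp_dualMul]
    calc _ = X.δ ▷ 𝟙_ C ⊗≫ A ◁ X.tr2 Y t ⊗≫ μ[A] := by rw [tr2]
      _ = _ := by rw [h]; monoidal
  rw [← cancel_epi (ρ_ X.X).hom, ← h1, ← tr_dualOne X Y]
  exact ⟨congrArg (X.tr Y), fun e => X.tr_inj e⟩

/-- The transpose of `(m_Y ⊗ Y) ∘ (Y ⊗ t)`, one side of the Casimir condition on `t`, is one side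
of the colinearity condition on `g`, with its last factor `X` evaluated against `Y`. -/
theorem tr2_mul_left :
    X.tr2 Y ((ρ_ Y).inv ≫ ((Y ◁ t ≫ (α_ _ _ _).inv) ≫ (α_ Y Y Y).inv ▷ A) ≫
        (X.dualMul Y ▷ Y ≫ (α_ Y A Y).hom ≫ Y ◁ X.dualφ Y ≫ (α_ Y Y A).inv) ▷ A ≫
          (α_ (Y ⊗ Y) A A).hom ≫ (Y ⊗ Y) ◁ μ[A]) =
      (X.X ◁ X.δ ≫ (α_ _ _ _).inv ≫ X.ψ ▷ (X.X ⊗ X.X) ⊗≫ A ◁ g ▷ X.X ⊗≫ μ[A] ▷ X.X) ▷ Y ⊗≫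
        A ◁ ε_ Y X.X ⊗≫ 𝟙 A := by
  calc _ = 𝟙 _ ⊗≫ (X.X ⊗ X.X) ◁ Y ◁ t ⊗≫
          (X.X ⊗ X.X) ◁ (X.dualMul Y ▷ Y ⊗≫ Y ◁ X.dualφ Y) ▷ A ⊗≫
          (((X.X ⊗ X.X) ⊗ Y ⊗ Y) ◁ μ[A] ≫ X.d2 Y ▷ A) ⊗≫ 𝟙 A := by
        rw [tr2]; monoidal
    _ = 𝟙 _ ⊗≫ (X.X ⊗ X.X) ◁ Y ◁ t ⊗≫
          ((X.X ⊗ X.X) ◁ (X.dualMul Y ▷ Y ⊗≫ Y ◁ X.dualφ Y) ⊗≫ X.d2 Y ▷ A ⊗≫ 𝟙 A) ▷ A ⊗≫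
          μ[A] := by
        rw [whisker_exchange]; monoidal
    _ = 𝟙 _ ⊗≫ (((X.X ⊗ X.X) ⊗ Y) ◁ t ≫
          ((X.X ◁ X.δ ⊗≫ X.ψ ▷ (X.X ⊗ X.X)) ▷ Y ⊗≫ 𝟙 (A ⊗ X.X ⊗ X.X ⊗ X.X ⊗ Y)) ▷
            ((Y ⊗ Y) ⊗ A)) ⊗≫
          A ◁ X.X ◁ X.d2 Y ▷ Y ▷ A ⊗≫ A ◁ ε_ Y X.X ▷ A ⊗≫ μ[A] := by
        rw [d2_mul]; monoidal
    _ = 𝟙 _ ⊗≫ (X.X ◁ X.δ ⊗≫ X.ψ ▷ (X.X ⊗ X.X)) ▷ Y ⊗≫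
          A ◁ (X.X ⊗ X.X) ◁ ((X.X ⊗ Y) ◁ t ≫ ε_ Y X.X ▷ ((Y ⊗ Y) ⊗ A)) ⊗≫
          A ◁ X.X ◁ ε_ Y X.X ▷ Y ▷ A ⊗≫ A ◁ ε_ Y X.X ▷ A ⊗≫ μ[A] := by
        rw [whisker_exchange, d2]; monoidal
    _ = 𝟙 _ ⊗≫ (X.X ◁ X.δ ⊗≫ X.ψ ▷ (X.X ⊗ X.X)) ▷ Y ⊗≫
          A ◁ (X.X ⊗ X.X) ◁ ε_ Y X.X ⊗≫ A ◁ X.tr2 Y t ⊗≫ μ[A] := by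
        rw [whisker_exchange, tr2, d2]; monoidal
    _ = 𝟙 _ ⊗≫ (X.X ◁ X.δ ⊗≫ X.ψ ▷ (X.X ⊗ X.X)) ▷ Y ⊗≫
          A ◁ ((X.X ⊗ X.X) ◁ ε_ Y X.X ≫ g ▷ 𝟙_ C) ⊗≫ μ[A] := by
        rw [h]; monoidal
    _ = 𝟙 _ ⊗≫ (X.X ◁ X.δ ⊗≫ X.ψ ▷ (X.X ⊗ X.X)) ▷ Y ⊗≫
          A ◁ g ▷ X.X ▷ Y ⊗≫ ((A ⊗ A) ◁ ε_ Y X.X ≫ μ[A] ▷ 𝟙_ C) ⊗≫ 𝟙 _ := by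
        rw [whisker_exchange]; monoidal
    _ = _ := by rw [whisker_exchange]; monoidal

/-- The transpose of `(Y ⊗ m_Y) ∘ (t ⊗ Y)`, the other side of the Casimir condition on `t`, is the
other side of the colinearity condition on `g`, with its last factor `X` evaluated against `Y`. -/
theorem tr2_mul_right :
    X.tr2 Y ((λ_ Y).inv ≫ ((t ▷ Y ≫ (α_ _ _ _).hom ≫ (Y ⊗ Y) ◁ X.dualφ Y ≫ (α_ _ _ _).inv) ≫
        (α_ Y Y Y).hom ▷ A) ≫ (Y ◁ X.dualMul Y ≫ (α_ Y Y A).inv) ▷ A ≫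
          (α_ (Y ⊗ Y) A A).hom ≫ (Y ⊗ Y) ◁ μ[A]) =
      (X.δ ▷ X.X ⊗≫ A ◁ X.X ◁ g ⊗≫ A ◁ X.ψ ⊗≫ μ[A] ▷ X.X) ▷ Y ⊗≫ A ◁ ε_ Y X.X ⊗≫ 𝟙 A := by
  calc _ = 𝟙 _ ⊗≫ (X.X ⊗ X.X) ◁ (t ▷ Y ⊗≫ (Y ⊗ Y) ◁ X.dualφ Y) ⊗≫
          (X.X ⊗ X.X) ◁ Y ◁ X.dualMul Y ▷ A ⊗≫
          (((X.X ⊗ X.X) ⊗ Y ⊗ Y) ◁ μ[A] ≫ X.d2 Y ▷ A) ⊗≫ 𝟙 A := by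
        rw [tr2]; monoidal
    _ = 𝟙 _ ⊗≫ (X.X ⊗ X.X) ◁ (t ▷ Y ⊗≫ (Y ⊗ Y) ◁ X.dualφ Y) ⊗≫
          ((X.X ⊗ X.X) ◁ (Y ◁ X.dualMul Y) ⊗≫ X.d2 Y ▷ A ⊗≫ 𝟙 A) ▷ A ⊗≫ μ[A] := by
        rw [whisker_exchange]; monoidal
    _ = 𝟙 _ ⊗≫ ((X.X ⊗ X.X) ◁ (𝟙 Y ⊗≫ t ▷ Y ⊗≫ (Y ⊗ Y) ◁ X.dualφ Y ⊗≫ 𝟙 ((Y ⊗ Y ⊗ Y) ⊗ A)) ≫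
          X.δ ▷ X.X ▷ ((Y ⊗ Y ⊗ Y) ⊗ A)) ⊗≫
          A ◁ X.X ◁ X.d2 Y ▷ Y ▷ A ⊗≫ A ◁ ε_ Y X.X ▷ A ⊗≫ μ[A] := by
        rw [mul_d2]; monoidal
    _ = 𝟙 _ ⊗≫ X.δ ▷ X.X ▷ Y ⊗≫ A ◁ X.X ◁ (X.X ⊗ X.X) ◁ t ▷ Y ⊗≫
          A ◁ X.X ◁ (((X.X ⊗ X.X) ⊗ Y ⊗ Y) ◁ X.dualφ Y ≫ X.d2 Y ▷ (Y ⊗ A)) ⊗≫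
          A ◁ ε_ Y X.X ▷ A ⊗≫ μ[A] := by
        rw [whisker_exchange]; monoidal
    _ = 𝟙 _ ⊗≫ X.δ ▷ X.X ▷ Y ⊗≫ A ◁ X.X ◁ X.tr2 Y t ▷ Y ⊗≫ A ◁ X.tr Y (X.dualφ Y) ▷ 𝟙_ C ⊗≫
          μ[A] := by
        rw [whisker_exchange, tr2]; monoidal
    _ = 𝟙 _ ⊗≫ X.δ ▷ X.X ▷ Y ⊗≫ A ◁ X.X ◁ g ▷ Y ⊗≫ A ◁ X.ψ ▷ Y ⊗≫
          ((A ⊗ A) ◁ ε_ Y X.X ≫ μ[A] ▷ 𝟙_ C) ⊗≫ 𝟙 _ := by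
        rw [h, tr_dualφ]; monoidal
    _ = _ := by rw [whisker_exchange]; monoidal

end

end

end RightTransfer

/-! ### Coseparability of `X` and separability of its dual -/

namespace LeftTransfer

section

variable {C : Type u} [Category.{v} C] [MonoidalCategory C] {A : C} [MonObj A]

theorem comp_associator_hom_f {W X Y Z : LeftTransfer A} (f : W ⟶ (X ⊗ Y) ⊗ Z) :
    Hom.f (f ≫ (α_ X Y Z).hom) = f.f ≫ (α_ X.X Y.X Z.X).hom ▷ A :=
  comp_of_f f _ (by simp only [tensorObj_φ, tensorObj_X]; monoidal)

theorem comp_associator_inv_f {W X Y Z : LeftTransfer A} (f : W ⟶ X ⊗ Y ⊗ Z) :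
    Hom.f (f ≫ (α_ X Y Z).inv) = f.f ≫ (α_ X.X Y.X Z.X).inv ▷ A :=
  comp_of_f f _ (by simp only [tensorObj_φ, tensorObj_X]; monoidal)

theorem leftUnitor_inv_comp_f {X Y : LeftTransfer A} (f : 𝟙_ (LeftTransfer A) ⊗ X ⟶ Y) :
    Hom.f ((λ_ X).inv ≫ f) = (λ_ X.X).inv ≫ f.f :=
  of_comp_f _ (by simp only [tensorObj_φ, tensorUnit_φ, tensorObj_X, tensorUnit_X]; monoidal) f

theorem rightUnitor_inv_comp_f {X Y : LeftTransfer A} (f : X ⊗ 𝟙_ (LeftTransfer A) ⟶ Y) :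
    Hom.f ((ρ_ X).inv ≫ f) = (ρ_ X.X).inv ≫ f.f :=
  of_comp_f _ (by simp only [tensorObj_φ, tensorUnit_φ, tensorObj_X, tensorUnit_X]; monoidal) f

end

end LeftTransfer

namespace RightTransfer

section

open scoped ComonObj

variable {C : Type u} [Category.{v} C] [MonoidalCategory C] {A : C} [MonObj A]

theorem associator_inv_comp_f {W X Y Z : RightTransfer A} (f : (X ⊗ Y) ⊗ Z ⟶ W) :
    Hom.f ((α_ X Y Z).inv ≫ f) = (α_ X.X Y.X Z.X).inv ≫ f.f :=
  of_comp_f _ (by simp only [tensorObj_ψ, tensorObj_X]; monoidal) f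

section

variable {X : RightTransfer A} {g : X.X ⊗ X.X ⟶ A}

/-- The condition for `g ≫ (ρ_ A).inv` to be a morphism `X ⊗ X ⟶ 𝟙_` of `𝒯_A^#`. -/
theorem form_comm_iff :
    (X ⊗ X).ψ ≫ A ◁ (g ≫ (ρ_ A).inv) ≫ (α_ A A (𝟙_ C)).inv ≫ μ[A] ▷ 𝟙_ C =
        (g ≫ (ρ_ A).inv) ▷ A ≫ (α_ A (𝟙_ C) A).hom ≫ A ◁ ((λ_ A).hom ≫ (ρ_ A).inv) ≫
          (α_ A A (𝟙_ C)).inv ≫ μ[A] ▷ 𝟙_ C ↔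
      (X ⊗ X).ψ ≫ A ◁ g ≫ μ[A] = g ▷ A ≫ μ[A] := by
  rw [← cancel_mono (ρ_ A).inv (g := (X ⊗ X).ψ ≫ A ◁ g ≫ μ[A])]
  have h1 : (X ⊗ X).ψ ≫ A ◁ (g ≫ (ρ_ A).inv) ≫ (α_ A A (𝟙_ C)).inv ≫ μ[A] ▷ 𝟙_ C =
      ((X ⊗ X).ψ ≫ A ◁ g ≫ μ[A]) ≫ (ρ_ A).inv := by monoidal
  have h2 : (g ≫ (ρ_ A).inv) ▷ A ≫ (α_ A (𝟙_ C) A).hom ≫ A ◁ ((λ_ A).hom ≫ (ρ_ A).inv) ≫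
      (α_ A A (𝟙_ C)).inv ≫ μ[A] ▷ 𝟙_ C = (g ▷ A ≫ μ[A]) ≫ (ρ_ A).inv := by monoidal
  exact ⟨fun h => h1.symm.trans (h.trans h2), fun h => h1.trans (h.trans h2.symm)⟩

variable [ComonObj X] {κ : X ⊗ X ⟶ 𝟙_ (RightTransfer A)} (hκ : κ.f = g ≫ (ρ_ A).inv)
include hκ

theorem comul_comp_form_iff : Δ[X] ≫ κ = ε[X] ↔ X.δ ≫ A ◁ g ≫ μ[A] = X.e := by
  have h1 : Hom.f (Δ[X] ≫ κ) = (X.δ ≫ A ◁ g ≫ μ[A]) ≫ (ρ_ A).inv := by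
    calc _ = X.δ ≫ A ◁ (g ≫ (ρ_ A).inv) ≫ (α_ A A (𝟙_ C)).inv ≫ μ[A] ▷ 𝟙_ C := by
          rw [comp_f, hκ]; rfl
      _ = _ := by monoidal
  have h2 : Hom.f ε[X] = X.e ≫ (ρ_ A).inv := X.counit_f
  refine ⟨fun h => ?_, fun h => hom_ext (h1.trans ((congrArg (· ≫ (ρ_ A).inv) h).trans h2.symm))⟩
  exact (cancel_mono (ρ_ A).inv).1 (h1.symm.trans ((congrArg Hom.f h).trans h2))

/-- The morphism `(X ⊗ κ) ∘ (δ ⊗ X)` of `𝒯_A^#`, computed in `C`. -/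
theorem comul_whisker_form_f : Hom.f (Δ[X] ▷ X ≫ (α_ X X X).hom ≫ X ◁ κ ≫ (ρ_ X).hom) =
    X.δ ▷ X.X ⊗≫ A ◁ X.X ◁ g ⊗≫ A ◁ X.ψ ⊗≫ μ[A] ▷ X.X := by
  have h1 : Hom.f (X ◁ κ ≫ (ρ_ X).hom) = (X.X ◁ (g ≫ (ρ_ A).inv) ≫ (α_ X.X A (𝟙_ C)).inv ≫
      X.ψ ▷ 𝟙_ C ≫ (α_ A X.X (𝟙_ C)).hom) ≫ A ◁ (ρ_ X.X).hom := by
    rw [rightUnitor_hom_eq, comp_of_f, whiskerLeft_f, hκ]; rfl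
  have h2 : Hom.f ((α_ X X X).hom ≫ X ◁ κ ≫ (ρ_ X).hom) =
      (α_ X.X X.X X.X).hom ≫ Hom.f (X ◁ κ ≫ (ρ_ X).hom) := by
    rw [associator_hom_eq, of_comp_f]
  rw [comp_f, h2, h1, whiskerRight_f]
  change (X.δ ▷ X.X ≫ (α_ A (X.X ⊗ X.X) X.X).hom) ≫ A ◁ ((α_ X.X X.X X.X).hom ≫
    (X.X ◁ (g ≫ (ρ_ A).inv) ≫ (α_ X.X A (𝟙_ C)).inv ≫
      X.ψ ▷ 𝟙_ C ≫ (α_ A X.X (𝟙_ C)).hom) ≫ A ◁ (ρ_ X.X).hom) ≫ (α_ A A X.X).inv ≫ μ[A] ▷ X.X = _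
  monoidal

/-- The morphism `(κ ⊗ X) ∘ (X ⊗ δ)` of `𝒯_A^#`, computed in `C`. -/
theorem whisker_comul_form_f : Hom.f (X ◁ Δ[X] ≫ (α_ X X X).inv ≫ κ ▷ X ≫ (λ_ X).hom) =
    X.X ◁ X.δ ≫ (α_ _ _ _).inv ≫ X.ψ ▷ (X.X ⊗ X.X) ⊗≫ A ◁ g ▷ X.X ⊗≫ μ[A] ▷ X.X := by
  have h1 : Hom.f (κ ▷ X ≫ (λ_ X).hom) =
      ((g ≫ (ρ_ A).inv) ▷ X.X ≫ (α_ A (𝟙_ C) X.X).hom) ≫ A ◁ (λ_ X.X).hom := by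
    rw [leftUnitor_hom_eq, comp_of_f, whiskerRight_f, hκ]; rfl
  have h2 : Hom.f ((α_ X X X).inv ≫ κ ▷ X ≫ (λ_ X).hom) =
      (α_ X.X X.X X.X).inv ≫ Hom.f (κ ▷ X ≫ (λ_ X).hom) := associator_inv_comp_f _
  rw [comp_f, h2, h1, whiskerLeft_f]
  change (X.X ◁ X.δ ≫ (α_ X.X A (X.X ⊗ X.X)).inv ≫ X.ψ ▷ (X.X ⊗ X.X) ≫
    (α_ A X.X (X.X ⊗ X.X)).hom) ≫ A ◁ ((α_ X.X X.X X.X).inv ≫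
    ((g ≫ (ρ_ A).inv) ▷ X.X ≫ (α_ A (𝟙_ C) X.X).hom) ≫ A ◁ (λ_ X.X).hom) ≫
    (α_ A A X.X).inv ≫ μ[A] ▷ X.X = _
  monoidal

end

variable (X : RightTransfer A) (Y : C) [ExactPairing Y X.X] [ComonObj X]

section

variable (t : 𝟙_ (LeftTransfer A) ⟶ X.dual Y ⊗ X.dual Y)

/-- The morphism `(m_Y ⊗ Y) ∘ (Y ⊗ t)` of `_A^#𝒯`, computed in `C`. -/
theorem casimir_left_f {s : 𝟙_ C ⟶ (Y ⊗ Y) ⊗ A} (hs : t.f = s) :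
    LeftTransfer.Hom.f ((ρ_ (X.dual Y)).inv ≫ X.dual Y ◁ t ≫ (α_ _ _ _).inv ≫
      μ[X.dual Y] ▷ X.dual Y) =
    (ρ_ Y).inv ≫ ((Y ◁ s ≫ (α_ _ _ _).inv) ≫ (α_ Y Y Y).inv ▷ A) ≫
        (X.dualMul Y ▷ Y ≫ (α_ Y A Y).hom ≫ Y ◁ X.dualφ Y ≫ (α_ Y Y A).inv) ▷ A ≫
          (α_ (Y ⊗ Y) A A).hom ≫ (Y ⊗ Y) ◁ μ[A] := by
  subst hs
  have h1 : LeftTransfer.Hom.f (X.dual Y ◁ t ≫ (α_ (X.dual Y) (X.dual Y) (X.dual Y)).inv) =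
      (Y ◁ t.f ≫ (α_ Y (Y ⊗ Y) A).inv) ≫ (α_ Y Y Y).inv ▷ A := LeftTransfer.comp_associator_inv_f _
  have h2 : LeftTransfer.Hom.f ((ρ_ (X.dual Y)).inv ≫ X.dual Y ◁ t ≫ (α_ _ _ _).inv ≫
      μ[X.dual Y] ▷ X.dual Y) = (ρ_ Y).inv ≫ LeftTransfer.Hom.f (X.dual Y ◁ t ≫ (α_ _ _ _).inv ≫
      μ[X.dual Y] ▷ X.dual Y) := LeftTransfer.rightUnitor_inv_comp_f _
  rw [h2, ← Category.assoc (X.dual Y ◁ t), LeftTransfer.comp_f, h1]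
  rfl

/-- The morphism `(Y ⊗ m_Y) ∘ (t ⊗ Y)` of `_A^#𝒯`, computed in `C`. -/
theorem casimir_right_f {s : 𝟙_ C ⟶ (Y ⊗ Y) ⊗ A} (hs : t.f = s) :
    LeftTransfer.Hom.f ((λ_ (X.dual Y)).inv ≫ t ▷ X.dual Y ≫ (α_ _ _ _).hom ≫
      X.dual Y ◁ μ[X.dual Y]) =
    (λ_ Y).inv ≫ ((s ▷ Y ≫ (α_ _ _ _).hom ≫ (Y ⊗ Y) ◁ X.dualφ Y ≫ (α_ _ _ _).inv) ≫
        (α_ Y Y Y).hom ▷ A) ≫ (Y ◁ X.dualMul Y ≫ (α_ Y Y A).inv) ▷ A ≫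
          (α_ (Y ⊗ Y) A A).hom ≫ (Y ⊗ Y) ◁ μ[A] := by
  subst hs
  have h1 : LeftTransfer.Hom.f (t ▷ X.dual Y ≫ (α_ (X.dual Y) (X.dual Y) (X.dual Y)).hom) =
      (t.f ▷ Y ≫ (α_ (Y ⊗ Y) A Y).hom ≫ (Y ⊗ Y) ◁ X.dualφ Y ≫ (α_ (Y ⊗ Y) Y A).inv) ≫
        (α_ Y Y Y).hom ▷ A := LeftTransfer.comp_associator_hom_f _
  have h2 : LeftTransfer.Hom.f ((λ_ (X.dual Y)).inv ≫ t ▷ X.dual Y ≫ (α_ _ _ _).hom ≫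
      X.dual Y ◁ μ[X.dual Y]) = (λ_ Y).inv ≫ LeftTransfer.Hom.f (t ▷ X.dual Y ≫ (α_ _ _ _).hom ≫
      X.dual Y ◁ μ[X.dual Y]) := LeftTransfer.leftUnitor_inv_comp_f _
  rw [h2, ← Category.assoc (t ▷ X.dual Y), LeftTransfer.comp_f, h1]
  rfl

end

/-- If `t` and `κ` have mutually transposed underlying morphisms, then `t` is a Casimir element
exactly if `κ` is a coseparability form. -/
theorem casimir_iff_form {t : 𝟙_ (LeftTransfer A) ⟶ X.dual Y ⊗ X.dual Y}
    {κ : X ⊗ X ⟶ 𝟙_ (RightTransfer A)} {s : 𝟙_ C ⟶ (Y ⊗ Y) ⊗ A} {g : X.X ⊗ X.X ⟶ A}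
    (hs : t.f = s) (hκ : κ.f = g ≫ (ρ_ A).inv) (h : X.tr2 Y s = (ρ_ _).hom ≫ g) :
    (t ≫ μ[X.dual Y] = η[X.dual Y] ∧
      (ρ_ (X.dual Y)).inv ≫ X.dual Y ◁ t ≫ (α_ _ _ _).inv ≫ μ[X.dual Y] ▷ X.dual Y =
        (λ_ (X.dual Y)).inv ≫ t ▷ X.dual Y ≫ (α_ _ _ _).hom ≫ X.dual Y ◁ μ[X.dual Y]) ↔
    (Δ[X] ≫ κ = ε[X] ∧ Δ[X] ▷ X ≫ (α_ X X X).hom ≫ X ◁ κ ≫ (ρ_ X).hom =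
        X ◁ Δ[X] ≫ (α_ X X X).inv ≫ κ ▷ X ≫ (λ_ X).hom) := by
  refine and_congr (Iff.trans ?_ ((X.mate_unit_iff h).trans (comul_comp_form_iff hκ).symm)) ?_
  · subst hs
    exact ⟨fun e => congrArg LeftTransfer.Hom.f e, fun e => LeftTransfer.hom_ext e⟩
  · have hl := X.tr2_mul_left h
    have hr := X.tr2_mul_right h
    rw [← whisker_comul_form_f hκ] at hl
    rw [← comul_whisker_form_f hκ] at hr
    constructor
    · intro e
      have e' := (casimir_left_f X Y t hs).symm.trans
        ((congrArg LeftTransfer.Hom.f e).trans (casimir_right_f X Y t hs))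
      exact hom_ext (X.counit_inj (hr.symm.trans ((congrArg (X.tr2 Y) e').symm.trans hl)))
    · intro e
      rw [e] at hr
      exact LeftTransfer.hom_ext ((casimir_left_f X Y t hs).trans
        ((X.tr2_inj (hl.trans hr.symm)).trans (casimir_right_f X Y t hs).symm))

/-- The coalgebra `(X, ψ)` is coseparable exactly if the dual algebra `(Y, φ)` is separable. -/
theorem isCoseparableCoalgebra_iff_dual :
    IsCoseparableCoalgebra X ↔ IsSeparableAlgebra (X.dual Y) := by
  rw [isCoseparableCoalgebra_iff_form, isSeparableAlgebra_iff_casimir]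
  constructor
  · rintro ⟨κ, hκ⟩
    let k : X.X ⊗ X.X ⟶ A ⊗ 𝟙_ C := κ.f
    have h1 : k = (k ≫ (ρ_ A).hom) ≫ (ρ_ A).inv := by simp
    obtain ⟨s, hs⟩ := X.tr2_surj Y ((ρ_ _).hom ≫ k ≫ (ρ_ A).hom)
    have hc : (X ⊗ X).ψ ≫ A ◁ k ≫ (α_ A A (𝟙_ C)).inv ≫ μ[A] ▷ 𝟙_ C =
        k ▷ A ≫ (α_ A (𝟙_ C) A).hom ≫ A ◁ ((λ_ A).hom ≫ (ρ_ A).inv) ≫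
          (α_ A A (𝟙_ C)).inv ≫ μ[A] ▷ 𝟙_ C := κ.comm
    rw [h1] at hc
    have hs' := (X.mate_comm_iff hs).2 (form_comm_iff.1 hc)
    rw [← Category.assoc] at hs'
    let t : 𝟙_ (LeftTransfer A) ⟶ X.dual Y ⊗ X.dual Y := ⟨s, hs'⟩
    exact ⟨t, (X.casimir_iff_form Y (t := t) rfl h1 hs).2 hκ⟩
  · rintro ⟨t, ht⟩
    let s : 𝟙_ C ⟶ (Y ⊗ Y) ⊗ A := t.f
    let g : X.X ⊗ X.X ⟶ A := (ρ_ _).inv ≫ X.tr2 Y s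
    have hs : X.tr2 Y s = (ρ_ _).hom ≫ g := by simp [g]
    have hc : ((ρ_ A).hom ≫ (λ_ A).inv) ≫ s ▷ A ≫ (α_ _ _ _).hom ≫ (Y ⊗ Y) ◁ μ[A] =
        A ◁ s ≫ (α_ _ _ _).inv ≫ X.dualφ2 Y ▷ A ≫ (α_ _ _ _).hom ≫ (Y ⊗ Y) ◁ μ[A] := t.comm
    rw [Category.assoc] at hc
    let κ : X ⊗ X ⟶ 𝟙_ (RightTransfer A) :=
      ⟨g ≫ (ρ_ A).inv, form_comm_iff.2 ((X.mate_comm_iff hs).1 hc)⟩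
    exact ⟨κ, (X.casimir_iff_form Y (κ := κ) rfl rfl hs).1 ht⟩

end

end RightTransfer

theorem mainTheorem8 {C : Type u} [Category.{v} C] [MonoidalCategory C] [HasCoequalizers C]
    [LeftCoflat C] (A : C) [MonObj A] [LeftModulesRobust (Mon.mk A)]
    (X : RightTransfer A) [ComonObj X] (Y : C) [ExactPairing Y X.X] :
    [IsCoseparableCoalgebra X,
      IsSeparableAlgebra (X.dual Y),
      AlgExtension.IsSeparable (X.dual Y).smashHom,
      IsSeparableAlgebra (AlgExtension.bimod (X.dual Y).smashHom)].TFAE ∧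
    (IsLeftTensorGenerator (𝟙_ C) →
      (IsSeparableFunctor (RightMod.restrictScalars (X.dual Y).smashHom) ↔
        IsCoseparableCoalgebra X)) := by
  have h12 := X.isCoseparableCoalgebra_iff_dual Y
  have h2 := (X.dual Y).isSeparableAlgebra_iff_section
  have h3 := AlgExtension.isSeparable_iff (X.dual Y).smashHom
  have h4 := AlgExtension.isSeparableAlgebra_bimod_iff (X.dual Y).smashHom
  refine ⟨?_, fun hgen => Iff.trans ?_ (h12.trans h2).symm⟩
  · tfae_have 1 ↔ 2 := h12
    tfae_have 2 ↔ 3 := h2.trans h3.symm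
    tfae_have 3 ↔ 4 := h3.trans h4.symm
    tfae_finish
  · exact ⟨AlgExtension.exists_section_of_isSeparableFunctor hgen,
      fun ⟨_, h⟩ => AlgExtension.isSeparableFunctor_of_section h⟩
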